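/- Let $\Omega\subset\mathbb{R}^3$ be a bounded domain with $C^\infty$ boundary, let $A\in W^{1,\infty}(\Omega,\mathbb{R}^3)$ and $q\in L^\infty(\Omega,\mathbb{C})$, and let $L_{A,q}=\sum_{j=1}^3(-i\partial_j+A_j)^2+q$. Let $\tilde\Omega\subset\mathbb{R}^3$ be a bounded open set with $\overline\Omega\subset\tilde\Omega$. Write $z\cdot w=\sum_j z_jw_j$ for $z,w\in\mathbb{C}^3$ and $\|r\|_{H^1_{\mathrm{scl}}(\Omega)}=\|r\|_{L^2(\Omega)}+\|h\nabla r\|_{L^2(\Omega)}$. Then $A$ has an extension to a Lipschitz vector field on $\mathbb{R}^3$ with compact support in $\tilde\Omega$. Moreover, fix any such extension, again denoted $A$, any $\psi\in C_0^\infty(\mathbb{R}^3)$ with $0\le\psi\le1$ and $\int\psi\,dx=1$, any $\alpha,\beta\in S^2$ with $\alpha\cdot\beta=0$, and set $\zeta_0=\alpha+i\beta$. For $h>0$ put $\epsilon=h^{1/3}$, $\psi_\epsilon(x)=\epsilon^{-3}\psi(x/\epsilon)$, $A^\sharp=A*\psi_\epsilon$, $$\Phi(x)=\frac1{2\pi}\int_{\mathbb{R}^2}\frac{-i\zeta_0\cdot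 A^\sharp(x-s_1\alpha-s_2\beta)}{s_1+is_2}\,ds_1\,ds_2,\qquad a=e^{\Phi}.$$ Let $\zeta=\zeta(h)\in\mathbb{C}^3$ be any family with $\zeta\cdot\zeta=0$ for all small $h>0$ and $\zeta-\zeta_0=\mathcal{O}(h)$ as $h\to0^+$. Then there are $h_0>0$ and constants $C$ and $C_\kappa$ ($\kappa\in\mathbb{N}^3$), independent of $h$, such that for every $0<h<h_0$: (i) $a$ is $C^\infty$ on $\mathbb{R}^3$ (in particular $a\in C^\infty(\overline\Omega)$), $\zeta_0\cdot\nabla a=-i(\zeta_0\cdot A^\sharp)a$ in $\Omega$, and $\|\partial^\kappa a\|_{L^\infty(\Omega)}\le C_\kappa h^{-|\kappa|/3}$ for every multi-index $\kappa$; (ii) there is $r\in H^1(\Omega)$ with $\|r\|_{H^1_{\mathrm{scl}}(\Omega)}\le C h^{1/3}$ such that $u(x)=e^{x\cdot\zeta/h}(a(x)+r(x))$ belongs to $H^1(\Omega)$ and is a weak solution of $L_{A,q}u=0$ in $\Omega$, that is, for all $v\in C_0^\infty(\Omega)$, $$\int_\Omega\big(\nabla u\cdot\nabla\bar v-2i(A\cdot\nabla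 u)\bar v+(-i\nabla\cdot A+A^2+q)u\bar v\big)dx=0 .$$ -/

import Mathlib

open MeasureTheory Filter Asymptotics Set
open scoped Topology ENNReal ContDiff ComplexConjugate

noncomputable section

namespace MagneticCGO

/-- Euclidean space `ℝ³`. -/
abbrev E3 : Type := EuclideanSpace ℝ (Fin 3)

/-- The complex space `ℂ³`. -/
abbrev C3 : Type := EuclideanSpace ℂ (Fin 3)

/-- The `j`-th standard basis vector of `ℝ³`. -/
def basisVec (j : Fin 3) : E3 := EuclideanSpace.single j (1 : ℝ)

/-- The inclusion `ℝ³ ⊆ ℂ³`. -/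
def toC3 (x : E3) : C3 := WithLp.toLp 2 (fun j => (x j : ℂ))

/-- The complex bilinear (not sesquilinear) product `z · w = ∑ z_j w_j`. -/
def cdot (z w : C3) : ℂ := ∑ j, z j * w j

section Calculus

variable {F : Type*} [NormedAddCommGroup F] [NormedSpace ℝ F]

/-- The classical partial derivative `∂_j f`. -/
def pderiv (j : Fin 3) (f : E3 → F) (x : E3) : F := fderiv ℝ f x (basisVec j)

/-- The classical partial derivative `∂^κ f = ∂_1^{κ_1} ∂_2^{κ_2} ∂_3^{κ_3} f` of multi-index
order `κ`. -/
def multiDeriv (κ : Fin 3 → ℕ) (f : E3 → F) : E3 → F :=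
  (pderiv 0)^[κ 0] ((pderiv 1)^[κ 1] ((pderiv 2)^[κ 2] f))

/-- `φ ∈ C_0^∞(Ω)`. -/
def IsTestFunction (Ω : Set E3) (φ : E3 → F) : Prop :=
  ContDiff ℝ ∞ φ ∧ HasCompactSupport φ ∧ tsupport φ ⊆ Ω

/-- `v` is the weak (distributional) partial derivative `∂_j u` in `Ω`. -/
def HasWeakPartial (Ω : Set E3) (j : Fin 3) (u v : E3 → F) : Prop :=
  LocallyIntegrableOn u Ω ∧ LocallyIntegrableOn v Ω ∧
    ∀ φ : E3 → ℝ, IsTestFunction Ω φ →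
      ∫ x in Ω, pderiv j φ x • u x = -∫ x in Ω, φ x • v x

/-- `G = (G_1, G_2, G_3)` is the weak gradient of `u` in `Ω`. -/
def HasWeakGradient (Ω : Set E3) (u : E3 → F) (G : Fin 3 → E3 → F) : Prop :=
  ∀ j, HasWeakPartial Ω j u (G j)

/-- The Sobolev space `W^{1,p}(Ω)`: functions in `L^p(Ω)` with weak gradient in `L^p(Ω)`. -/
def MemW1 (p : ℝ≥0∞) (Ω : Set E3) (u : E3 → F) : Prop :=
  MemLp u p (volume.restrict Ω) ∧
    ∃ G : Fin 3 → E3 → F, HasWeakGradient Ω u G ∧ ∀ j, MemLp (G j) p (volume.restrict Ω)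

end Calculus

/-- The Sobolev space `H^1(Ω) = W^{1,2}(Ω)` of complex valued functions. -/
def MemH1 (Ω : Set E3) (u : E3 → ℂ) : Prop := MemW1 2 Ω u

/-- The semiclassical norm `‖u‖_{H^1_scl(Ω)} = ‖u‖_{L^2(Ω)} + ‖h∇u‖_{L^2(Ω)}`. The weak gradient
is unique almost everywhere, so that the infimum runs over a single value; it is `∞` if `u` has no
weak gradient. -/
def h1sclNorm (Ω : Set E3) (h : ℝ) (u : E3 → ℂ) : ℝ≥0∞ :=
  ⨅ (G : Fin 3 → E3 → ℂ) (_ : HasWeakGradient Ω u G),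
    eLpNorm u 2 (volume.restrict Ω) +
      eLpNorm (fun x => (WithLp.toLp 2 (fun j => (h : ℂ) * G j x) : C3)) 2 (volume.restrict Ω)

/-- `Ω` is a bounded domain (connected, nonempty, open) with `C^∞` boundary: near each boundary
point it is a sublevel set `{ρ < 0}` of a smooth function with nonvanishing differential there. -/
structure IsSmoothBoundedDomain (Ω : Set E3) : Prop where
  isOpen : IsOpen Ω
  isConnected : IsConnected Ω
  isBounded : Bornology.IsBounded Ω
  smooth_boundary : ∀ p ∈ frontier Ω, ∃ (U : Set E3) (ρ : E3 → ℝ),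
    IsOpen U ∧ p ∈ U ∧ ContDiff ℝ ∞ ρ ∧ fderiv ℝ ρ p ≠ 0 ∧ ∀ x ∈ U, x ∈ Ω ↔ ρ x < 0

/-- `u` is a weak solution in `Ω` of `L_{A,q} u = ∑_j (-i∂_j + A_j)² u + q u = 0`, that is, for all
`v ∈ C_0^∞(Ω)`,
`∫_Ω (∇u · ∇v̄ - 2i (A · ∇u) v̄ + (-i ∇·A + A² + q) u v̄) dx = 0`.
Here `G = ∇u`, `D j = ∂_j A` are weak derivatives (unique almost everywhere). -/
def IsWeakSolution (Ω : Set E3) (A : E3 → E3) (q : E3 → ℂ) (u : E3 → ℂ) : Prop :=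
  ∃ (G : Fin 3 → E3 → ℂ) (D : Fin 3 → E3 → E3),
    HasWeakGradient Ω u G ∧ HasWeakGradient Ω A D ∧
    ∀ v : E3 → ℂ, IsTestFunction Ω v →
      ∫ x in Ω,
        ((∑ j, G j x * conj (pderiv j v x))
          - 2 * Complex.I * (∑ j, (A x j : ℂ) * G j x) * conj (v x)
          + (-Complex.I * (∑ j, (D j x j : ℂ)) + (∑ j, (A x j : ℂ) ^ 2) + q x)
              * u x * conj (v x)) = 0

/-- `A'` is an extension of `A` from `Ω` to a Lipschitz vector field on `ℝ³`, compactly supported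
in `Ω'`. -/
structure IsLipschitzExtension (Ω Ω' : Set E3) (A A' : E3 → E3) : Prop where
  lipschitz : ∃ K, LipschitzWith K A'
  hasCompactSupport : HasCompactSupport A'
  tsupport_subset : tsupport A' ⊆ Ω'
  ae_eq : A' =ᵐ[volume.restrict Ω] A

/-- `ψ ∈ C_0^∞(ℝ³)`, `0 ≤ ψ ≤ 1`, `∫ ψ = 1`. -/
structure IsMollifier (ψ : E3 → ℝ) : Prop where
  contDiff : ContDiff ℝ ∞ ψ
  hasCompactSupport : HasCompactSupport ψ
  nonneg : ∀ x, 0 ≤ ψ x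
  le_one : ∀ x, ψ x ≤ 1
  integral_eq_one : ∫ x, ψ x = 1

/-- `ψ_ε(x) = ε^{-3} ψ(x/ε)`. -/
def scaledMollifier (ψ : E3 → ℝ) (ε : ℝ) (x : E3) : ℝ := (ε ^ 3)⁻¹ * ψ (ε⁻¹ • x)

/-- The mollification `A^♯ = A * ψ_ε`. -/
def mollify (ψ : E3 → ℝ) (ε : ℝ) (A : E3 → E3) : E3 → E3 :=
  convolution (scaledMollifier ψ ε) A (ContinuousLinearMap.lsmul ℝ ℝ) volume

/-- `ζ_0 = α + iβ`. -/
def zetaZero (α β : E3) : C3 := toC3 α + Complex.I • toC3 β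

/-- The Cauchy operator in the planes parallel to the span of the orthonormal vectors `α, β`:
`(N^{-1} f)(x) = π^{-1} ∫_{ℝ²} f(x - s₁α - s₂β) / (s₁ + i s₂) ds₁ ds₂`. -/
def cauchyOp (α β : E3) (f : E3 → ℂ) (x : E3) : ℂ :=
  (1 / (Real.pi : ℂ)) *
    ∫ s : ℝ × ℝ, (1 / ((s.1 : ℂ) + Complex.I * (s.2 : ℂ))) * f (x - (s.1 • α + s.2 • β))

/-- The phase correction `Φ = ½ N^{-1}(-i ζ_0 · A^♯)` where `A^♯` is the mollification of `A` at
scale `ε`. -/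
def Phi (α β : E3) (ψ : E3 → ℝ) (A : E3 → E3) (ε : ℝ) : E3 → ℂ := fun x =>
  (1 / 2 : ℂ) *
    cauchyOp α β (fun y => -Complex.I * cdot (zetaZero α β) (toC3 (mollify ψ ε A y))) x

/-- The amplitude `a = e^Φ` with mollification scale `ε = h^{1/3}`. -/
def amplitude (α β : E3) (ψ : E3 → ℝ) (A : E3 → E3) (h : ℝ) : E3 → ℂ := fun x =>
  Complex.exp (Phi α β ψ A (h ^ (1 / 3 : ℝ)) x)

end MagneticCGO

end

open MagneticCGO

/-! Write u = e^{x·ζ/h}(a + r). Because ζ·ζ = 0, conjugating L_{A,q} by the exponential produces no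
h⁻² term, and the singular part of the conjugated operator is the transport term -(2/h)(ζ·∇ + iζ·A).
An amplitude that almost annihilates this term leaves a moderate residual, and r must cancel it. Two
facts carry the construction: the transport equation can be solved explicitly, and the conjugated
operator can be inverted with a gain of h.

Transport. The operator ζ₀·∇ = ∂_α + i∂_β is, up to a factor 2, a ∂̄ operator in the planes parallel
to α and β, and the Cauchy transform inverts it (`shiftInt_cauchyKernel_dbar`, `transport_Phi`). Its
kernel is locally integrable, so it loses no derivatives; each derivative put on the mollifier costs
ε⁻¹. As A is Lipschitz, one derivative may be put on A instead, whence ∇a = O(1), Δa = O(ε⁻¹) and A♯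
- A = O(ε). With ε³ = h the residual is dominated by the mollification error ε/h = h^{-2/3}
(`norm_conjOp_le`).

Inversion. The transposed conjugated operator satisfies h⁻¹‖φ‖ ≤ C‖Pφ‖ on test functions, which is a
Carleman estimate with the linear weight Re ζ·x/h (`carleman_ellOp`). A linear weight yields no
positive commutator, so t²/(2s) is added, where t = Re ζ·x. The parameter s depends only on the
coefficient bound, not on h: it is small enough for the commutator to absorb the lower order terms,
while the extra factor stays bounded above and below on a ball. Hahn-Banach and Riesz turn the
estimate into L² solvability with ‖r‖ ≤ Ch‖f‖ (`exists_solution_conj`). The gradient comes from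
interior elliptic regularity, a Caccioppoli inequality for mollified solutions weighted by powers of
h (`exists_weakGradient`). The equation is solved in a ball larger than one containing Ω, so no
boundary regularity enters. Both ‖r‖ and ‖h∇r‖ are then O(h · h^{-2/3}) = O(h^{1/3})
(`exists_cgo_remainder`). The distributional equation for a + r becomes the weak formulation for u
by integration by parts against products of Lipschitz and smooth functions
(`isWeakSolution_phase_mul`).

Extension. Mollifying a W^{1,∞} field shows that it changes by at most a constant times the length
along polygonal paths in Ω. Near a smooth boundary nearby points are joined by short such paths, and
compactness makes the field Lipschitz off a null set. It is then extended together with the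
prescribed value 0 away from the closure of Ω (`exists_isLipschitzExtension`). -/

noncomputable section

namespace MagneticCGO

section

/-! ### Coordinate calculus and integration by parts for smooth functions. -/

section Calculus

variable {F : Type*} [NormedAddCommGroup F] [NormedSpace ℝ F]
variable {R : Type*} [NormedCommRing R] [NormedAlgebra ℝ R]

lemma sum_smul_basisVec (v : E3) : ∑ j, v j • basisVec j = v := by
  ext i
  fin_cases i <;> simp [basisVec, Fin.sum_univ_three]

lemma norm_basisVec (j : Fin 3) : ‖basisVec j‖ = 1 := by simp [basisVec]

lemma fderiv_apply_eq_sum (f : E3 → F) (x v : E3) :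
    fderiv ℝ f x v = ∑ j, v j • pderiv j f x := by
  conv_lhs => rw [← sum_smul_basisVec v]
  simp [pderiv, map_sum]

lemma norm_pderiv_le (j : Fin 3) (f : E3 → F) (x : E3) : ‖pderiv j f x‖ ≤ ‖fderiv ℝ f x‖ := by
  simpa [pderiv, norm_basisVec] using (fderiv ℝ f x).le_opNorm (basisVec j)

lemma abs_coord_le (v : E3) (j : Fin 3) : |v j| ≤ ‖v‖ := by
  simpa using PiLp.norm_apply_le v j

lemma norm_fderiv_le_sum (f : E3 → F) (x : E3) : ‖fderiv ℝ f x‖ ≤ ∑ j, ‖pderiv j f x‖ := by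
  refine ContinuousLinearMap.opNorm_le_bound _ (Finset.sum_nonneg fun _ _ => norm_nonneg _) ?_
  intro v
  rw [fderiv_apply_eq_sum, Finset.sum_mul]
  refine (norm_sum_le _ _).trans (Finset.sum_le_sum fun j _ => ?_)
  rw [norm_smul, mul_comm, Real.norm_eq_abs]
  gcongr
  exact abs_coord_le v j

lemma _root_.ContDiff.pderiv {f : E3 → F} (hf : ContDiff ℝ ∞ f) (j : Fin 3) :
    ContDiff ℝ ∞ (pderiv j f) :=
  (hf.fderiv_right (m := ∞) (by simp)).clm_apply contDiff_const

lemma _root_.ContDiff.pderiv' {n m : WithTop ℕ∞} {f : E3 → F} (hf : ContDiff ℝ n f)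
    (h : m + 1 ≤ n) (j : Fin 3) : ContDiff ℝ m (MagneticCGO.pderiv j f) :=
  (hf.fderiv_right h).clm_apply contDiff_const

lemma tsupport_pderiv_subset (f : E3 → F) (j : Fin 3) : tsupport (pderiv j f) ⊆ tsupport f := by
  refine closure_minimal (fun x hx => ?_) (isClosed_tsupport f)
  refine support_fderiv_subset ℝ (f := f) ?_
  intro h
  exact hx (by simp [pderiv, h])

lemma _root_.HasCompactSupport.pderiv {f : E3 → F} (hf : HasCompactSupport f) (j : Fin 3) :
    HasCompactSupport (pderiv j f) :=
  hf.of_isClosed_subset (isClosed_tsupport _) (tsupport_pderiv_subset f j)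

lemma pderiv_comm {f : E3 → F} (hf : ContDiff ℝ 2 f) (i j : Fin 3) (x : E3) :
    pderiv i (pderiv j f) x = pderiv j (pderiv i f) x := by
  have hd : DifferentiableAt ℝ (fderiv ℝ f) x :=
    (hf.fderiv_right (m := 1) (by norm_num)).differentiable (by simp) x
  have key : ∀ k l : Fin 3, MagneticCGO.pderiv k (MagneticCGO.pderiv l f) x =
      fderiv ℝ (fderiv ℝ f) x (basisVec k) (basisVec l) := by
    intro k l
    change fderiv ℝ (fun y => fderiv ℝ f y (basisVec l)) x (basisVec k) = _
    rw [fderiv_clm_apply hd (differentiableAt_const _)]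
    simp
  rw [key, key]
  exact (hf.contDiffAt.isSymmSndFDerivAt (by simp)).eq _ _

lemma pderiv_add {f g : E3 → F} {x : E3} (hf : DifferentiableAt ℝ f x)
    (hg : DifferentiableAt ℝ g x) (j : Fin 3) :
    pderiv j (fun y => f y + g y) x = pderiv j f x + pderiv j g x := by
  simp [pderiv, fderiv_fun_add hf hg]

lemma pderiv_sub {f g : E3 → F} {x : E3} (hf : DifferentiableAt ℝ f x)
    (hg : DifferentiableAt ℝ g x) (j : Fin 3) :
    pderiv j (fun y => f y - g y) x = pderiv j f x - pderiv j g x := by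
  simp [pderiv, fderiv_fun_sub hf hg]

lemma pderiv_neg (f : E3 → F) (x : E3) (j : Fin 3) :
    pderiv j (fun y => - f y) x = - pderiv j f x := by
  simp [pderiv, fderiv_fun_neg]

lemma pderiv_const (c : F) (x : E3) (j : Fin 3) : pderiv j (fun _ => c) x = 0 := by
  simp [pderiv]

lemma pderiv_sum {ι : Type*} (s : Finset ι) {f : ι → E3 → F} {x : E3}
    (hf : ∀ i ∈ s, DifferentiableAt ℝ (f i) x) (j : Fin 3) :
    pderiv j (fun y => ∑ i ∈ s, f i y) x = ∑ i ∈ s, pderiv j (f i) x := by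
  simp [pderiv, fderiv_fun_sum hf]

lemma pderiv_mul {f g : E3 → R} {x : E3} (hf : DifferentiableAt ℝ f x)
    (hg : DifferentiableAt ℝ g x) (j : Fin 3) :
    pderiv j (fun y => f y * g y) x = pderiv j f x * g x + f x * pderiv j g x := by
  simp only [pderiv, fderiv_fun_mul hf hg]
  simp
  ring

lemma pderiv_const_mul {f : E3 → R} {x : E3} (hf : DifferentiableAt ℝ f x) (c : R) (j : Fin 3) :
    pderiv j (fun y => c * f y) x = c * pderiv j f x := by
  rw [pderiv_mul (differentiableAt_const c) hf, pderiv_const]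
  simp

lemma pderiv_clm_comp {G : Type*} [NormedAddCommGroup G] [NormedSpace ℝ G] (L : F →L[ℝ] G)
    {f : E3 → F} {x : E3} (hf : DifferentiableAt ℝ f x) (j : Fin 3) :
    pderiv j (fun y => L (f y)) x = L (pderiv j f x) := by
  have := L.hasFDerivAt.comp x hf.hasFDerivAt
  simp only [pderiv]
  rw [show (fun y => L (f y)) = L ∘ f from rfl, this.fderiv]
  simp

lemma pderiv_ofReal {f : E3 → ℝ} {x : E3} (hf : DifferentiableAt ℝ f x) (j : Fin 3) :
    pderiv j (fun y => (f y : ℂ)) x = ((pderiv j f x : ℝ) : ℂ) :=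
  pderiv_clm_comp Complex.ofRealCLM hf j

lemma pderiv_re {f : E3 → ℂ} {x : E3} (hf : DifferentiableAt ℝ f x) (j : Fin 3) :
    pderiv j (fun y => (f y).re) x = (pderiv j f x).re :=
  pderiv_clm_comp Complex.reCLM hf j

lemma pderiv_im {f : E3 → ℂ} {x : E3} (hf : DifferentiableAt ℝ f x) (j : Fin 3) :
    pderiv j (fun y => (f y).im) x = (pderiv j f x).im :=
  pderiv_clm_comp Complex.imCLM hf j

lemma pderiv_conj {f : E3 → ℂ} {x : E3} (hf : DifferentiableAt ℝ f x) (j : Fin 3) :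
    pderiv j (fun y => conj (f y)) x = conj (pderiv j f x) :=
  pderiv_clm_comp Complex.conjCLE.toContinuousLinearMap hf j

lemma pderiv_cexp {f : E3 → ℂ} {x : E3} (hf : DifferentiableAt ℝ f x) (j : Fin 3) :
    pderiv j (fun y => Complex.exp (f y)) x = Complex.exp (f x) * pderiv j f x := by
  simp only [pderiv]
  rw [hf.hasFDerivAt.cexp.fderiv]
  simp

lemma pderiv_rexp {f : E3 → ℝ} {x : E3} (hf : DifferentiableAt ℝ f x) (j : Fin 3) :
    pderiv j (fun y => Real.exp (f y)) x = Real.exp (f x) * pderiv j f x := by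
  simp only [pderiv]
  rw [hf.hasFDerivAt.exp.fderiv]
  simp

/-- Integration by parts without boundary terms. -/
lemma integral_mul_pderiv {𝕜 : Type*} [RCLike 𝕜] {f g : E3 → 𝕜} (hf : ContDiff ℝ 1 f)
    (hg : ContDiff ℝ 1 g) (hc : HasCompactSupport g) (j : Fin 3) :
    ∫ x, f x * pderiv j g x = -∫ x, pderiv j f x * g x := by
  have hf' := hf.pderiv' (m := 0) (by simp) j
  have hg' := hg.pderiv' (m := 0) (by simp) j
  refine integral_mul_fderiv_eq_neg_fderiv_mul_of_integrable ?_ ?_ ?_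
    (fun x _ => hf.differentiable (by simp) x) (fun x _ => hg.differentiable (by simp) x)
  · exact (hf'.continuous.mul hg.continuous).integrable_of_hasCompactSupport hc.mul_left
  · exact (hf.continuous.mul hg'.continuous).integrable_of_hasCompactSupport (hc.pderiv j).mul_left
  · exact (hf.continuous.mul hg.continuous).integrable_of_hasCompactSupport hc.mul_left

lemma integral_pderiv_eq_zero {𝕜 : Type*} [RCLike 𝕜] {g : E3 → 𝕜} (hg : ContDiff ℝ 1 g)
    (hc : HasCompactSupport g) (j : Fin 3) : ∫ x, pderiv j g x = 0 := by
  have := integral_mul_pderiv (𝕜 := 𝕜) (f := fun _ => 1) contDiff_const hg hc j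
  simpa [pderiv_const] using this

/-- The Laplacian. -/
def lap (f : E3 → F) (x : E3) : F := ∑ j, pderiv j (pderiv j f) x

end Calculus

/-! ### Stability properties of test functions. -/

section Test

variable {F : Type*} [NormedAddCommGroup F] [NormedSpace ℝ F]
variable {R : Type*} [NormedCommRing R] [NormedAlgebra ℝ R] {Ω : Set E3}

namespace IsTestFunction

lemma continuous {φ : E3 → F} (h : IsTestFunction Ω φ) : Continuous φ := h.1.continuous

lemma differentiableAt {φ : E3 → F} (h : IsTestFunction Ω φ) (x : E3) : DifferentiableAt ℝ φ x :=
  h.1.differentiable (by simp) x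

lemma mono {Ω' : Set E3} {φ : E3 → F} (h : IsTestFunction Ω φ) (hs : Ω ⊆ Ω') :
    IsTestFunction Ω' φ := ⟨h.1, h.2.1, h.2.2.trans hs⟩

lemma of_tsupport_subset {G : Type*} [NormedAddCommGroup G] [NormedSpace ℝ G] {φ : E3 → F}
    {χ : E3 → G} (h : IsTestFunction Ω φ) (hχ : ContDiff ℝ ∞ χ) (hs : tsupport χ ⊆ tsupport φ) :
    IsTestFunction Ω χ :=
  ⟨hχ, h.2.1.of_isClosed_subset (isClosed_tsupport _) hs, hs.trans h.2.2⟩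

lemma of_support {G : Type*} [NormedAddCommGroup G] [NormedSpace ℝ G] {φ : E3 → F} {χ : E3 → G}
    (h : IsTestFunction Ω φ) (hχ : ContDiff ℝ ∞ χ) (hs : ∀ x, φ x = 0 → χ x = 0) :
    IsTestFunction Ω χ :=
  h.of_tsupport_subset hχ (closure_mono fun x hx hx' => hx (hs x hx'))

lemma pderiv {φ : E3 → F} (h : IsTestFunction Ω φ) (j : Fin 3) :
    IsTestFunction Ω (MagneticCGO.pderiv j φ) :=
  h.of_tsupport_subset (h.1.pderiv j) (tsupport_pderiv_subset φ j)

lemma add {φ χ : E3 → F} (h : IsTestFunction Ω φ) (h' : IsTestFunction Ω χ) :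
    IsTestFunction Ω (fun x => φ x + χ x) :=
  ⟨h.1.add h'.1, h.2.1.add h'.2.1,
    (tsupport_add φ χ).trans (union_subset h.2.2 h'.2.2)⟩

lemma mul_left {φ : E3 → R} (h : IsTestFunction Ω φ) {f : E3 → R} (hf : ContDiff ℝ ∞ f) :
    IsTestFunction Ω (fun x => f x * φ x) :=
  h.of_support (hf.mul h.1) (fun x hx => by simp [hx])

lemma zero : IsTestFunction Ω (fun _ => (0 : F)) :=
  ⟨contDiff_const, HasCompactSupport.zero, by
    rw [show (fun _ : E3 => (0 : F)) = 0 from rfl]; simp [tsupport]⟩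

lemma conjugate {φ : E3 → ℂ} (h : IsTestFunction Ω φ) : IsTestFunction Ω (fun x => conj (φ x)) :=
  h.of_support (Complex.conjCLE.contDiff.comp h.1) (fun x hx => by simp [hx])

lemma re {φ : E3 → ℂ} (h : IsTestFunction Ω φ) : IsTestFunction Ω (fun x => (φ x).re) :=
  h.of_support (Complex.reCLM.contDiff.comp h.1) (fun x hx => by simp [hx])

lemma im {φ : E3 → ℂ} (h : IsTestFunction Ω φ) : IsTestFunction Ω (fun x => (φ x).im) :=
  h.of_support (Complex.imCLM.contDiff.comp h.1) (fun x hx => by simp [hx])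

lemma ofReal {φ : E3 → ℝ} (h : IsTestFunction Ω φ) : IsTestFunction Ω (fun x => (φ x : ℂ)) :=
  h.of_support (Complex.ofRealCLM.contDiff.comp h.1) (fun x hx => by simp [hx])

lemma lap {φ : E3 → F} (h : IsTestFunction Ω φ) : IsTestFunction Ω (lap φ) := by
  refine h.of_tsupport_subset (ContDiff.sum fun j _ => (h.1.pderiv j).pderiv j) ?_
  refine closure_minimal (fun x hx => ?_) (isClosed_tsupport φ)
  by_contra hx'
  refine hx (Finset.sum_eq_zero fun j _ => ?_)
  by_contra h0
  exact hx' (tsupport_pderiv_subset φ j (tsupport_pderiv_subset _ j (subset_tsupport _ h0)))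

lemma integrable {φ : E3 → F} (h : IsTestFunction Ω φ) : Integrable φ :=
  h.continuous.integrable_of_hasCompactSupport h.2.1

lemma memLp {φ : E3 → F} (h : IsTestFunction Ω φ) (p : ℝ≥0∞) : MemLp φ p :=
  h.continuous.memLp_of_hasCompactSupport h.2.1

lemma eq_zero {φ : E3 → F} (h : IsTestFunction Ω φ) {x : E3} (hx : x ∉ Ω) : φ x = 0 :=
  image_eq_zero_of_notMem_tsupport fun hx' => hx (h.2.2 hx')

end IsTestFunction
end Test

end

/-! ### Carleman estimate for the Laplacian with a convexified linear weight. -/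

/-- The linear form `x ↦ e · x`. -/
def dotForm (e : E3) : E3 →L[ℝ] ℝ := innerSL ℝ e

lemma dotForm_apply (e x : E3) : dotForm e x = ∑ j, e j * x j := by
  simp [dotForm, PiLp.inner_apply, mul_comm]

lemma pderiv_dotForm (e x : E3) (j : Fin 3) : pderiv j (fun y => dotForm e y) x = e j := by
  have : pderiv j (fun y => dotForm e y) x = dotForm e (basisVec j) := by
    simp [pderiv]
  rw [this, dotForm_apply]
  simp [basisVec]

/-- Here X and Y stand for the symmetric and antisymmetric parts of the conjugated Laplacian applied
to u. Expanding the square gives X² + Y² - 2XY; the two bracketed groups on the right are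
divergences once X and Y are substituted (`carleman_div`). The second group trades the surplus of
(pu)² for a gradient term, at the price of (N/s)uX. Half of X² absorbs that product, and the
condition on p absorbs the remaining u². -/
lemma carleman_pointwise {X Y Z gr u p N s : ℝ} (hs : 0 < s)
    (hp : u ≠ 0 → 1 ≤ 2 * s * p ^ 2) :
    (X - Y) ^ 2 ≥ (N / s) * gr + (2 * N ^ 2 / s) * (p * u) ^ 2 +
      ((-2 * X * Y - (4 / s) * Z ^ 2 - (4 * N ^ 2 / s) * (p * u) ^ 2) +
        (- (N / s) * u * X + (N ^ 2 / s) * (p * u) ^ 2 - (N / s) * gr)) := by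
  have h1 : (N ^ 2 / (2 * s ^ 2)) * u ^ 2 ≤ (N ^ 2 / s) * (p * u) ^ 2 := by
    rcases eq_or_ne u 0 with rfl | h0
    · simp
    rw [div_mul_eq_mul_div, div_mul_eq_mul_div, div_le_div_iff₀ (by positivity) hs]
    nlinarith [mul_le_mul_of_nonneg_left (hp h0) (by positivity : 0 ≤ N ^ 2 * u ^ 2 * s)]
  have h2 : 0 ≤ (X + (N / s) * u) ^ 2 := sq_nonneg _
  have h3 : ((N / s) * u) ^ 2 = 2 * ((N ^ 2 / (2 * s ^ 2)) * u ^ 2) := by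
    field_simp
  have h4 : 0 ≤ (4 / s) * Z ^ 2 := by positivity
  have h5 : (2 * N ^ 2 / s) * (p * u) ^ 2 = 2 * ((N ^ 2 / s) * (p * u) ^ 2) := by ring
  have h6 : (4 * N ^ 2 / s) * (p * u) ^ 2 = 4 * ((N ^ 2 / s) * (p * u) ^ 2) := by ring
  nlinarith [sq_nonneg Y, sq_nonneg X]

/-- The divergence of the vector field used in the Carleman estimate. -/
lemma carleman_div {u : E3 → ℝ} (hu : ContDiff ℝ ∞ u) (e : E3) (τ s : ℝ) (x : E3) (p : E3 → ℝ)
    (hp : ∀ y, p y = τ + dotForm e y / s) (N : ℝ) (hN : N = ∑ j, e j ^ 2) :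
    ∑ j, pderiv j (fun y => -4 * (pderiv j u y * (p y * ∑ k, e k * pderiv k u y)
        - e j / 2 * (p y * ∑ k, pderiv k u y * pderiv k u y))
        - (3 * N / s) * (u y * pderiv j u y)
        - (2 * N * e j) * (p y * p y * p y * (u y * u y))) x =
      (-2 * (lap u x + p x ^ 2 * N * u x) *
        (2 * p x * (∑ k, e k * pderiv k u x) + N / s * u x)
        - (4 / s) * (∑ k, e k * pderiv k u x) ^ 2 - (4 * N ^ 2 / s) * (p x * u x) ^ 2) +
      (- (N / s) * u x * (lap u x + p x ^ 2 * N * u x) + (N ^ 2 / s) * (p x * u x) ^ 2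
        - (N / s) * ∑ k, pderiv k u x ^ 2) := by
  have hd : Differentiable ℝ u := hu.differentiable (by simp)
  have hd1 : ∀ j, Differentiable ℝ (pderiv j u) := fun j => (hu.pderiv j).differentiable (by simp)
  have hpd : Differentiable ℝ p := by
    rw [funext hp]; fun_prop
  have hpj : ∀ j, pderiv j p x = e j / s := by
    intro j
    -- The derivative of p is e_j/s: this is the convexity that produces all the positive terms.
    rw [funext hp, pderiv_add (by fun_prop) (by fun_prop), pderiv_const]
    simp_rw [div_eq_inv_mul]
    rw [pderiv_const_mul (by fun_prop), pderiv_dotForm]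
    ring
  have hc := fun i j => pderiv_comm (hu.of_le (by norm_cast)) i j x
  simp only [Fin.sum_univ_three]
  simp (disch := fun_prop) only [pderiv_add, pderiv_sub, pderiv_mul, pderiv_const, hpj]
  rw [hc 1 0, hc 2 0, hc 2 1]
  simp only [lap, Fin.sum_univ_three, hN]
  ring

/-- The convexified linear weight. -/
def cweight (e : E3) (τ s : ℝ) (x : E3) : ℝ := τ * dotForm e x + dotForm e x * dotForm e x / (2 * s)

lemma contDiff_cweight (e : E3) (τ s : ℝ) : ContDiff ℝ ∞ (cweight e τ s) := by
  unfold cweight; fun_prop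

lemma pderiv_cweight (e : E3) (τ : ℝ) {s : ℝ} (hs : 0 < s) (x : E3) (j : Fin 3) :
    pderiv j (cweight e τ s) x = (τ + dotForm e x / s) * e j := by
  have : cweight e τ s = fun y => τ * dotForm e y + (2 * s)⁻¹ * (dotForm e y * dotForm e y) := by
    funext y; simp only [cweight]; ring
  rw [this]
  simp (disch := fun_prop) only [pderiv_add, pderiv_mul, pderiv_const, pderiv_dotForm]
  field_simp
  ring

/-- With u = e^w v and ∇w = p e, these formulas express ∇u and Δu through v. They serve to identify
X - Y of `carleman_pointwise` with e^w Δv. -/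
lemma carleman_conj {v : E3 → ℝ} (hv : ContDiff ℝ ∞ v) (e : E3) (τ : ℝ) {s : ℝ} (hs : 0 < s)
    (x : E3) (j : Fin 3) :
    pderiv j (fun y => Real.exp (cweight e τ s y) * v y) x =
        Real.exp (cweight e τ s x) * (pderiv j v x + (τ + dotForm e x / s) * e j * v x) ∧
    pderiv j (pderiv j (fun y => Real.exp (cweight e τ s y) * v y)) x =
        Real.exp (cweight e τ s x) * (pderiv j (pderiv j v) x
          + 2 * ((τ + dotForm e x / s) * e j) * pderiv j v x
          + (e j * e j / s) * v x + ((τ + dotForm e x / s) * e j) ^ 2 * v x) := by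
  have hd : Differentiable ℝ v := hv.differentiable (by simp)
  have hd1 : Differentiable ℝ (pderiv j v) := (hv.pderiv j).differentiable (by simp)
  have hw : Differentiable ℝ (cweight e τ s) := (contDiff_cweight e τ s).differentiable (by simp)
  have h1 : ∀ y, pderiv j (fun y => Real.exp (cweight e τ s y) * v y) y =
      Real.exp (cweight e τ s y) * (pderiv j v y + (τ + s⁻¹ * dotForm e y) * e j * v y) := by
    intro y
    simp (disch := fun_prop) only [pderiv_mul, pderiv_rexp]
    rw [pderiv_cweight e τ hs]
    ring
  refine ⟨(h1 x).trans (by ring), ?_⟩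
  rw [funext h1]
  simp (disch := fun_prop) only [pderiv_mul, pderiv_rexp, pderiv_add, pderiv_const, pderiv_dotForm]
  rw [pderiv_cweight e τ hs]
  ring

/-- Carleman estimate for the Laplacian with a convexified linear weight. -/
theorem carleman_laplace {U : Set E3} {v : E3 → ℝ} (hv : IsTestFunction U v) (e : E3) (τ : ℝ)
    {s m N : ℝ} (hs : 0 < s) (hm : 0 ≤ m) (hms : 1 ≤ 2 * s * m ^ 2)
    (hp : ∀ x ∈ U, m ≤ τ + dotForm e x / s) (hN : N = ∑ j, e j ^ 2) :
    (N / (2 * s)) * (∫ x, Real.exp (cweight e τ s x) ^ 2 * ∑ j, pderiv j v x ^ 2)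
      + (N ^ 2 / s * m ^ 2) * (∫ x, Real.exp (cweight e τ s x) ^ 2 * v x ^ 2)
      ≤ ∫ x, Real.exp (cweight e τ s x) ^ 2 * lap v x ^ 2 := by
  set W : E3 → ℝ := fun x => Real.exp (cweight e τ s x) with hW
  have hWs : ContDiff ℝ ∞ W := Real.contDiff_exp.comp (contDiff_cweight e τ s)
  set u : E3 → ℝ := fun y => W y * v y with hu
  have hut : IsTestFunction U u := hv.mul_left hWs
  set p : E3 → ℝ := fun y => τ + dotForm e y / s with hpdef
  have hps : ContDiff ℝ ∞ p := by rw [hpdef]; fun_prop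
  set V : Fin 3 → E3 → ℝ := fun j y => -4 * (pderiv j u y * (p y * ∑ k, e k * pderiv k u y)
        - e j / 2 * (p y * ∑ k, pderiv k u y * pderiv k u y))
        - (3 * N / s) * (u y * pderiv j u y)
        - (2 * N * e j) * (p y * p y * p y * (u y * u y)) with hV
  have hV_test : ∀ j, IsTestFunction U (V j) := by
    intro j
    have h1 : ∀ k, ContDiff ℝ ∞ (pderiv k u) := fun k => hut.1.pderiv k
    have h2 : ContDiff ℝ ∞ u := hut.1
    refine hut.of_tsupport_subset (by rw [hV]; fun_prop) ?_
    refine closure_minimal (fun x hx => ?_) (isClosed_tsupport u)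
    by_contra hx'
    have h3 : u x = 0 := image_eq_zero_of_notMem_tsupport hx'
    have h4 : ∀ k, pderiv k u x = 0 := fun k =>
      image_eq_zero_of_notMem_tsupport fun hk => hx' (tsupport_pderiv_subset u k hk)
    exact hx (by simp [hV, h3, h4])
  have hpt : ∀ x, W x ^ 2 * lap v x ^ 2 ≥ (N / (2 * s)) * (W x ^ 2 * ∑ j, pderiv j v x ^ 2)
      + (N ^ 2 / s * m ^ 2) * (W x ^ 2 * v x ^ 2) + ∑ j, pderiv j (V j) x := by
    intro x
    have hdiv := carleman_div hut.1 e τ s x p (fun y => rfl) N hN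
    have hN0 : 0 ≤ N := hN ▸ Finset.sum_nonneg fun _ _ => sq_nonneg _
    have hm2 : u x ≠ 0 → m ^ 2 ≤ p x ^ 2 := fun h0 => by
      have hx : x ∈ U := by
        by_contra hx
        exact h0 (hut.eq_zero hx)
      exact pow_le_pow_left₀ hm (hp x hx) 2
    have hpw := carleman_pointwise (X := lap u x + p x ^ 2 * N * u x)
      (Y := 2 * p x * (∑ k, e k * pderiv k u x) + N / s * u x) (Z := ∑ k, e k * pderiv k u x)
      (gr := ∑ k, pderiv k u x ^ 2) (u := u x) (p := p x) (N := N) hs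
      (fun h0 => hms.trans (by have := hm2 h0; gcongr))
    have hc := fun j => carleman_conj hv.1 e τ hs x j
    have hX : lap u x + p x ^ 2 * N * u x - (2 * p x * (∑ k, e k * pderiv k u x) + N / s * u x)
        = W x * lap v x := by
      simp only [lap, hu, (hc _).1, (hc _).2, hN, hpdef, Fin.sum_univ_three, hW]
      ring
    rw [hX, ← hdiv] at hpw
    -- Going back from ∇u to e^w ∇v costs |∇w|²u² = N(pu)². Half of the gradient coefficient and one
    -- of the two available copies of (N²/s)(pu)² pay for it; the other copy is kept for `hm3`.
    have hgr : (N / (2 * s)) * (W x ^ 2 * ∑ j, pderiv j v x ^ 2) ≤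
        (N / s) * (∑ k, pderiv k u x ^ 2) + (N ^ 2 / s) * (p x * u x) ^ 2 := by
      have h1 : W x ^ 2 * ∑ j, pderiv j v x ^ 2 ≤
          2 * (∑ k, pderiv k u x ^ 2) + 2 * N * (p x * u x) ^ 2 := by
        simp only [hu, (hc _).1, hN, hpdef, Fin.sum_univ_three, hW]
        rw [← sub_nonneg]
        have : ∀ E a0 a1 a2 q e0 e1 e2 b : ℝ, 2 * ((E * (a0 + q * e0 * b)) ^ 2
          + (E * (a1 + q * e1 * b)) ^ 2 + (E * (a2 + q * e2 * b)) ^ 2)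
          + 2 * (e0 ^ 2 + e1 ^ 2 + e2 ^ 2) * (q * (E * b)) ^ 2
          - E ^ 2 * (a0 ^ 2 + a1 ^ 2 + a2 ^ 2)
          = (E * (a0 + 2 * q * e0 * b)) ^ 2 + (E * (a1 + 2 * q * e1 * b)) ^ 2
            + (E * (a2 + 2 * q * e2 * b)) ^ 2 := by intros; ring
        rw [this]
        positivity
      calc (N / (2 * s)) * (W x ^ 2 * ∑ j, pderiv j v x ^ 2)
          ≤ (N / (2 * s)) * (2 * (∑ k, pderiv k u x ^ 2) + 2 * N * (p x * u x) ^ 2) := by gcongr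
        _ = _ := by field_simp
    have hm3 : (N ^ 2 / s * m ^ 2) * (W x ^ 2 * v x ^ 2) ≤ (N ^ 2 / s) * (p x * u x) ^ 2 := by
      rcases eq_or_ne (u x) 0 with h0 | h0
      · have : W x ^ 2 * v x ^ 2 = 0 := by rw [← mul_pow]; simp [show W x * v x = 0 from h0]
        rw [this, h0]; simp
      · have := hm2 h0
        calc (N ^ 2 / s * m ^ 2) * (W x ^ 2 * v x ^ 2) ≤ (N ^ 2 / s * p x ^ 2) * (W x ^ 2 * v x ^ 2) := by
              gcongr
          _ = _ := by simp only [hu]; ring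
    have h6 : (2 * N ^ 2 / s) * (p x * u x) ^ 2 = 2 * ((N ^ 2 / s) * (p x * u x) ^ 2) := by ring
    have h7 : (W x * lap v x) ^ 2 = W x ^ 2 * lap v x ^ 2 := by ring
    linarith
  have hsq : ∀ {f : E3 → ℝ}, IsTestFunction U f → Integrable (fun x => W x ^ 2 * f x ^ 2) :=
    fun hf => by
      have := (hf.mul_left hf.1).mul_left (hWs.pow 2)
      simpa [sq] using this.integrable
  have hI0 := hsq hv
  have hI1 : Integrable (fun x => W x ^ 2 * ∑ j, pderiv j v x ^ 2) := by
    simp_rw [Finset.mul_sum]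
    exact integrable_finsetSum _ fun j _ => hsq (hv.pderiv j)
  have hI2 := hsq hv.lap
  have hI3 : Integrable (fun x => ∑ j, pderiv j (V j) x) :=
    integrable_finsetSum _ fun j _ => ((hV_test j).pderiv j).integrable
  have hint := integral_mono (((hI1.const_mul (N / (2 * s))).add
    (hI0.const_mul (N ^ 2 / s * m ^ 2))).add hI3) hI2 hpt
  have h0 : ∫ x, ∑ j, pderiv j (V j) x = 0 := by
    rw [integral_finsetSum _ fun j _ => ((hV_test j).pderiv j).integrable]
    exact Finset.sum_eq_zero fun j _ =>
      integral_pderiv_eq_zero ((hV_test j).1.of_le (by norm_cast)) (hV_test j).2.1 j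
  rw [integral_add' ((hI1.const_mul _).add (hI0.const_mul _)) hI3,
    integral_add' (hI1.const_mul _) (hI0.const_mul _), integral_const_mul, integral_const_mul, h0,
    add_zero] at hint
  exact hint

/-! ### Complex functions, lower order terms and removal of the convexification. -/

/-- The second order operator `-Δ + b · ∇ + c`. -/
def ellOp (b : Fin 3 → E3 → ℂ) (c : E3 → ℂ) (v : E3 → ℂ) (x : E3) : ℂ :=
  -lap v x + ∑ j, b j x * pderiv j v x + c x * v x

lemma norm_ellOp_le {b : Fin 3 → E3 → ℂ} {c : E3 → ℂ} {M : ℝ} (hb : ∀ j x, ‖b j x‖ ≤ M)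
    (hc : ∀ x, ‖c x‖ ≤ M) (v : E3 → ℂ) (x : E3) :
    ‖ellOp b c v x‖ ≤ ‖lap v x‖ + ∑ j, M * ‖pderiv j v x‖ + M * ‖v x‖ := by
  unfold ellOp
  refine (norm_add_le _ _).trans (add_le_add ((norm_add_le _ _).trans
    (add_le_add (norm_neg _).le ((norm_sum_le _ _).trans (Finset.sum_le_sum fun j _ => ?_)))) ?_)
  · rw [norm_mul]; gcongr; exact hb j x
  · rw [norm_mul]; gcongr; exact hc x

lemma memLp_ellOp {b : Fin 3 → E3 → ℂ} {c : E3 → ℂ} {M : ℝ} (hb : ∀ j x, ‖b j x‖ ≤ M)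
    (hc : ∀ x, ‖c x‖ ≤ M) (hbm : ∀ j, Measurable (b j)) (hcm : Measurable c) {U : Set E3}
    {v : E3 → ℂ} (hv : IsTestFunction U v) (p : ℝ≥0∞) : MemLp (ellOp b c v) p := by
  have h1 : ∀ j, Measurable (pderiv j v) := fun j => (hv.pderiv j).continuous.measurable
  have h2 : Measurable (lap v) := hv.lap.continuous.measurable
  have h3 : Measurable v := hv.continuous.measurable
  have hg : MemLp (fun x => ‖lap v x‖ + ∑ j, M * ‖pderiv j v x‖ + M * ‖v x‖) p :=
    ((hv.lap.memLp p).norm.add (memLp_finsetSum _ fun j _ =>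
      ((hv.pderiv j).memLp p).norm.const_mul M)).add ((hv.memLp p).norm.const_mul M)
  refine hg.mono' ?_ (Eventually.of_forall fun x => norm_ellOp_le hb hc v x)
  unfold ellOp
  exact Measurable.aestronglyMeasurable (by fun_prop)

lemma lap_re {v : E3 → ℂ} (hv : ContDiff ℝ ∞ v) (x : E3) :
    lap (fun y => (v y).re) x = (lap v x).re := by
  have h1 : ∀ j, pderiv j (fun y => (v y).re) = fun y => (pderiv j v y).re := fun j =>
    funext fun y => pderiv_re (hv.differentiable (by simp) y) j
  simp only [lap, Complex.re_sum, h1]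
  exact Finset.sum_congr rfl fun j _ => pderiv_re ((hv.pderiv j).differentiable (by simp) x) j

lemma lap_im {v : E3 → ℂ} (hv : ContDiff ℝ ∞ v) (x : E3) :
    lap (fun y => (v y).im) x = (lap v x).im := by
  have h1 : ∀ j, pderiv j (fun y => (v y).im) = fun y => (pderiv j v y).im := fun j =>
    funext fun y => pderiv_im (hv.differentiable (by simp) y) j
  simp only [lap, Complex.im_sum, h1]
  exact Finset.sum_congr rfl fun j _ => pderiv_im ((hv.pderiv j).differentiable (by simp) x) j

lemma IsTestFunction.integrable_weight_normSq {U : Set E3} {f : E3 → ℂ} (hf : IsTestFunction U f)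
    {W : E3 → ℝ} (hW : Continuous W) : Integrable (fun x => W x * ‖f x‖ ^ 2) := by
  refine (hW.mul (hf.continuous.norm.pow 2)).integrable_of_hasCompactSupport ?_
  refine hf.2.1.of_isClosed_subset (isClosed_tsupport _) (closure_mono fun x hx hx' => hx ?_)
  simp [hx']

/-- Carleman estimate for the Laplacian acting on complex functions. -/
theorem carleman_laplace_complex {U : Set E3} {v : E3 → ℂ} (hv : IsTestFunction U v) (e : E3)
    (τ : ℝ) {s m N : ℝ} (hs : 0 < s) (hm : 0 ≤ m) (hms : 1 ≤ 2 * s * m ^ 2)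
    (hp : ∀ x ∈ U, m ≤ τ + dotForm e x / s) (hN : N = ∑ j, e j ^ 2) :
    (N / (2 * s)) * (∫ x, Real.exp (cweight e τ s x) ^ 2 * ∑ j, ‖pderiv j v x‖ ^ 2)
      + (N ^ 2 / s * m ^ 2) * (∫ x, Real.exp (cweight e τ s x) ^ 2 * ‖v x‖ ^ 2)
      ≤ ∫ x, Real.exp (cweight e τ s x) ^ 2 * ‖lap v x‖ ^ 2 := by
  set W : E3 → ℝ := fun x => Real.exp (cweight e τ s x) with hW
  have hWs : ContDiff ℝ ∞ W := Real.contDiff_exp.comp (contDiff_cweight e τ s)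
  have hW2 : Continuous (fun x => W x ^ 2) := hWs.continuous.pow 2
  have hre := carleman_laplace hv.re e τ hs hm hms hp hN
  have him := carleman_laplace hv.im e τ hs hm hms hp hN
  have hsq : ∀ {f : E3 → ℝ}, IsTestFunction U f → Integrable (fun x => W x ^ 2 * f x ^ 2) :=
    fun hf => by
      have := (hf.mul_left hf.1).mul_left (hWs.pow 2)
      simpa [sq] using this.integrable
  have hn : ∀ z : ℂ, ‖z‖ ^ 2 = z.re ^ 2 + z.im ^ 2 := fun z => by
    rw [Complex.sq_norm, Complex.normSq_apply]; ring
  have hd : ∀ x, DifferentiableAt ℝ v x := hv.differentiableAt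
  simp only [lap_re hv.1, lap_im hv.1, pderiv_re (hd _), pderiv_im (hd _)] at hre him
  have split : ∀ {f : E3 → ℂ}, IsTestFunction U f →
      ∫ x, W x ^ 2 * ‖f x‖ ^ 2 = (∫ x, W x ^ 2 * (f x).re ^ 2) + ∫ x, W x ^ 2 * (f x).im ^ 2 := by
    intro f hf
    rw [← integral_add (hsq hf.re) (hsq hf.im)]
    exact integral_congr_ae (Eventually.of_forall fun x => by simp only [hn]; ring)
  have splitsum : ∫ x, W x ^ 2 * ∑ j, ‖pderiv j v x‖ ^ 2 =
      (∫ x, W x ^ 2 * ∑ j, (pderiv j v x).re ^ 2) + ∫ x, W x ^ 2 * ∑ j, (pderiv j v x).im ^ 2 := by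
    rw [← integral_add]
    · refine integral_congr_ae (Eventually.of_forall fun x => ?_)
      simp only [hn, Finset.sum_add_distrib]; ring
    · simp_rw [Finset.mul_sum]
      exact integrable_finsetSum _ fun j _ => hsq (hv.pderiv j).re
    · simp_rw [Finset.mul_sum]
      exact integrable_finsetSum _ fun j _ => hsq (hv.pderiv j).im
  rw [split hv, split hv.lap, splitsum]
  linarith

lemma sq_sum_five (a b c d f : ℝ) :
    (a + (b + c + d) + f) ^ 2 ≤ 5 * (a ^ 2 + (b ^ 2 + c ^ 2 + d ^ 2) + f ^ 2) := by
  nlinarith [sq_nonneg (a - b), sq_nonneg (a - c), sq_nonneg (a - d), sq_nonneg (a - f),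
    sq_nonneg (b - c), sq_nonneg (b - d), sq_nonneg (b - f), sq_nonneg (c - d), sq_nonneg (c - f),
    sq_nonneg (d - f)]

set_option maxHeartbeats 800000 in
/-- Carleman estimate for `-Δ + b · ∇ + c` with a linear weight. -/
theorem carleman_ellOp (R M : ℝ) (hR : 0 < R) : ∃ K τ₀ : ℝ, 0 < K ∧ 0 < τ₀ ∧
    ∀ τ : ℝ, τ₀ ≤ τ → ∀ e : E3, 1 / 4 ≤ ‖e‖ ^ 2 → ‖e‖ ≤ 2 →
    ∀ (b : Fin 3 → E3 → ℂ) (c : E3 → ℂ), (∀ j x, ‖b j x‖ ≤ M) → (∀ x, ‖c x‖ ≤ M) →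
      (∀ j, Measurable (b j)) → Measurable c →
    ∀ v : E3 → ℂ, IsTestFunction (Metric.ball 0 R) v →
      τ ^ 2 * (∫ x, Real.exp (τ * dotForm e x) ^ 2 * ‖v x‖ ^ 2) ≤
        K * ∫ x, Real.exp (τ * dotForm e x) ^ 2 * ‖ellOp b c v x‖ ^ 2 := by
  set s : ℝ := 1 / (40 * (M ^ 2 + 1)) with hs_def
  have hs : 0 < s := by positivity
  -- The number 14 exceeds 5/(3/8), the quotient of the constants in `hfin`, and the exponential
  -- bounds e^{t²/s} on the ball, where |t| ≤ 2R. The first summand of the threshold for τ keeps p ≥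
  -- τ/2 on the ball; the second secures `hms`.
  refine ⟨14 * Real.exp (4 * R ^ 2 / s), 4 * R / s + 80 * (M ^ 2 + 1), by positivity,
    by positivity, ?_⟩
  intro τ hτ e he1 he2 b c hb hc hbm hcm v hv
  have hRs : 0 < 4 * R / s := by positivity
  have hτ1 : 4 * R / s ≤ τ := by nlinarith
  have hτ2 : 80 * (M ^ 2 + 1) ≤ τ := by linarith
  have hτ80 : 80 ≤ τ := by nlinarith [sq_nonneg M]
  have hτ3 : 80 * (M ^ 2 + 1) ≤ τ ^ 2 := by nlinarith
  set N : ℝ := ∑ j, e j ^ 2 with hN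
  have hNe : ‖e‖ ^ 2 = N := by
    rw [EuclideanSpace.norm_sq_eq]; simp [hN]
  have hN1 : 1 / 4 ≤ N := hNe ▸ he1
  have hdot : ∀ x ∈ Metric.ball (0 : E3) R, |dotForm e x| ≤ 2 * R := by
    intro x hx
    have hx' : ‖x‖ < R := by simpa using hx
    calc |dotForm e x| ≤ ‖e‖ * ‖x‖ := abs_real_inner_le_norm e x
      _ ≤ 2 * R := by gcongr
  have hms : 1 ≤ 2 * s * (τ / 2) ^ 2 := by
    have : s * (80 * (M ^ 2 + 1)) = 2 := by rw [hs_def]; field_simp; norm_num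
    nlinarith [mul_le_mul_of_nonneg_left hτ3 hs.le]
  have hp : ∀ x ∈ Metric.ball (0 : E3) R, τ / 2 ≤ τ + dotForm e x / s := by
    intro x hx
    have h1 : -(2 * R) / s ≤ dotForm e x / s := by
      gcongr; exact (abs_le.1 (hdot x hx)).1
    have h2 : -(2 * R) / s = - (4 * R / s) / 2 := by ring
    linarith
  have hcar := carleman_laplace_complex hv e τ hs (by linarith) hms hp hN
  set W : E3 → ℝ := fun x => Real.exp (cweight e τ s x) with hW
  have hWs : ContDiff ℝ ∞ W := Real.contDiff_exp.comp (contDiff_cweight e τ s)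
  have hW2 : Continuous (fun x => W x ^ 2) := hWs.continuous.pow 2
  set I0 := ∫ x, W x ^ 2 * ‖v x‖ ^ 2 with hI0
  set I1 := ∫ x, W x ^ 2 * ∑ j, ‖pderiv j v x‖ ^ 2 with hI1
  have i0 : Integrable (fun x => W x ^ 2 * ‖v x‖ ^ 2) := hv.integrable_weight_normSq hW2
  have i1 : Integrable (fun x => W x ^ 2 * ∑ j, ‖pderiv j v x‖ ^ 2) := by
    simp_rw [Finset.mul_sum]
    exact integrable_finsetSum _ fun j _ => (hv.pderiv j).integrable_weight_normSq hW2
  have iL : ∀ {V : E3 → ℝ}, Continuous V → Integrable (fun x => V x ^ 2 * ‖ellOp b c v x‖ ^ 2) := by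
    intro V hV
    obtain ⟨B, hB⟩ : ∃ B, ∀ x ∈ tsupport v, ‖V x ^ 2‖ ≤ B :=
      hv.2.1.isCompact.exists_bound_of_continuousOn (hV.pow 2).continuousOn
    have hL := (memLp_ellOp hb hc hbm hcm hv 2).integrable_norm_pow (by norm_num)
    refine (hL.const_mul B).mono' ?_ (Eventually.of_forall fun x => ?_)
    · exact ((hV.pow 2).aestronglyMeasurable).mul hL.aestronglyMeasurable
    · by_cases hx : x ∈ tsupport v
      · have := hB x hx
        rw [norm_mul, Real.norm_of_nonneg (by positivity : 0 ≤ ‖ellOp b c v x‖ ^ (2:ℕ))]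
        exact mul_le_mul_of_nonneg_right this (by positivity)
      · have h0 : ∀ {f : E3 → ℂ}, IsTestFunction (tsupport v) f → f x = 0 := fun hf => hf.eq_zero hx
        have hv' : IsTestFunction (tsupport v) v := ⟨hv.1, hv.2.1, subset_rfl⟩
        simp [ellOp, h0 hv', h0 hv'.lap, h0 (hv'.pderiv _)]
  have hmain : ∫ x, W x ^ 2 * ‖lap v x‖ ^ 2 ≤
      5 * (∫ x, W x ^ 2 * ‖ellOp b c v x‖ ^ 2) + 5 * M ^ 2 * I1 + 5 * M ^ 2 * I0 := by
    rw [hI0, hI1, ← integral_const_mul, ← integral_const_mul, ← integral_const_mul,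
      ← integral_add' ((iL hWs.continuous).const_mul _) (i1.const_mul _),
      ← integral_add' (((iL hWs.continuous).const_mul _).add (i1.const_mul _)) (i0.const_mul _)]
    refine integral_mono (hv.lap.integrable_weight_normSq hW2)
      ((((iL hWs.continuous).const_mul _).add (i1.const_mul _)).add (i0.const_mul _)) fun x => ?_
    have h1 : ‖lap v x‖ ≤ ‖ellOp b c v x‖ + ∑ j, M * ‖pderiv j v x‖ + M * ‖v x‖ := by
      have : lap v x = -ellOp b c v x + ∑ j, b j x * pderiv j v x + c x * v x := by
        simp only [ellOp]; ring
      rw [this]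
      refine (norm_add_le _ _).trans (add_le_add ((norm_add_le _ _).trans
        (add_le_add (norm_neg _).le ((norm_sum_le _ _).trans
          (Finset.sum_le_sum fun j _ => ?_)))) ?_)
      · rw [norm_mul]; gcongr; exact hb j x
      · rw [norm_mul]; gcongr; exact hc x
    have h2 : ‖lap v x‖ ^ 2 ≤ 5 * ‖ellOp b c v x‖ ^ 2 + 5 * M ^ 2 * ∑ j, ‖pderiv j v x‖ ^ 2
        + 5 * M ^ 2 * ‖v x‖ ^ 2 := by
      refine (pow_le_pow_left₀ (norm_nonneg _) h1 2).trans ?_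
      rw [Fin.sum_univ_three, Fin.sum_univ_three]
      refine (sq_sum_five _ _ _ _ _).trans (le_of_eq ?_)
      ring
    have := mul_le_mul_of_nonneg_left h2 (sq_nonneg (W x))
    simp only [Pi.add_apply]
    linarith
  have hI0n : 0 ≤ I0 := integral_nonneg fun x => by positivity
  have hI1n : 0 ≤ I1 := integral_nonneg fun x => by positivity
  -- The choice of s is made here: since N ≥ 1/4, the gradient coefficient 20N(M² + 1) dominates the
  -- 5M² produced by the first order terms.
  have hc1 : 5 * M ^ 2 ≤ N / (2 * s) := by
    have : N / (2 * s) = N * (20 * (M ^ 2 + 1)) := by rw [hs_def]; field_simp; norm_num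
    rw [this]
    nlinarith [sq_nonneg M]
  have hc2 : 5 * M ^ 2 + (3 / 8) * τ ^ 2 ≤ N ^ 2 / s * (τ / 2) ^ 2 := by
    have h1 : N ^ 2 / s * (τ / 2) ^ 2 = N ^ 2 * (10 * (M ^ 2 + 1)) * τ ^ 2 := by
      rw [hs_def]; field_simp; norm_num
    have h2 : 1 / 16 ≤ N ^ 2 := by nlinarith
    have h3 : (1 / 16) * (10 * (M ^ 2 + 1)) * τ ^ 2 ≤ N ^ 2 * (10 * (M ^ 2 + 1)) * τ ^ 2 := by
      gcongr
    rw [h1]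
    nlinarith [sq_nonneg M, mul_nonneg (sq_nonneg M) (by nlinarith : 0 ≤ τ ^ 2 - 20)]
  have hfin : (3 / 8) * τ ^ 2 * I0 ≤ 5 * ∫ x, W x ^ 2 * ‖ellOp b c v x‖ ^ 2 := by
    have a1 := mul_le_mul_of_nonneg_right hc1 hI1n
    have a2 := mul_le_mul_of_nonneg_right hc2 hI0n
    linarith
  have hWform : ∀ x, W x ^ 2 = Real.exp (τ * dotForm e x) ^ 2 *
      Real.exp (dotForm e x ^ 2 / s) := by
    intro x
    simp only [hW, cweight, ← Real.exp_nat_mul, ← Real.exp_add]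
    congr 1
    field_simp
    push_cast
    ring
  have hτc : Continuous fun x => Real.exp (τ * dotForm e x) := by fun_prop
  -- The convexified weight is the linear one times e^{t²/s}, which is at least 1 everywhere and
  -- bounded independently of τ on the ball.
  have hlow : ∫ x, Real.exp (τ * dotForm e x) ^ 2 * ‖v x‖ ^ 2 ≤ I0 := by
    refine integral_mono (hv.integrable_weight_normSq (hτc.pow 2)) i0 fun x => ?_
    simp only [hWform]
    gcongr
    exact le_mul_of_one_le_right (by positivity) (Real.one_le_exp (by positivity))
  have hup : ∫ x, W x ^ 2 * ‖ellOp b c v x‖ ^ 2 ≤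
      Real.exp (4 * R ^ 2 / s) * ∫ x, Real.exp (τ * dotForm e x) ^ 2 * ‖ellOp b c v x‖ ^ 2 := by
    rw [← integral_const_mul]
    refine integral_mono (iL hWs.continuous) ((iL hτc).const_mul _) fun x => ?_
    simp only [hWform]
    by_cases hx : x ∈ Metric.ball (0 : E3) R
    · have : dotForm e x ^ 2 ≤ 4 * R ^ 2 := by
        have := hdot x hx
        rw [← sq_abs]; nlinarith [abs_nonneg (dotForm e x)]
      rw [← mul_assoc, mul_comm (Real.exp (4 * R ^ 2 / s))]
      gcongr
    · simp [ellOp, hv.eq_zero hx, hv.lap.eq_zero hx, (hv.pderiv _).eq_zero hx]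
  have := mul_le_mul_of_nonneg_left hlow (sq_nonneg τ)
  nlinarith

/-! ### Duality and L² solvability of the conjugated equation. -/

section

section L2

variable {α : Type*} [MeasurableSpace α] {μ : Measure α}

lemma toReal_eLpNorm_sq {F : Type*} [NormedAddCommGroup F] {f : α → F} (hf : MemLp f 2 μ) :
    (eLpNorm f 2 μ).toReal ^ 2 = ∫ x, ‖f x‖ ^ 2 ∂μ := by
  rw [hf.eLpNorm_eq_integral_rpow_norm (by norm_num) (by norm_num)]
  have h0 : 0 ≤ ∫ x, ‖f x‖ ^ (2 : ℝ) ∂μ := integral_nonneg fun x => by positivity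
  simp only [ENNReal.toReal_ofNat, Real.rpow_two] at h0 ⊢
  rw [ENNReal.toReal_ofReal (by positivity), ← Real.rpow_natCast, ← Real.rpow_mul h0]
  norm_num

variable {𝕜 : Type*} [RCLike 𝕜]

/-- Conjugating the first factor converts the sesquilinear inner product into the bilinear pairing
in which all transposes are taken here. -/
lemma inner_toLp_conj {f g : α → 𝕜} (hg : MemLp g 2 μ)
    (hf' : MemLp (fun x => conj (f x)) 2 μ) :
    inner 𝕜 (hf'.toLp _) (hg.toLp _) = ∫ x, f x * g x ∂μ := by
  rw [L2.inner_def]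
  refine integral_congr_ae ?_
  filter_upwards [hf'.coeFn_toLp, hg.coeFn_toLp] with x h1 h2
  rw [h1, h2, RCLike.inner_apply]
  simp [mul_comm]

lemma MemLp.conjugate {f : α → 𝕜} {p : ℝ≥0∞} (hf : MemLp f p μ) :
    MemLp (fun x => conj (f x)) p μ :=
  hf.of_le (RCLike.continuous_conj.comp_aestronglyMeasurable hf.1)
    (Eventually.of_forall fun x => by simp)

lemma norm_integral_mul_le {f g : α → 𝕜} (hf : MemLp f 2 μ) (hg : MemLp g 2 μ) :
    ‖∫ x, f x * g x ∂μ‖ ≤ (eLpNorm f 2 μ).toReal * (eLpNorm g 2 μ).toReal := by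
  have hf' := MemLp.conjugate hf
  rw [← inner_toLp_conj hg hf']
  refine (norm_inner_le_norm _ _).trans (le_of_eq ?_)
  rw [Lp.norm_toLp, Lp.norm_toLp]
  congr 2
  exact eLpNorm_congr_norm_ae (Eventually.of_forall fun x => by simp)

lemma sq_integral_mul_le {f g : α → ℝ} (hf : MemLp f 2 μ) (hg : MemLp g 2 μ) :
    (∫ x, f x * g x ∂μ) ^ 2 ≤ (∫ x, f x ^ 2 ∂μ) * ∫ x, g x ^ 2 ∂μ := by
  have h1 := toReal_eLpNorm_sq hf
  have h2 := toReal_eLpNorm_sq hg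
  simp only [Real.norm_eq_abs, sq_abs] at h1 h2
  rw [← h1, ← h2, ← mul_pow, ← sq_abs]
  exact pow_le_pow_left₀ (abs_nonneg _) (norm_integral_mul_le hf hg) 2

end L2

/-- A functional which is dominated by `T` is represented by a vector. -/
theorem exists_inner_eq_of_le {𝕜 V H : Type*} [RCLike 𝕜] [AddCommGroup V] [Module 𝕜 V] [NormedAddCommGroup H]
    [InnerProductSpace 𝕜 H] [CompleteSpace H] (T : V →ₗ[𝕜] H) (ℓ : V →ₗ[𝕜] 𝕜) {K : ℝ} (hK : 0 ≤ K)
    (h : ∀ v, ‖ℓ v‖ ≤ K * ‖T v‖) : ∃ g : H, ‖g‖ ≤ K ∧ ∀ v, inner 𝕜 g (T v) = ℓ v := by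
  -- The inequality makes ℓ factor through the range of T, on which it is bounded by K. Hahn-Banach
  -- extends it and Riesz represents it.
  have hker : LinearMap.ker T ≤ LinearMap.ker ℓ := by
    intro v hv
    have h1 := h v
    rw [LinearMap.mem_ker.1 hv, norm_zero, mul_zero] at h1
    exact LinearMap.mem_ker.2 (norm_le_zero_iff.1 h1)
  let f0 : LinearMap.range T →ₗ[𝕜] 𝕜 :=
    ((LinearMap.ker T).liftQ ℓ hker).comp T.quotKerEquivRange.symm.toLinearMap
  have hf0 : ∀ v, f0 ⟨T v, v, rfl⟩ = ℓ v := by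
    intro v
    have : T.quotKerEquivRange.symm ⟨T v, v, rfl⟩ = (LinearMap.ker T).mkQ v := by
      rw [LinearEquiv.symm_apply_eq]; rfl
    simp [f0, this]
  let f : StrongDual 𝕜 (LinearMap.range T) := f0.mkContinuous K (by
    rintro ⟨_, v, rfl⟩
    rw [hf0]
    exact h v)
  obtain ⟨g, hg, hgn⟩ := exists_extension_norm_eq (LinearMap.range T) f
  refine ⟨(InnerProductSpace.toDual 𝕜 H).symm g, ?_, fun v => ?_⟩
  · rw [LinearIsometryEquiv.norm_map, hgn]
    exact LinearMap.mkContinuous_norm_le _ hK _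
  · rw [InnerProductSpace.toDual_symm_apply]
    exact (hg ⟨T v, v, rfl⟩).trans (hf0 v)

/-- The space of complex test functions. -/
def testSpace (U : Set E3) : Submodule ℂ (E3 → ℂ) where
  carrier := {φ | IsTestFunction U φ}
  add_mem' h h' := IsTestFunction.add h h'
  zero_mem' := IsTestFunction.zero
  smul_mem' _ _ h := IsTestFunction.mul_left h contDiff_const

lemma lap_add {f g : E3 → ℂ} (hf : ContDiff ℝ ∞ f) (hg : ContDiff ℝ ∞ g) (x : E3) :
    lap (fun y => f y + g y) x = lap f x + lap g x := by
  have hd : ∀ {u : E3 → ℂ}, ContDiff ℝ ∞ u → ∀ y, DifferentiableAt ℝ u y := fun hu y =>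
    hu.differentiable (by simp) y
  have h1 : ∀ j, pderiv j (fun y => f y + g y) = fun y => pderiv j f y + pderiv j g y := fun j =>
    funext fun y => pderiv_add (hd hf y) (hd hg y) j
  simp only [lap, h1, ← Finset.sum_add_distrib]
  exact Finset.sum_congr rfl fun j _ => pderiv_add (hd (hf.pderiv j) x) (hd (hg.pderiv j) x) j

lemma lap_const_mul {f : E3 → ℂ} (hf : ContDiff ℝ ∞ f) (a : ℂ) (x : E3) :
    lap (fun y => a * f y) x = a * lap f x := by
  have hd : ∀ {u : E3 → ℂ}, ContDiff ℝ ∞ u → ∀ y, DifferentiableAt ℝ u y := fun hu y =>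
    hu.differentiable (by simp) y
  have h1 : ∀ j, pderiv j (fun y => a * f y) = fun y => a * pderiv j f y := fun j =>
    funext fun y => pderiv_const_mul (hd hf y) a j
  simp only [lap, h1, Finset.mul_sum]
  exact Finset.sum_congr rfl fun j _ => pderiv_const_mul (hd (hf.pderiv j) x) a j

lemma ellOp_add (b : Fin 3 → E3 → ℂ) (c : E3 → ℂ) {f g : E3 → ℂ} (hf : ContDiff ℝ ∞ f)
    (hg : ContDiff ℝ ∞ g) (x : E3) :
    ellOp b c (fun y => f y + g y) x = ellOp b c f x + ellOp b c g x := by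
  simp only [ellOp, lap_add hf hg, pderiv_add (hf.differentiable (by simp) x)
    (hg.differentiable (by simp) x), mul_add, Finset.sum_add_distrib]
  ring

lemma ellOp_const_mul (b : Fin 3 → E3 → ℂ) (c : E3 → ℂ) {f : E3 → ℂ} (hf : ContDiff ℝ ∞ f)
    (a : ℂ) (x : E3) : ellOp b c (fun y => a * f y) x = a * ellOp b c f x := by
  simp only [ellOp, lap_const_mul hf, pderiv_const_mul (hf.differentiable (by simp) x),
    mul_add, Finset.mul_sum]
  simp only [mul_left_comm a, mul_neg]

/-- The complex exponential `e^{x·ζ/h}`. -/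
def phase (ζ : C3) (h : ℝ) (x : E3) : ℂ := Complex.exp (cdot (toC3 x) ζ / (h : ℂ))

lemma cdot_toC3 (x : E3) (ζ : C3) : cdot (toC3 x) ζ = ∑ j, (x j : ℂ) * ζ j := rfl

lemma contDiff_phase (ζ : C3) (h : ℝ) : ContDiff ℝ ∞ (phase ζ h) := by
  unfold phase
  simp only [cdot_toC3]
  have : ∀ j : Fin 3, ContDiff ℝ ∞ (fun x : E3 => (x j : ℂ)) := fun j =>
    Complex.ofRealCLM.contDiff.comp (by fun_prop)
  fun_prop

lemma pderiv_coord (x : E3) (k j : Fin 3) :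
    pderiv j (fun y : E3 => (y k : ℂ)) x = if j = k then 1 else 0 := by
  rw [pderiv_ofReal (by fun_prop)]
  have : pderiv j (fun y : E3 => y k) x = (basisVec j) k := by
    have : (fun y : E3 => y k) = EuclideanSpace.proj (𝕜 := ℝ) k := rfl
    rw [this, pderiv, ContinuousLinearMap.fderiv]
    simp
  rw [this]
  by_cases hjk : j = k
  · subst hjk; simp [basisVec]
  · simp [basisVec, hjk, Ne.symm hjk]

lemma pderiv_phase (ζ : C3) (h : ℝ) (x : E3) (j : Fin 3) :
    pderiv j (phase ζ h) x = phase ζ h x * (ζ j / h) := by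
  have hc : ∀ k : Fin 3, Differentiable ℝ (fun x : E3 => (x k : ℂ)) := fun k =>
    Complex.ofRealCLM.differentiable.comp (by fun_prop)
  unfold phase
  simp only [cdot_toC3, div_eq_mul_inv]
  rw [pderiv_cexp (by fun_prop), pderiv_mul (by fun_prop) (by fun_prop),
    pderiv_sum _ (fun i _ => by fun_prop)]
  simp (disch := fun_prop) only [pderiv_mul, pderiv_const, pderiv_coord]
  simp

lemma phase_neg_mul (ζ : C3) (h : ℝ) (x : E3) : phase (-ζ) h x * phase ζ h x = 1 := by
  unfold phase
  rw [← Complex.exp_add]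
  simp [cdot_toC3, neg_div]

/-- The real part of a complex vector. -/
def reVec (ζ : C3) : E3 := WithLp.toLp 2 fun j => (ζ j).re

lemma norm_phase (ζ : C3) (h : ℝ) (x : E3) :
    ‖phase ζ h x‖ = Real.exp (h⁻¹ * dotForm (reVec ζ) x) := by
  rw [phase, Complex.norm_exp, dotForm_apply, cdot_toC3, Complex.div_ofReal_re, Complex.re_sum]
  congr 1
  rw [div_eq_inv_mul]
  congr 1
  refine Finset.sum_congr rfl fun j _ => ?_
  simp [reVec, mul_comm]

/-- The exponential contributes ζ_j/h for each derivative. The only h⁻² term is (ζ·ζ)/h², which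
vanishes; this is why the components of ζ must form a null vector. -/
lemma ellOp_phase_mul (b : Fin 3 → E3 → ℂ) (c : E3 → ℂ) {ζ : C3} {h : ℝ}
    (hζ : cdot ζ ζ = 0) {φ : E3 → ℂ} (hφ : ContDiff ℝ ∞ φ) (x : E3) :
    ellOp b c (fun y => phase ζ h y * φ y) x = phase ζ h x *
      ellOp (fun j y => b j y - 2 * (ζ j / h)) (fun y => c y + ∑ j, b j y * (ζ j / h)) φ x := by
  have hd : Differentiable ℝ φ := hφ.differentiable (by simp)
  have hd1 : ∀ j, Differentiable ℝ (pderiv j φ) := fun j => (hφ.pderiv j).differentiable (by simp)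
  have hp : Differentiable ℝ (phase ζ h) := (contDiff_phase ζ h).differentiable (by simp)
  have h1 : ∀ j, pderiv j (fun y => phase ζ h y * φ y) =
      fun y => phase ζ h y * (ζ j / h) * φ y + phase ζ h y * pderiv j φ y := fun j => by
    funext y
    rw [pderiv_mul (hp y) (hd y), pderiv_phase]
  have h2 : ∀ j, pderiv j (pderiv j (fun y => phase ζ h y * φ y)) x =
      phase ζ h x * (pderiv j (pderiv j φ) x + 2 * (ζ j / h) * pderiv j φ x
        + (ζ j * ζ j / (h * h)) * φ x) := fun j => by
    rw [h1]
    simp (disch := fun_prop) only [pderiv_add, pderiv_mul, pderiv_phase, pderiv_const]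
    ring
  have h3 : ζ 0 * ζ 0 + ζ 1 * ζ 1 + ζ 2 * ζ 2 = 0 := by
    simpa [cdot, Fin.sum_univ_three] using hζ
  simp only [ellOp, lap, h2]
  simp only [h1, Fin.sum_univ_three]
  linear_combination (-(phase ζ h x * φ x / (h * h))) * h3

lemma phase_mul_neg (ζ : C3) (h : ℝ) (x : E3) : phase ζ h x * phase (-ζ) h x = 1 := by
  rw [mul_comm, phase_neg_mul]

/-- The first order coefficient of the conjugated operator. -/
def conjB (b : Fin 3 → E3 → ℂ) (ζ : C3) (h : ℝ) (j : Fin 3) (y : E3) : ℂ := b j y + 2 * (ζ j / h)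

/-- The zeroth order coefficient of the conjugated operator. -/
def conjC (b : Fin 3 → E3 → ℂ) (c : E3 → ℂ) (ζ : C3) (h : ℝ) (y : E3) : ℂ :=
  c y - ∑ j, b j y * (ζ j / h)

lemma cdot_neg_neg (ζ : C3) : cdot (-ζ) (-ζ) = cdot ζ ζ := by simp [cdot]

lemma ellOp_conj (b : Fin 3 → E3 → ℂ) (c : E3 → ℂ) {ζ : C3} {h : ℝ}
    (hζ : cdot ζ ζ = 0) {φ : E3 → ℂ} (hφ : ContDiff ℝ ∞ φ) (x : E3) :
    ellOp b c (fun y => phase (-ζ) h y * φ y) x =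
      phase (-ζ) h x * ellOp (conjB b ζ h) (conjC b c ζ h) φ x := by
  rw [ellOp_phase_mul b c (by rw [cdot_neg_neg, hζ]) hφ]
  have h1 : (fun j y => b j y - 2 * ((-ζ) j / h)) = conjB b ζ h := by
    funext j y; simp only [conjB, PiLp.neg_apply]; ring
  have h2 : (fun y => c y + ∑ j, b j y * ((-ζ) j / h)) = conjC b c ζ h := by
    funext y
    simp only [conjC, PiLp.neg_apply, neg_div, mul_neg, Finset.sum_neg_distrib]
    ring
  rw [h1, h2]

lemma norm_conjB_le {b : Fin 3 → E3 → ℂ} {M : ℝ} (hb : ∀ j x, ‖b j x‖ ≤ M) (ζ : C3) {h : ℝ}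
    (hh : 0 < h) (j : Fin 3) (x : E3) : ‖conjB b ζ h j x‖ ≤ M + 2 * (‖ζ‖ / h) := by
  refine (norm_add_le _ _).trans (add_le_add (hb j x) ?_)
  rw [norm_mul, norm_div, Complex.norm_real, Real.norm_of_nonneg hh.le]
  have := PiLp.norm_apply_le ζ j
  simp only [RCLike.norm_ofNat]
  gcongr

lemma norm_conjC_le {b : Fin 3 → E3 → ℂ} {c : E3 → ℂ} {M : ℝ} (hb : ∀ j x, ‖b j x‖ ≤ M)
    (hc : ∀ x, ‖c x‖ ≤ M) (ζ : C3) {h : ℝ} (hh : 0 < h) (x : E3) :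
    ‖conjC b c ζ h x‖ ≤ M + 3 * (M * (‖ζ‖ / h)) := by
  refine (norm_sub_le _ _).trans (add_le_add (hc x) ((norm_sum_le _ _).trans ?_))
  have h1 : ∀ j ∈ Finset.univ, ‖b j x * (ζ j / h)‖ ≤ M * (‖ζ‖ / h) := fun j _ => by
    rw [norm_mul, norm_div, Complex.norm_real, Real.norm_of_nonneg hh.le]
    have := PiLp.norm_apply_le ζ j
    have := (norm_nonneg _).trans (hb j x)
    gcongr
    exact hb j x
  refine (Finset.sum_le_card_nsmul _ _ _ h1).trans (le_of_eq ?_)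
  simp

lemma measurable_conjB {b : Fin 3 → E3 → ℂ} (hbm : ∀ j, Measurable (b j)) (ζ : C3) (h : ℝ)
    (j : Fin 3) : Measurable (conjB b ζ h j) := (hbm j).add_const _

lemma measurable_conjC {b : Fin 3 → E3 → ℂ} {c : E3 → ℂ} (hbm : ∀ j, Measurable (b j))
    (hcm : Measurable c) (ζ : C3) (h : ℝ) : Measurable (conjC b c ζ h) := by
  unfold conjC; fun_prop

/-- Solvability in `L²` of the conjugated equation in a ball, in the sense of distributions. -/
theorem exists_solution_conj (R M : ℝ) (hR : 0 < R) : ∃ K h₀ : ℝ, 0 < K ∧ 0 < h₀ ∧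
    ∀ h : ℝ, 0 < h → h < h₀ → ∀ ζ : C3, cdot ζ ζ = 0 → 1 / 4 ≤ ‖reVec ζ‖ ^ 2 → ‖reVec ζ‖ ≤ 2 →
    ∀ (b : Fin 3 → E3 → ℂ) (c : E3 → ℂ), (∀ j x, ‖b j x‖ ≤ M) → (∀ x, ‖c x‖ ≤ M) →
      (∀ j, Measurable (b j)) → Measurable c →
    ∀ f : E3 → ℂ, MemLp f 2 volume →
    ∃ r : E3 → ℂ, MemLp r 2 volume ∧
      (eLpNorm r 2 volume).toReal ≤ K * h * (eLpNorm f 2 volume).toReal ∧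
      ∀ φ : E3 → ℂ, IsTestFunction (Metric.ball 0 R) φ →
        ∫ x, r x * ellOp (conjB b ζ h) (conjC b c ζ h) φ x = ∫ x, f x * φ x := by
  obtain ⟨K, τ₀, hK, hτ₀, hcar⟩ := carleman_ellOp R M hR
  refine ⟨√K, τ₀⁻¹, by positivity, by positivity, ?_⟩
  intro h hh hh0 ζ hζ hζ1 hζ2 b c hb hc hbm hcm f hf
  set b' := conjB b ζ h
  set c' := conjC b c ζ h
  have hmem : ∀ φ : E3 → ℂ, IsTestFunction (Metric.ball 0 R) φ → MemLp (ellOp b' c' φ) 2 := by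
    intro φ hφ
    exact memLp_ellOp (M := max (M + 2 * (‖ζ‖ / h)) (M + 3 * (M * (‖ζ‖ / h))))
      (fun j x => (norm_conjB_le hb ζ hh j x).trans (le_max_left _ _))
      (fun x => (norm_conjC_le hb hc ζ hh x).trans (le_max_right _ _))
      (measurable_conjB hbm ζ h) (measurable_conjC hbm hcm ζ h) hφ 2
  have hest : ∀ φ : E3 → ℂ, IsTestFunction (Metric.ball 0 R) φ →
      (eLpNorm φ 2 volume).toReal ≤ √K * h * (eLpNorm (ellOp b' c' φ) 2 volume).toReal := by
    intro φ hφ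
    have hv := hφ.mul_left (contDiff_phase (-ζ) h)
    have h1 := hcar h⁻¹ ((le_inv_comm₀ hτ₀ hh).2 hh0.le) (reVec ζ) hζ1 hζ2 b c hb hc hbm hcm _ hv
    -- The Carleman weight with e = Re ζ and τ = 1/h is exactly |e^{x·ζ/h}|, so it cancels the
    -- modulus of the factor e^{-x·ζ/h} in front of the test function and leaves unweighted L²
    -- norms.
    have hE : ∀ x, Real.exp (h⁻¹ * dotForm (reVec ζ) x) ^ 2 * ‖phase (-ζ) h x‖ ^ 2 = 1 := by
      intro x
      rw [← norm_phase, ← mul_pow, ← norm_mul, phase_mul_neg]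
      simp
    have h2 : ∀ x, Real.exp (h⁻¹ * dotForm (reVec ζ) x) ^ 2 * ‖phase (-ζ) h x * φ x‖ ^ 2
        = ‖φ x‖ ^ 2 := fun x => by
      rw [norm_mul, mul_pow, ← mul_assoc, hE, one_mul]
    have h3 : ∀ x, Real.exp (h⁻¹ * dotForm (reVec ζ) x) ^ 2 *
        ‖ellOp b c (fun y => phase (-ζ) h y * φ y) x‖ ^ 2 = ‖ellOp b' c' φ x‖ ^ 2 := fun x => by
      rw [ellOp_conj b c hζ hφ.1, norm_mul, mul_pow, ← mul_assoc, hE, one_mul]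
    simp only [h2, h3] at h1
    rw [← toReal_eLpNorm_sq (hφ.memLp 2), ← toReal_eLpNorm_sq (hmem φ hφ)] at h1
    refine abs_le_of_sq_le_sq' ?_ (by positivity) |>.2
    rw [mul_pow, mul_pow, Real.sq_sqrt hK.le]
    calc (eLpNorm φ 2 volume).toReal ^ 2
        = h ^ 2 * (h⁻¹ ^ 2 * (eLpNorm φ 2 volume).toReal ^ 2) := by field_simp
      _ ≤ h ^ 2 * (K * (eLpNorm (ellOp b' c' φ) 2 volume).toReal ^ 2) := by gcongr
      _ = _ := by ring
  let T : testSpace (Metric.ball 0 R) →ₗ[ℂ] Lp ℂ 2 (volume : Measure E3) :=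
    { toFun := fun φ => (hmem φ φ.2).toLp _
      map_add' := fun φ χ => by
        rw [← MemLp.toLp_add]
        exact MemLp.toLp_congr _ _ (Eventually.of_forall fun x => ellOp_add b' c' φ.2.1 χ.2.1 x)
      map_smul' := fun a φ => by
        rw [RingHom.id_apply, ← MemLp.toLp_const_smul]
        exact MemLp.toLp_congr _ _ (Eventually.of_forall fun x => ellOp_const_mul b' c' φ.2.1 a x) }
  have hfi : ∀ {φ : E3 → ℂ}, IsTestFunction (Metric.ball 0 R) φ →
      Integrable (fun x => f x * φ x) := fun hφ => hf.integrable_mul (hφ.memLp 2)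
  let ℓ : testSpace (Metric.ball 0 R) →ₗ[ℂ] ℂ :=
    { toFun := fun φ => ∫ x, f x * (φ : E3 → ℂ) x
      map_add' := fun φ χ => by
        rw [← integral_add (hfi φ.2) (hfi χ.2)]
        simp [mul_add]
      map_smul' := fun a φ => by
        rw [RingHom.id_apply, smul_eq_mul, ← integral_const_mul]
        simp [mul_left_comm] }
  obtain ⟨g, hg, hgT⟩ := exists_inner_eq_of_le T ℓ
    (K := √K * h * (eLpNorm f 2 volume).toReal) (by positivity) (fun φ => by
      refine (norm_integral_mul_le hf (φ.2.memLp 2)).trans ?_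
      have h1 := hest φ φ.2
      have h2 : ‖T φ‖ = (eLpNorm (ellOp b' c' φ) 2 volume).toReal :=
        Lp.norm_toLp _ (hmem φ φ.2)
      rw [h2]
      calc _ ≤ (eLpNorm f 2 volume).toReal *
            (√K * h * (eLpNorm (ellOp b' c' φ) 2 volume).toReal) := by gcongr
        _ = _ := by ring)
  have hgm := Lp.memLp g
  have hrm := MemLp.conjugate hgm
  -- Riesz represents the functional through a conjugate-linear slot, so the solution for the
  -- bilinear pairing is the conjugate of g.
  refine ⟨fun x => conj (g x), hrm, ?_, fun φ hφ => ?_⟩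
  · rw [eLpNorm_congr_norm_ae (g := g) (Eventually.of_forall fun x => by simp)]
    exact hg
  · have h1 := hgT ⟨φ, hφ⟩
    have hcc := MemLp.conjugate hrm
    have h2 : hcc.toLp _ = g := by
      refine Lp.ext ?_
      filter_upwards [hcc.coeFn_toLp] with x hx
      rw [hx]; simp
    rw [← inner_toLp_conj (hmem φ hφ) hcc, h2]
    exact h1

end

/-! ### Superpositions of translates, covering both mollification and the Cauchy transform. -/

section

section ShiftIntegral

variable {S : Type*} [NormedAddCommGroup S] [NormedSpace ℝ S] [ProperSpace S] [MeasurableSpace S]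
  [BorelSpace S]
variable {𝕜 : Type*} [RCLike 𝕜]
variable {V : Type} [NormedAddCommGroup V] [NormedSpace ℝ V] [NormedSpace 𝕜 V] [SMulCommClass ℝ 𝕜 V]

/-- The superposition `∫ k(s) F(x - ℓ s) ds` of translates of `F`. -/
def shiftInt (ν : Measure S) (ℓ : S →L[ℝ] E3) (k : S → 𝕜) (F : E3 → V) (x : E3) : V :=
  ∫ s, k s • F (x - ℓ s) ∂ν

variable {ν : Measure S} {ℓ : S →L[ℝ] E3} {k : S → 𝕜} {c : ℝ}

/-- For x in a bounded set and F supported in a ball, only s in a fixed ball contribute to ∫ k(s)F(x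
- ℓs) ds. This is what allows k to be merely locally integrable, as is needed for the Cauchy kernel
and for rough functions that are mollified. -/
lemma norm_le_of_shift_mem (hc : 0 ≤ c) (hℓ : ∀ s, ‖s‖ ≤ c * ‖ℓ s‖) {R R' : ℝ} {x : E3} {s : S}
    (hx : ‖x‖ ≤ R') (hs : ‖x - ℓ s‖ ≤ R) : ‖s‖ ≤ c * (R + R') := by
  refine (hℓ s).trans (mul_le_mul_of_nonneg_left ?_ hc)
  calc ‖ℓ s‖ = ‖x - (x - ℓ s)‖ := by rw [sub_sub_cancel]
    _ ≤ ‖x‖ + ‖x - ℓ s‖ := norm_sub_le _ _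
    _ ≤ R + R' := by linarith

lemma norm_smul_shift_le (hc : 0 ≤ c) (hℓ : ∀ s, ‖s‖ ≤ c * ‖ℓ s‖) {R R' B : ℝ} {F : E3 → V}
    (hF : ∀ y, ‖F y‖ ≤ B) (hR : ∀ y, R < ‖y‖ → F y = 0) {x : E3} (hx : ‖x‖ ≤ R') (s : S) :
    ‖k s • F (x - ℓ s)‖ ≤
      (Metric.closedBall (0 : S) (c * (R + R'))).indicator (fun s => ‖k s‖ * B) s := by
  by_cases hs : s ∈ Metric.closedBall (0 : S) (c * (R + R'))
  · rw [indicator_of_mem hs, norm_smul]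
    gcongr
    exact hF _
  · have : F (x - ℓ s) = 0 := by
      refine hR _ (lt_of_not_ge fun h => hs ?_)
      simpa using norm_le_of_shift_mem hc hℓ hx h
    rw [indicator_of_notMem hs, this, smul_zero, norm_zero]

lemma integrable_shift_bound (hk : LocallyIntegrable k ν) (ρ B : ℝ) :
    Integrable ((Metric.closedBall (0 : S) ρ).indicator (fun s => ‖k s‖ * B)) ν := by
  rw [integrable_indicator_iff measurableSet_closedBall]
  exact ((hk.integrableOn_isCompact (isCompact_closedBall _ _)).norm).mul_const B

lemma exists_bound_of_hasCompactSupport {W : Type*} [NormedAddCommGroup W] {F : E3 → W}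
    (hF : Continuous F) (hFc : HasCompactSupport F) :
    ∃ R B : ℝ, 0 ≤ R ∧ (∀ y, ‖F y‖ ≤ B) ∧ ∀ y, R < ‖y‖ → F y = 0 := by
  obtain ⟨B, hB⟩ := hFc.exists_bound_of_continuous hF
  obtain ⟨R, hR⟩ := hFc.isCompact.isBounded.exists_norm_le
  refine ⟨max R 0, B, le_max_right _ _, hB, fun y hy => ?_⟩
  refine image_eq_zero_of_notMem_tsupport fun h => ?_
  exact absurd (hR y h) (not_le.2 ((le_max_left _ _).trans_lt hy))

lemma integrable_shift (hc : 0 ≤ c) (hℓ : ∀ s, ‖s‖ ≤ c * ‖ℓ s‖) (hk : LocallyIntegrable k ν)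
    {F : E3 → V} (hF : Continuous F) (hFc : HasCompactSupport F) (x : E3) :
    Integrable (fun s => k s • F (x - ℓ s)) ν := by
  obtain ⟨R, B, -, hB, hR⟩ := exists_bound_of_hasCompactSupport hF hFc
  refine (integrable_shift_bound hk (c * (R + ‖x‖)) B).mono' ?_
    (Eventually.of_forall fun s => norm_smul_shift_le hc hℓ hB hR le_rfl s)
  exact hk.aestronglyMeasurable.smul
    (hF.comp (continuous_const.sub ℓ.continuous)).aestronglyMeasurable

/-- Differentiation under the integral, with all derivatives falling on F. The dominating function
is uniform for base points in the unit ball about x. -/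
lemma hasFDerivAt_shiftInt (hc : 0 ≤ c) (hℓ : ∀ s, ‖s‖ ≤ c * ‖ℓ s‖) (hk : LocallyIntegrable k ν)
    {F : E3 → V} (hF : ContDiff ℝ 1 F) (hFc : HasCompactSupport F) (x : E3) :
    HasFDerivAt (shiftInt ν ℓ k F) (shiftInt ν ℓ k (fderiv ℝ F) x) x := by
  obtain ⟨R, B, -, hB, hR⟩ :=
    exists_bound_of_hasCompactSupport (hF.continuous_fderiv (by simp)) (hFc.fderiv ℝ)
  refine hasFDerivAt_integral_of_dominated_of_fderiv_le (𝕜 := ℝ)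
    (F := fun y s => k s • F (y - ℓ s)) (F' := fun y s => k s • fderiv ℝ F (y - ℓ s))
    (bound := (Metric.closedBall (0 : S) (c * (R + (‖x‖ + 1)))).indicator (fun s => ‖k s‖ * B))
    (Metric.ball_mem_nhds x one_pos) ?_ ?_ ?_ ?_ ?_ ?_
  · exact Eventually.of_forall fun y =>
      (integrable_shift hc hℓ hk hF.continuous hFc y).aestronglyMeasurable
  · exact integrable_shift hc hℓ hk hF.continuous hFc x
  · exact (integrable_shift hc hℓ hk (hF.continuous_fderiv (by simp))
      (hFc.fderiv ℝ) x).aestronglyMeasurable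
  · refine Eventually.of_forall fun s y hy => norm_smul_shift_le hc hℓ hB hR ?_ s
    have h1 : ‖y - x‖ < 1 := by simpa [dist_eq_norm] using hy
    calc ‖y‖ = ‖x + (y - x)‖ := by rw [add_sub_cancel]
      _ ≤ ‖x‖ + ‖y - x‖ := norm_add_le _ _
      _ ≤ ‖x‖ + 1 := by linarith
  · exact integrable_shift_bound hk _ _
  · refine Eventually.of_forall fun s y _ => ?_
    have h1 : HasFDerivAt F (fderiv ℝ F (y - ℓ s)) (y - ℓ s) :=
      (hF.differentiable (by simp) _).hasFDerivAt
    have h2 : HasFDerivAt (fun y => y - ℓ s) (ContinuousLinearMap.id ℝ E3) y :=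
      (hasFDerivAt_id y).sub_const _
    exact (h1.comp y h2).const_smul (k s)

lemma fderiv_shiftInt (hc : 0 ≤ c) (hℓ : ∀ s, ‖s‖ ≤ c * ‖ℓ s‖) (hk : LocallyIntegrable k ν)
    {F : E3 → V} (hF : ContDiff ℝ 1 F) (hFc : HasCompactSupport F) :
    fderiv ℝ (shiftInt ν ℓ k F) = shiftInt ν ℓ k (fderiv ℝ F) :=
  funext fun x => (hasFDerivAt_shiftInt hc hℓ hk hF hFc x).fderiv

lemma pderiv_shiftInt [CompleteSpace V] (hc : 0 ≤ c) (hℓ : ∀ s, ‖s‖ ≤ c * ‖ℓ s‖)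
    (hk : LocallyIntegrable k ν) {F : E3 → V} (hF : ContDiff ℝ 1 F) (hFc : HasCompactSupport F)
    (j : Fin 3) (x : E3) :
    pderiv j (shiftInt ν ℓ k F) x = shiftInt ν ℓ k (pderiv j F) x := by
  rw [pderiv, fderiv_shiftInt hc hℓ hk hF hFc, shiftInt, ContinuousLinearMap.integral_apply
    (integrable_shift hc hℓ hk (hF.continuous_fderiv (by simp)) (hFc.fderiv ℝ) x)]
  rfl

end ShiftIntegral

section ShiftIntegralSmooth

variable {S : Type*} [NormedAddCommGroup S] [NormedSpace ℝ S] [ProperSpace S] [MeasurableSpace S]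
  [BorelSpace S] {𝕜 : Type*} [RCLike 𝕜] {ν : Measure S} {ℓ : S →L[ℝ] E3} {k : S → 𝕜} {c : ℝ}

/-- The derivative is again a superposition of translates, now with values in a space of linear
maps; the induction therefore generalises over the target space. -/
lemma contDiff_shiftInt (hc : 0 ≤ c) (hℓ : ∀ s, ‖s‖ ≤ c * ‖ℓ s‖) (hk : LocallyIntegrable k ν)
    {V : Type} [NormedAddCommGroup V] [NormedSpace ℝ V] [NormedSpace 𝕜 V] [SMulCommClass ℝ 𝕜 V]
    {F : E3 → V} (hF : ContDiff ℝ ∞ F) (hFc : HasCompactSupport F) :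
    ContDiff ℝ ∞ (shiftInt ν ℓ k F) := by
  rw [contDiff_infty]
  intro n
  induction n generalizing V with
  | zero =>
    refine contDiff_zero.2 (continuous_iff_continuousAt.2 fun x => ?_)
    exact (hasFDerivAt_shiftInt hc hℓ hk (hF.of_le (by norm_cast)) hFc x).continuousAt
  | succ n ih =>
    have h1 : ContDiff ℝ 1 F := hF.of_le (by norm_cast)
    rw [Nat.cast_add, Nat.cast_one, contDiff_succ_iff_fderiv]
    refine ⟨fun x => (hasFDerivAt_shiftInt hc hℓ hk h1 hFc x).differentiableAt, by simp, ?_⟩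
    rw [fderiv_shiftInt hc hℓ hk h1 hFc]
    exact ih (hF.fderiv_right (by simp)) (hFc.fderiv ℝ)

lemma norm_iteratedFDeriv_shiftInt_le (hc : 0 ≤ c) (hℓ : ∀ s, ‖s‖ ≤ c * ‖ℓ s‖)
    (hk : LocallyIntegrable k ν)
    {V : Type} [NormedAddCommGroup V] [NormedSpace ℝ V] [NormedSpace 𝕜 V] [SMulCommClass ℝ 𝕜 V]
    {F : E3 → V} (hF : ContDiff ℝ ∞ F) (hFc : HasCompactSupport F) (n : ℕ) (x : E3) :
    ‖iteratedFDeriv ℝ n (shiftInt ν ℓ k F) x‖ ≤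
      ∫ s, ‖k s‖ * ‖iteratedFDeriv ℝ n F (x - ℓ s)‖ ∂ν := by
  induction n generalizing V with
  | zero =>
    simp only [norm_iteratedFDeriv_zero]
    refine (norm_integral_le_integral_norm _).trans (le_of_eq ?_)
    simp only [norm_smul]
  | succ n ih =>
    have h1 : ContDiff ℝ 1 F := hF.of_le (by norm_cast)
    rw [← norm_iteratedFDeriv_fderiv, fderiv_shiftInt hc hℓ hk h1 hFc]
    simp only [← norm_iteratedFDeriv_fderiv (n := n) (f := F)]
    exact ih (hF.fderiv_right (by simp)) (hFc.fderiv ℝ)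

end ShiftIntegralSmooth

end

/-! ### Mollification by shrinking bumps. -/

/-- A sequence of smooth bump functions shrinking to the origin. -/
def bumpSeq (n : ℕ) : ContDiffBump (0 : E3) where
  rIn := 1 / (2 * (n + 1))
  rOut := 1 / (n + 1)
  rIn_pos := by positivity
  rIn_lt_rOut := by
    apply one_div_lt_one_div_of_lt <;> [positivity; linarith [(Nat.cast_nonneg n : (0 : ℝ) ≤ n)]]

/-- The normalized bump function. -/
def eta (n : ℕ) : E3 → ℝ := (bumpSeq n).normed volume

lemma contDiff_eta (n : ℕ) : ContDiff ℝ ∞ (eta n) := (bumpSeq n).contDiff_normed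

lemma hasCompactSupport_eta (n : ℕ) : HasCompactSupport (eta n) :=
  (bumpSeq n).hasCompactSupport_normed

lemma eta_nonneg (n : ℕ) (x : E3) : 0 ≤ eta n x := (bumpSeq n).nonneg_normed x

lemma integral_eta (n : ℕ) : ∫ x, eta n x = 1 := (bumpSeq n).integral_normed

lemma tsupport_eta (n : ℕ) : tsupport (eta n) = Metric.closedBall 0 (1 / (n + 1)) :=
  (bumpSeq n).tsupport_normed_eq

lemma eta_neg (n : ℕ) (x : E3) : eta n (-x) = eta n x := (bumpSeq n).normed_neg x

/-- Mollification at scale `1 / (n + 1)`. -/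
def molli (n : ℕ) (f : E3 → ℝ) : E3 → ℝ :=
  shiftInt volume (ContinuousLinearMap.id ℝ E3) f (eta n)

lemma molli_apply (n : ℕ) (f : E3 → ℝ) (x : E3) : molli n f x = ∫ t, f t * eta n (x - t) := rfl

lemma molli_eq_convolution (n : ℕ) (f : E3 → ℝ) :
    molli n f = convolution ((bumpSeq n).normed volume) f (ContinuousLinearMap.lsmul ℝ ℝ) volume := by
  funext x
  rw [convolution_lsmul_swap, molli_apply]
  exact integral_congr_ae (Eventually.of_forall fun t => mul_comm _ _)

lemma norm_le_one_mul_id (s : E3) : ‖s‖ ≤ 1 * ‖ContinuousLinearMap.id ℝ E3 s‖ := by simp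

lemma contDiff_molli (n : ℕ) {f : E3 → ℝ} (hf : LocallyIntegrable f) : ContDiff ℝ ∞ (molli n f) :=
  contDiff_shiftInt zero_le_one norm_le_one_mul_id hf (contDiff_eta n) (hasCompactSupport_eta n)

lemma pderiv_molli (n : ℕ) {f : E3 → ℝ} (hf : LocallyIntegrable f) (j : Fin 3) (x : E3) :
    pderiv j (molli n f) x = ∫ t, f t * pderiv j (eta n) (x - t) :=
  pderiv_shiftInt zero_le_one norm_le_one_mul_id hf ((contDiff_eta n).of_le (by norm_cast))
    (hasCompactSupport_eta n) j x

lemma pderiv_pderiv_molli (n : ℕ) {f : E3 → ℝ} (hf : LocallyIntegrable f) (j : Fin 3) (x : E3) :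
    pderiv j (pderiv j (molli n f)) x = ∫ t, f t * pderiv j (pderiv j (eta n)) (x - t) := by
  have h : pderiv j (molli n f) =
      shiftInt volume (ContinuousLinearMap.id ℝ E3) f (pderiv j (eta n)) :=
    funext fun x => pderiv_molli n hf j x
  rw [h]
  exact pderiv_shiftInt zero_le_one norm_le_one_mul_id hf
    (((contDiff_eta n).pderiv j).of_le (by norm_cast)) ((hasCompactSupport_eta n).pderiv j) j x

lemma integrable_mul_shift {f : E3 → ℝ} (hf : LocallyIntegrable f) {F : E3 → ℝ}
    (hF : Continuous F) (hFc : HasCompactSupport F) (x : E3) :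
    Integrable (fun t => f t * F (x - t)) :=
  integrable_shift (𝕜 := ℝ) (V := ℝ) (ℓ := ContinuousLinearMap.id ℝ E3) zero_le_one
    norm_le_one_mul_id hf hF hFc x

lemma tendsto_bumpSeq_rOut : Tendsto (fun n => (bumpSeq n).rOut) atTop (𝓝 0) :=
  tendsto_one_div_add_atTop_nhds_zero_nat

lemma ae_tendsto_molli {f : E3 → ℝ} (hf : LocallyIntegrable f) :
    ∀ᵐ x, Tendsto (fun n => molli n f x) atTop (𝓝 (f x)) := by
  simp only [molli_eq_convolution]
  -- The constant 2 is the fixed ratio of outer to inner radius in `bumpSeq`, needed for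
  -- differentiation at Lebesgue points.
  refine ContDiffBump.ae_convolution_tendsto_right_of_locallyIntegrable (K := 2)
    tendsto_bumpSeq_rOut (Eventually.of_forall fun n => le_of_eq ?_) hf
  simp only [bumpSeq]
  field_simp

lemma tendsto_molli {f : E3 → ℝ} (hf : Continuous f) (x : E3) :
    Tendsto (fun n => molli n f x) atTop (𝓝 (f x)) := by
  simp only [molli_eq_convolution]
  exact ContDiffBump.convolution_tendsto_right_of_continuous tendsto_bumpSeq_rOut hf x

lemma integral_eta_sub (n : ℕ) (x : E3) : ∫ t, eta n (x - t) = 1 := by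
  rw [integral_sub_left_eq_self (eta n) volume x, integral_eta]

lemma integrable_eta_sub (n : ℕ) (x : E3) : Integrable (fun t => eta n (x - t)) := by
  have := integrable_mul_shift (f := fun _ => 1) (locallyIntegrable_const 1)
    (contDiff_eta n).continuous (hasCompactSupport_eta n) x
  simpa using this

lemma abs_molli_le (n : ℕ) {f : E3 → ℝ} {B : ℝ} (hB : ∀ x, |f x| ≤ B) (x : E3) :
    |molli n f x| ≤ B := by
  rw [molli_apply, ← Real.norm_eq_abs]
  calc ‖∫ t, f t * eta n (x - t)‖ ≤ ∫ t, B * eta n (x - t) := by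
        refine norm_integral_le_of_norm_le ((integrable_eta_sub n x).const_mul B)
          (Eventually.of_forall fun t => ?_)
        rw [norm_mul, Real.norm_eq_abs, Real.norm_of_nonneg (eta_nonneg n _)]
        exact mul_le_mul_of_nonneg_right (hB t) (eta_nonneg n _)
    _ = B := by rw [integral_const_mul, integral_eta_sub, mul_one]

/-- Jensen's inequality for the probability density η_n(x - ·): the variance of f under it is
nonnegative. -/
lemma sq_molli_le (n : ℕ) {f : E3 → ℝ} (hf : LocallyIntegrable f)
    (hf2 : LocallyIntegrable (fun x => f x ^ 2)) (x : E3) :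
    molli n f x ^ 2 ≤ molli n (fun y => f y ^ 2) x := by
  have hη := (contDiff_eta n).continuous
  have i1 := integrable_mul_shift hf hη (hasCompactSupport_eta n) x
  have i2 := integrable_mul_shift hf2 hη (hasCompactSupport_eta n) x
  have h0 : 0 ≤ ∫ t, (f t ^ 2 * eta n (x - t) - (2 * molli n f x) * (f t * eta n (x - t))
      + molli n f x ^ 2 * eta n (x - t)) := by
    refine integral_nonneg fun t => ?_
    have : f t ^ 2 * eta n (x - t) - (2 * molli n f x) * (f t * eta n (x - t))
      + molli n f x ^ 2 * eta n (x - t) = eta n (x - t) * (f t - molli n f x) ^ 2 := by ring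
    simp only [this]
    exact mul_nonneg (eta_nonneg n _) (sq_nonneg _)
  have hadd := integral_add (i2.sub (i1.const_mul (2 * molli n f x)))
    ((integrable_eta_sub n x).const_mul (molli n f x ^ 2))
  simp only [Pi.sub_apply] at hadd
  rw [hadd, integral_sub i2 (i1.const_mul _), integral_const_mul, integral_const_mul, integral_eta_sub,
    ← molli_apply n f, ← molli_apply n (fun y => f y ^ 2)] at h0
  nlinarith

lemma integral_sq_molli_le (n : ℕ) {f : E3 → ℝ} (hf : Integrable f) (hf2 : MemLp f 2) :
    MemLp (molli n f) 2 ∧ ∫ x, molli n f x ^ 2 ≤ ∫ x, f x ^ 2 := by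
  have i2 : Integrable (fun x => f x ^ 2) := hf2.integrable_sq
  have hη : Integrable (eta n) :=
    (contDiff_eta n).continuous.integrable_of_hasCompactSupport (hasCompactSupport_eta n)
  have hcont := (contDiff_molli n hf.locallyIntegrable).continuous
  have hm : Integrable (molli n fun y => f y ^ 2) := by
    rw [molli_eq_convolution]
    exact hη.integrable_convolution _ i2
  have hle := sq_molli_le n hf.locallyIntegrable i2.locallyIntegrable
  have hi : Integrable (fun x => molli n f x ^ 2) :=
    hm.mono' (hcont.pow 2).aestronglyMeasurable (Eventually.of_forall fun x => by
      rw [Real.norm_of_nonneg (sq_nonneg _)]; exact hle x)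
  refine ⟨(memLp_two_iff_integrable_sq hcont.aestronglyMeasurable).2 hi, ?_⟩
  refine (integral_mono hi hm hle).trans (le_of_eq ?_)
  have hη' : Integrable ((bumpSeq n).normed volume : E3 → ℝ) := hη
  rw [molli_eq_convolution, integral_convolution _ hη' i2]
  simp [(bumpSeq n).integral_normed]

/-- Fubini together with the evenness of the bump. -/
lemma integral_molli_mul (n : ℕ) {f ψ : E3 → ℝ} (hf : Integrable f) (hψ : Integrable ψ) :
    ∫ x, molli n f x * ψ x = ∫ x, f x * molli n ψ x := by
  obtain ⟨B, hB⟩ := (hasCompactSupport_eta n).exists_bound_of_continuous (contDiff_eta n).continuous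
  have hint : Integrable (Function.uncurry fun x t => f t * eta n (x - t) * ψ x)
      (volume.prod volume) := by
    have h1 := (hψ.mul_prod hf).bdd_mul (c := B) (f := fun z : E3 × E3 => eta n (z.1 - z.2))
      ((contDiff_eta n).continuous.comp (continuous_fst.sub continuous_snd)).aestronglyMeasurable
      (Eventually.of_forall fun z => hB _)
    refine h1.congr (Eventually.of_forall fun z => ?_)
    simp only [Function.uncurry]
    ring
  calc ∫ x, molli n f x * ψ x = ∫ x, ∫ t, f t * eta n (x - t) * ψ x := by
        simp only [molli_apply, integral_mul_const]
    _ = ∫ t, ∫ x, f t * eta n (x - t) * ψ x := integral_integral_swap hint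
    _ = ∫ t, f t * molli n ψ t := by
        refine integral_congr_ae (Eventually.of_forall fun t => ?_)
        simp only [molli_apply]
        rw [← integral_const_mul]
        refine integral_congr_ae (Eventually.of_forall fun x => ?_)
        simp only
        rw [← eta_neg n (x - t), neg_sub]
        ring

lemma tendsto_integral_molli_mul {f ψ : E3 → ℝ} (hf : Integrable f) (hψ : Continuous ψ)
    (hψc : HasCompactSupport ψ) :
    Tendsto (fun n => ∫ x, molli n f x * ψ x) atTop (𝓝 (∫ x, f x * ψ x)) := by
  obtain ⟨B, hB⟩ := hψc.exists_bound_of_continuous hψ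
  have hψi : Integrable ψ := hψ.integrable_of_hasCompactSupport hψc
  simp only [integral_molli_mul _ hf hψi]
  refine tendsto_integral_of_dominated_convergence (fun x => ‖f x‖ * B) (fun n => ?_)
    (hf.norm.mul_const B) (fun n => Eventually.of_forall fun x => ?_)
    (Eventually.of_forall fun x => (tendsto_molli hψ x).const_mul _)
  · exact hf.aestronglyMeasurable.mul
      (contDiff_molli n hψi.locallyIntegrable).continuous.aestronglyMeasurable
  · rw [norm_mul]
    gcongr
    exact abs_molli_le n hB x

/-! ### Interior regularity for Δr = -div g + g₀ with L² data. -/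

lemma caccioppoli_pointwise {χ ρ γ0 κ : ℝ} (hκ : 0 < κ) (d g dχ : Fin 3 → ℝ) :
    χ ^ 2 * ∑ j, d j ^ 2 ≤
      2 * (2 * χ * ρ * (∑ j, dχ j * (d j + g j)) + χ ^ 2 * (∑ j, d j * (d j + g j))
        + χ ^ 2 * ρ * γ0)
      + 10 * (∑ j, dχ j ^ 2) * ρ ^ 2 + 4 * χ ^ 2 * (∑ j, g j ^ 2)
      + χ ^ 2 * (κ ^ 2 * ρ ^ 2 + (κ ^ 2)⁻¹ * γ0 ^ 2) := by
  have h0 : 0 ≤ χ ^ 2 * (κ * ρ + κ⁻¹ * γ0) ^ 2 := by positivity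
  -- Young's inequality with parameter κ splits the product of ρ and the zeroth order source. In the
  -- application κ = 1/h, which weights the two factors correctly.
  have h1 : (κ * ρ + κ⁻¹ * γ0) ^ 2 = κ ^ 2 * ρ ^ 2 + (κ ^ 2)⁻¹ * γ0 ^ 2 + 2 * ρ * γ0 := by
    field_simp; ring
  have h2 : ∀ j, 0 ≤ 2 * χ ^ 2 * d j ^ 2 + 4 * χ * ρ * (dχ j * (d j + g j))
      + 2 * χ ^ 2 * (d j * g j) + 10 * dχ j ^ 2 * ρ ^ 2 + 4 * χ ^ 2 * g j ^ 2
      - χ ^ 2 * d j ^ 2 := by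
    intro j
    nlinarith [sq_nonneg (χ * d j + 4 * ρ * dχ j + 2 * χ * g j),
      sq_nonneg (χ * d j + 4 * ρ * dχ j), sq_nonneg (χ * d j + 2 * χ * g j),
      sq_nonneg (χ * g j + ρ * dχ j)]
  rw [h1] at h0
  have h3 := h2 0
  have h4 := h2 1
  have h5 := h2 2
  simp only [Fin.sum_univ_three]
  linarith

lemma pderiv_comp_sub_left {F : E3 → ℝ} (hF : Differentiable ℝ F) (x t : E3) (j : Fin 3) :
    pderiv j (fun t => F (x - t)) t = - pderiv j F (x - t) := by
  have h1 : HasFDerivAt (fun t : E3 => x - t) (-ContinuousLinearMap.id ℝ E3) t :=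
    (hasFDerivAt_id t).const_sub x
  have h2 := (hF (x - t)).hasFDerivAt.comp t h1
  simp only [pderiv]
  rw [show (fun t => F (x - t)) = F ∘ (fun t => x - t) from rfl, h2.fderiv]
  simp

/-- Mollification turns a distributional equation into a classical one. -/
lemma lap_molli {R : ℝ} {r g0 : E3 → ℝ} {g : Fin 3 → E3 → ℝ} (hr : LocallyIntegrable r)
    (hg : ∀ j, LocallyIntegrable (g j))
    (heq : ∀ φ : E3 → ℝ, IsTestFunction (Metric.ball 0 R) φ →
      ∫ x, r x * lap φ x = (∑ j, ∫ x, g j x * pderiv j φ x) + ∫ x, g0 x * φ x)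
    {n : ℕ} {x : E3} (hx : ‖x‖ + 1 / (n + 1) < R) :
    lap (molli n r) x = -(∑ j, pderiv j (molli n (g j)) x) + molli n g0 x := by
  have hη := contDiff_eta n
  have hηc := hasCompactSupport_eta n
  set φ : E3 → ℝ := fun t => eta n (x - t) with hφ
  have hts : tsupport φ ⊆ Metric.closedBall 0 (‖x‖ + 1 / (n + 1)) := by
    refine closure_minimal (fun t ht => ?_) Metric.isClosed_closedBall
    have h : x - t ∈ tsupport (eta n) := subset_tsupport _ ht
    rw [tsupport_eta, mem_closedBall_zero_iff] at h
    rw [mem_closedBall_zero_iff]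
    calc ‖t‖ = ‖x - (x - t)‖ := by rw [sub_sub_cancel]
      _ ≤ ‖x‖ + ‖x - t‖ := norm_sub_le _ _
      _ ≤ _ := by linarith
  have hφt : IsTestFunction (Metric.ball 0 R) φ := by
    refine ⟨hη.comp (contDiff_const.sub contDiff_id), ?_,
      hts.trans (Metric.closedBall_subset_ball hx)⟩
    exact (isCompact_closedBall (0 : E3) _).of_isClosed_subset (isClosed_tsupport _) hts
  have h1 : ∀ j, pderiv j φ = fun t => - pderiv j (eta n) (x - t) := fun j =>
    funext fun t => pderiv_comp_sub_left (hη.differentiable (by simp)) x t j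
  have h2 : ∀ j t, pderiv j (pderiv j φ) t = pderiv j (pderiv j (eta n)) (x - t) := fun j t => by
    rw [h1, pderiv_neg, pderiv_comp_sub_left ((hη.pderiv j).differentiable (by simp)), neg_neg]
  have hE := heq φ hφt
  have h3 : ∫ t, r t * lap φ t = lap (molli n r) x := by
    simp only [lap, h2, Finset.mul_sum, pderiv_pderiv_molli n hr]
    exact integral_finsetSum _ fun j _ => integrable_mul_shift hr
      ((hη.pderiv j).pderiv j).continuous ((hηc.pderiv j).pderiv j) x
  rw [h3] at hE
  rw [hE]
  simp only [h1, mul_neg, integral_neg, Finset.sum_neg_distrib, pderiv_molli n (hg _)]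
  rfl

/-- Interior regularity: an `L²` solution of `Δr = -div g + g₀` has first derivatives in `L²`, with
an estimate. -/
theorem sq_integral_mul_pderiv_le {R₁ R₂ : ℝ} (hR₁ : 0 < R₁) (hR : R₁ < R₂) : ∃ C : ℝ, 0 < C ∧
    ∀ (r g0 : E3 → ℝ) (g : Fin 3 → E3 → ℝ), Integrable r → MemLp r 2 → Integrable g0 →
      MemLp g0 2 → (∀ j, Integrable (g j)) → (∀ j, MemLp (g j) 2) →
    (∀ φ : E3 → ℝ, IsTestFunction (Metric.ball 0 R₂) φ →
      ∫ x, r x * lap φ x = (∑ j, ∫ x, g j x * pderiv j φ x) + ∫ x, g0 x * φ x) →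
    ∀ κ : ℝ, 1 ≤ κ → ∀ (j : Fin 3) (φ : E3 → ℝ), IsTestFunction (Metric.ball 0 R₁) φ →
      (∫ x, r x * pderiv j φ x) ^ 2 ≤ C * (κ ^ 2 * (∫ x, r x ^ 2) + (∑ j, ∫ x, g j x ^ 2)
        + (κ ^ 2)⁻¹ * ∫ x, g0 x ^ 2) * ∫ x, φ x ^ 2 := by
  let Χ : ContDiffBump (0 : E3) := ⟨R₁, (R₁ + R₂) / 2, hR₁, by linarith⟩
  set χ : E3 → ℝ := fun x => Χ x with hχ
  have hχs : ContDiff ℝ ∞ χ := Χ.contDiff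
  have hχts : tsupport χ = Metric.closedBall 0 ((R₁ + R₂) / 2) := Χ.tsupport_eq
  have hχt : IsTestFunction (Metric.ball 0 R₂) χ := ⟨hχs, Χ.hasCompactSupport, by
    rw [hχts]; exact Metric.closedBall_subset_ball (by linarith)⟩
  have hχ1 : ∀ x, χ x ^ 2 ≤ 1 := fun x => by
    have h1 := Χ.nonneg' x
    have h2 : Χ x ≤ 1 := Χ.le_one
    exact pow_le_one₀ h1 h2
  obtain ⟨B, hB⟩ : ∃ B, ∀ x, ‖∑ j, pderiv j χ x ^ 2‖ ≤ B := by
    refine HasCompactSupport.exists_bound_of_continuous (f := fun x => ∑ j, pderiv j χ x ^ 2) ?_ ?_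
    · exact hχt.2.1.of_isClosed_subset (isClosed_tsupport _)
        (closure_minimal (fun x hx => by
          by_contra hx'
          refine hx (Finset.sum_eq_zero fun j _ => ?_)
          have : pderiv j χ x = 0 := image_eq_zero_of_notMem_tsupport
            fun h => hx' (tsupport_pderiv_subset _ _ h)
          simp [this]) (isClosed_tsupport _))
    · exact continuous_finsetSum _ fun j _ => (hχs.pderiv j).continuous.pow 2
  have hB0 : 0 ≤ B := (norm_nonneg _).trans (hB 0)
  refine ⟨10 * B + 5, by positivity, ?_⟩
  intro r g0 g hr1 hr2 hg01 hg02 hg1 hg2 heq κ hκ j φ hφ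
  have hκ0 : 0 < κ := by linarith
  have hev : ∀ᶠ n : ℕ in atTop, (1 : ℝ) / (n + 1) < (R₂ - R₁) / 2 :=
    (tendsto_one_div_add_atTop_nhds_zero_nat (𝕜 := ℝ)).eventually_lt_const (by linarith)
  have hlim := tendsto_integral_molli_mul hr1 (hφ.pderiv j).continuous (hφ.pderiv j).2.1
  -- The bound is proved for the mollifications of r, with a constant independent of n, and passed
  -- to the limit against the fixed test function. Thus no derivative of r has to exist beforehand.
  refine le_of_tendsto (hlim.pow 2) ?_
  filter_upwards [hev] with n hn
  set ρ := molli n r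
  set γ0 := molli n g0
  set γ : Fin 3 → E3 → ℝ := fun i => molli n (g i) with hγ
  have hρs : ContDiff ℝ ∞ ρ := contDiff_molli n hr1.locallyIntegrable
  have hγ0s : ContDiff ℝ ∞ γ0 := contDiff_molli n hg01.locallyIntegrable
  have hγs : ∀ i, ContDiff ℝ ∞ (γ i) := fun i => contDiff_molli n (hg1 i).locallyIntegrable
  obtain ⟨hρ2, hρle⟩ := integral_sq_molli_le n hr1 hr2
  obtain ⟨hγ02, hγ0le⟩ := integral_sq_molli_le n hg01 hg02
  have hγ2 := fun i => (integral_sq_molli_le n (hg1 i) (hg2 i)).1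
  have hγle := fun i => (integral_sq_molli_le n (hg1 i) (hg2 i)).2
  -- The equation reads div(∇ρ + γ) = γ₀ on the support of χ, so the divergence of χ²ρ(∇ρ + γ)
  -- contains χ²|∇ρ|² and no second derivatives. It integrates to zero.
  set V : Fin 3 → E3 → ℝ := fun i x => (ρ x * (pderiv i ρ x + γ i x)) * (χ x * χ x) with hV
  have hVt : ∀ i, IsTestFunction (Metric.ball 0 R₂) (V i) := fun i =>
    (hχt.mul_left hχs).mul_left (hρs.mul ((hρs.pderiv i).add (hγs i)))
  have hpt : ∀ x, χ x ^ 2 * ∑ i, pderiv i ρ x ^ 2 ≤ 2 * ∑ i, pderiv i (V i) x +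
      ((10 * B + κ ^ 2) * ρ x ^ 2 + 4 * (∑ i, γ i x ^ 2) + (κ ^ 2)⁻¹ * γ0 x ^ 2) := by
    intro x
    have hd : ∀ {u : E3 → ℝ}, ContDiff ℝ ∞ u → Differentiable ℝ u := fun hu =>
      hu.differentiable (by simp)
    have hρd := hd hρs
    have hρd1 := fun i => hd (hρs.pderiv i)
    have hγd := fun i => hd (hγs i)
    have hχd := hd hχs
    have hdiv : ∑ i, pderiv i (V i) x = 2 * χ x * ρ x * (∑ i, pderiv i χ x * (pderiv i ρ x + γ i x))
        + χ x ^ 2 * (∑ i, pderiv i ρ x * (pderiv i ρ x + γ i x)) + χ x ^ 2 * ρ x * γ0 x := by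
      have h1 : χ x ^ 2 * ρ x * γ0 x = χ x ^ 2 * ρ x * (lap ρ x + ∑ i, pderiv i (γ i) x) := by
        by_cases hx : x ∈ tsupport χ
        -- The cutoff lives in a ball of radius (R₁ + R₂)/2 and 1/(n + 1) < (R₂ - R₁)/2, so the
        -- mollified equation holds classically there.
        · rw [hχts, mem_closedBall_zero_iff] at hx
          rw [lap_molli hr1.locallyIntegrable
            (fun i => (hg1 i).locallyIntegrable) heq (by linarith)]
          ring
        · simp [image_eq_zero_of_notMem_tsupport hx]
      rw [h1]
      simp (disch := fun_prop) only [hV, pderiv_mul, pderiv_add, Fin.sum_univ_three, lap]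
      ring
    have hp := caccioppoli_pointwise (χ := χ x) (ρ := ρ x) (γ0 := γ0 x) hκ0
      (fun i => pderiv i ρ x) (fun i => γ i x) (fun i => pderiv i χ x)
    rw [← hdiv] at hp
    refine hp.trans ?_
    have hBx : ∑ i, pderiv i χ x ^ 2 ≤ B := (le_abs_self _).trans (hB x)
    have e1 : 10 * (∑ i, pderiv i χ x ^ 2) * ρ x ^ 2 ≤ 10 * B * ρ x ^ 2 := by gcongr
    have e2 : χ x ^ 2 * (∑ i, γ i x ^ 2) ≤ 1 * ∑ i, γ i x ^ 2 :=
      mul_le_mul_of_nonneg_right (hχ1 x) (Finset.sum_nonneg fun _ _ => sq_nonneg _)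
    have e3 : χ x ^ 2 * (κ ^ 2 * ρ x ^ 2 + (κ ^ 2)⁻¹ * γ0 x ^ 2) ≤
        1 * (κ ^ 2 * ρ x ^ 2 + (κ ^ 2)⁻¹ * γ0 x ^ 2) :=
      mul_le_mul_of_nonneg_right (hχ1 x) (by positivity)
    linarith
  have hdρt : ∀ i, IsTestFunction (Metric.ball 0 R₂) (fun x => pderiv i ρ x * χ x) := fun i =>
    hχt.mul_left (hρs.pderiv i)
  have hi1 : Integrable (fun x => χ x ^ 2 * ∑ i, pderiv i ρ x ^ 2) := by
    simp_rw [Finset.mul_sum]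
    refine integrable_finsetSum _ fun i _ => ?_
    refine ((hdρt i).mul_left (hdρt i).1).integrable.congr (Eventually.of_forall fun x => ?_)
    simp only; ring
  have hi2 : Integrable (fun x => ∑ i, pderiv i (V i) x) :=
    integrable_finsetSum _ fun i _ => ((hVt i).pderiv i).integrable
  have hi3 : Integrable (fun x => ∑ i, γ i x ^ 2) :=
    integrable_finsetSum _ fun i _ => (hγ2 i).integrable_sq
  have hi4 : Integrable (fun x => (10 * B + κ ^ 2) * ρ x ^ 2 + 4 * (∑ i, γ i x ^ 2)) :=
    (hρ2.integrable_sq.const_mul _).add (hi3.const_mul _)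
  have hi5 : Integrable (fun x => (10 * B + κ ^ 2) * ρ x ^ 2 + 4 * (∑ i, γ i x ^ 2)
      + (κ ^ 2)⁻¹ * γ0 x ^ 2) := hi4.add (hγ02.integrable_sq.const_mul _)
  have hint := integral_mono hi1 ((hi2.const_mul 2).add hi5) hpt
  have h0 : ∫ x, ∑ i, pderiv i (V i) x = 0 := by
    rw [integral_finsetSum _ fun i _ => ((hVt i).pderiv i).integrable]
    exact Finset.sum_eq_zero fun i _ =>
      integral_pderiv_eq_zero ((hVt i).1.of_le (by norm_cast)) (hVt i).2.1 i
  rw [integral_add' (hi2.const_mul 2) hi5, integral_const_mul, h0,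
    integral_add hi4 (hγ02.integrable_sq.const_mul _),
    integral_add (hρ2.integrable_sq.const_mul _) (hi3.const_mul _), integral_const_mul,
    integral_const_mul, integral_const_mul,
    integral_finsetSum _ fun i _ => (hγ2 i).integrable_sq] at hint
  have hbound : ∫ x, χ x ^ 2 * ∑ i, pderiv i ρ x ^ 2 ≤ (10 * B + 5) *
      (κ ^ 2 * (∫ x, r x ^ 2) + (∑ j, ∫ x, g j x ^ 2) + (κ ^ 2)⁻¹ * ∫ x, g0 x ^ 2) := by
    have k1 : 1 ≤ κ ^ 2 := one_le_pow₀ hκ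
    have s1 : ∑ i, ∫ x, γ i x ^ 2 ≤ ∑ i, ∫ x, g i x ^ 2 := Finset.sum_le_sum fun i _ => hγle i
    have p1 : 0 ≤ ∫ x, r x ^ 2 := integral_nonneg fun x => sq_nonneg _
    have p2 : 0 ≤ ∑ i, ∫ x, g i x ^ 2 :=
      Finset.sum_nonneg fun i _ => integral_nonneg fun x => sq_nonneg _
    have p3 : 0 ≤ (κ ^ 2)⁻¹ * ∫ x, g0 x ^ 2 :=
      mul_nonneg (by positivity) (integral_nonneg fun x => sq_nonneg _)
    have q1 : (10 * B + κ ^ 2) * ∫ x, ρ x ^ 2 ≤ (10 * B + 5) * (κ ^ 2 * ∫ x, r x ^ 2) := by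
      calc (10 * B + κ ^ 2) * ∫ x, ρ x ^ 2 ≤ (10 * B * κ ^ 2 + 5 * κ ^ 2) * ∫ x, r x ^ 2 := by
            refine mul_le_mul ?_ hρle (integral_nonneg fun x => sq_nonneg _) (by positivity)
            linarith [le_mul_of_one_le_right (by positivity : 0 ≤ 10 * B) k1]
        _ = _ := by ring
    have q3 : (κ ^ 2)⁻¹ * ∫ x, γ0 x ^ 2 ≤ (κ ^ 2)⁻¹ * ∫ x, g0 x ^ 2 := by gcongr
    nlinarith [mul_nonneg hB0 p2, mul_nonneg hB0 p3]
  have hibp : ∫ x, ρ x * pderiv j φ x = -∫ x, (pderiv j ρ x * χ x) * φ x := by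
    rw [integral_mul_pderiv (hρs.of_le (by norm_cast)) (hφ.1.of_le (by norm_cast)) hφ.2.1]
    congr 1
    refine integral_congr_ae (Eventually.of_forall fun x => ?_)
    by_cases hx : x ∈ Metric.ball (0 : E3) R₁
    -- The cutoff equals 1 on the ball carrying φ, so inserting it costs nothing.
    · have : χ x = 1 := Χ.one_of_mem_closedBall (Metric.ball_subset_closedBall hx)
      simp [this]
    · simp [hφ.eq_zero hx]
  rw [hibp, neg_sq]
  refine (sq_integral_mul_le ((hdρt j).memLp 2) (hφ.memLp 2)).trans ?_
  refine mul_le_mul_of_nonneg_right (le_trans ?_ hbound) (integral_nonneg fun x => sq_nonneg _)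
  refine integral_mono ((hdρt j).memLp 2).integrable_sq hi1 fun x => ?_
  simp only
  rw [mul_pow, mul_comm]
  gcongr
  exact Finset.single_le_sum (f := fun i => pderiv i ρ x ^ 2) (fun i _ => sq_nonneg _)
    (Finset.mem_univ j)

/-- The space of real test functions. -/
def realTestSpace (U : Set E3) : Submodule ℝ (E3 → ℝ) where
  carrier := {φ | IsTestFunction U φ}
  add_mem' h h' := IsTestFunction.add h h'
  zero_mem' := IsTestFunction.zero
  smul_mem' _ _ h := IsTestFunction.mul_left h contDiff_const

/-- A function whose distributional derivative is bounded on `L²` has a weak derivative in `L²`. -/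
theorem exists_weakPartial_of_le {U : Set E3} {r : E3 → ℝ} (hr : MemLp r 2) (j : Fin 3) {K : ℝ}
    (hK : 0 ≤ K) (h : ∀ φ : E3 → ℝ, IsTestFunction U φ →
      (∫ x, r x * pderiv j φ x) ^ 2 ≤ K ^ 2 * ∫ x, φ x ^ 2) :
    ∃ G : E3 → ℝ, MemLp G 2 ∧ (eLpNorm G 2 volume).toReal ≤ K ∧
      ∀ φ : E3 → ℝ, IsTestFunction U φ → ∫ x, r x * pderiv j φ x = -∫ x, G x * φ x := by
  let T : realTestSpace U →ₗ[ℝ] Lp ℝ 2 (volume : Measure E3) :=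
    { toFun := fun φ => (φ.2.memLp 2).toLp _
      map_add' := fun φ χ => rfl
      map_smul' := fun a φ => rfl }
  have hi : ∀ {φ : E3 → ℝ}, IsTestFunction U φ → Integrable (fun x => r x * pderiv j φ x) :=
    fun hφ => hr.integrable_mul ((hφ.pderiv j).memLp 2)
  let ℓ : realTestSpace U →ₗ[ℝ] ℝ :=
    { toFun := fun φ => -∫ x, r x * pderiv j (φ : E3 → ℝ) x
      map_add' := fun φ χ => by
        rw [← neg_add, ← integral_add (hi φ.2) (hi χ.2)]
        congr 1
        refine integral_congr_ae (Eventually.of_forall fun x => ?_)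
        have := pderiv_add (φ.2.differentiableAt x) (χ.2.differentiableAt x) j
        simp only [← mul_add, ← this]
        rfl
      map_smul' := fun a φ => by
        rw [RingHom.id_apply, smul_eq_mul, mul_neg, ← integral_const_mul]
        congr 1
        refine integral_congr_ae (Eventually.of_forall fun x => ?_)
        have := pderiv_const_mul (φ.2.differentiableAt x) a j
        simp only [mul_left_comm a, ← this]
        rfl }
  obtain ⟨g, hg, hgT⟩ := exists_inner_eq_of_le T ℓ hK (fun φ => by
    have h1 := h φ φ.2
    have h2 : ‖T φ‖ = (eLpNorm (φ : E3 → ℝ) 2 volume).toReal := Lp.norm_toLp _ (φ.2.memLp 2)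
    have h3 := toReal_eLpNorm_sq (φ.2.memLp 2)
    simp only [Real.norm_eq_abs, sq_abs] at h3
    rw [← h3, ← mul_pow] at h1
    rw [h2]
    change ‖-∫ x, r x * pderiv j (φ : E3 → ℝ) x‖ ≤ _
    rw [norm_neg, Real.norm_eq_abs]
    exact abs_le_of_sq_le_sq h1 (by positivity))
  refine ⟨g, Lp.memLp g, hg, fun φ hφ => ?_⟩
  have h1 := hgT ⟨φ, hφ⟩
  have h2 : inner ℝ g (T ⟨φ, hφ⟩) = ∫ x, g x * φ x := by
    rw [L2.inner_def]
    refine integral_congr_ae ?_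
    filter_upwards [(hφ.memLp 2).coeFn_toLp] with x hx
    change inner ℝ (g x) (((hφ.memLp 2).toLp φ : E3 →₂[volume] ℝ) x) = _
    rw [hx]
    simp [mul_comm]
  rw [h2] at h1
  rw [h1]
  exact (neg_neg _).symm

lemma lap_ofReal {φ : E3 → ℝ} (hφ : ContDiff ℝ ∞ φ) (x : E3) :
    lap (fun y => (φ y : ℂ)) x = ((lap φ x : ℝ) : ℂ) := by
  have h1 : ∀ j, pderiv j (fun y => (φ y : ℂ)) = fun y => ((pderiv j φ y : ℝ) : ℂ) := fun j =>
    funext fun y => pderiv_ofReal (hφ.differentiable (by simp) y) j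
  simp only [lap, h1, Complex.ofReal_sum]
  exact Finset.sum_congr rfl fun j _ => pderiv_ofReal ((hφ.pderiv j).differentiable (by simp) x) j

lemma integral_re_mul {f : E3 → ℂ} {φ : E3 → ℝ} (h : Integrable (fun x => f x * (φ x : ℂ))) :
    ∫ x, (f x).re * φ x = (∫ x, f x * (φ x : ℂ)).re := by
  have := Complex.reCLM.integral_comp_comm h
  simpa using this

lemma integral_im_mul {f : E3 → ℂ} {φ : E3 → ℝ} (h : Integrable (fun x => f x * (φ x : ℂ))) :
    ∫ x, (f x).im * φ x = (∫ x, f x * (φ x : ℂ)).im := by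
  have := Complex.imCLM.integral_comp_comm h
  simpa using this

lemma integral_sq_le_of_norm_le {f : E3 → ℂ} {u : E3 → ℝ} (hf : MemLp f 2) (hu : MemLp u 2)
    (h : ∀ x, |u x| ≤ ‖f x‖) : ∫ x, u x ^ 2 ≤ (eLpNorm f 2 volume).toReal ^ 2 := by
  rw [toReal_eLpNorm_sq hf]
  refine integral_mono hu.integrable_sq (hf.integrable_norm_pow (by norm_num)) fun x => ?_
  simp only
  rw [← sq_abs]
  exact pow_le_pow_left₀ (abs_nonneg _) (h x) 2

lemma HasWeakPartial.of_integral_eq {Ω U : Set E3} (hU : Ω ⊆ U) {j : Fin 3}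
    {u v : E3 → ℂ} (hu : LocallyIntegrable u) (hv : LocallyIntegrable v)
    (h : ∀ φ : E3 → ℝ, IsTestFunction U φ →
      ∫ x, u x * ((pderiv j φ x : ℝ) : ℂ) = -∫ x, v x * (φ x : ℂ)) : HasWeakPartial Ω j u v := by
  refine ⟨hu.locallyIntegrableOn _, hv.locallyIntegrableOn _, fun φ hφ => ?_⟩
  rw [setIntegral_eq_integral_of_forall_compl_eq_zero, setIntegral_eq_integral_of_forall_compl_eq_zero]
  · simpa [mul_comm] using h φ (hφ.mono hU)
  · intro x hx; simp [hφ.eq_zero hx]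
  · intro x hx; simp [(hφ.pderiv j).eq_zero hx]

/-- Interior regularity for complex valued distributional solutions of `Δr = -div g + g₀`. -/
theorem exists_weakGradient {R₁ R₂ : ℝ} (hR₁ : 0 < R₁) (hR : R₁ < R₂) : ∃ C : ℝ, 0 < C ∧
    ∀ (r g0 : E3 → ℂ) (g : Fin 3 → E3 → ℂ), Integrable r → MemLp r 2 → Integrable g0 →
      MemLp g0 2 → (∀ j, Integrable (g j)) → (∀ j, MemLp (g j) 2) →
    (∀ φ : E3 → ℂ, IsTestFunction (Metric.ball 0 R₂) φ →
      ∫ x, r x * lap φ x = (∑ j, ∫ x, g j x * pderiv j φ x) + ∫ x, g0 x * φ x) →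
    ∀ κ : ℝ, 1 ≤ κ → ∀ Ω : Set E3, Ω ⊆ Metric.ball 0 R₁ →
      ∃ G : Fin 3 → E3 → ℂ, HasWeakGradient Ω r G ∧ ∀ j, MemLp (G j) 2 ∧
        (eLpNorm (G j) 2 volume).toReal ≤ C * (κ * (eLpNorm r 2 volume).toReal
          + (∑ j, (eLpNorm (g j) 2 volume).toReal) + κ⁻¹ * (eLpNorm g0 2 volume).toReal) := by
  obtain ⟨C, hC, hmain⟩ := sq_integral_mul_pderiv_le hR₁ hR
  -- One √C for the real part and one for the imaginary part; the estimate is quadratic, hence the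
  -- roots.
  refine ⟨2 * √C, by positivity, ?_⟩
  intro r g0 g hr1 hr2 hg01 hg02 hg1 hg2 heq κ hκ Ω hΩ
  have hκ0 : 0 < κ := by linarith
  set N : ℝ := κ * (eLpNorm r 2 volume).toReal
    + (∑ j, (eLpNorm (g j) 2 volume).toReal) + κ⁻¹ * (eLpNorm g0 2 volume).toReal with hN
  have hN0 : 0 ≤ N := by positivity
  have hi : ∀ {f : E3 → ℂ}, MemLp f 2 → ∀ {φ : E3 → ℝ}, IsTestFunction (Metric.ball 0 R₂) φ →
      Integrable (fun x => f x * (φ x : ℂ)) := fun hf _ hφ =>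
    hf.integrable_mul (hφ.ofReal.memLp 2)
  have part : ∀ P : ℂ →L[ℝ] ℝ, (∀ z, |P z| ≤ ‖z‖) → ∀ j, ∃ G : E3 → ℝ, MemLp G 2 ∧
      (eLpNorm G 2 volume).toReal ≤ √C * N ∧ ∀ φ : E3 → ℝ, IsTestFunction (Metric.ball 0 R₁) φ →
        ∫ x, P (r x) * pderiv j φ x = -∫ x, G x * φ x := by
    intro P hP j
    have hPm : ∀ {f : E3 → ℂ}, MemLp f 2 → MemLp (fun x => P (f x)) 2 := fun hf => P.comp_memLp' hf
    have hPi : ∀ {f : E3 → ℂ}, Integrable f → Integrable (fun x => P (f x)) := fun hf =>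
      P.integrable_comp hf
    have hPmul : ∀ (z : ℂ) (t : ℝ), P (z * t) = P z * t := fun z t => by
      rw [mul_comm z, ← Complex.real_smul, map_smul, smul_eq_mul, mul_comm]
    have hPint : ∀ {f : E3 → ℂ}, MemLp f 2 → ∀ {φ : E3 → ℝ},
        IsTestFunction (Metric.ball 0 R₂) φ →
        ∫ x, P (f x) * φ x = P (∫ x, f x * (φ x : ℂ)) := fun hf _ hφ => by
      have := P.integral_comp_comm (hi hf hφ)
      simpa only [hPmul] using this
    refine exists_weakPartial_of_le (hPm hr2) j (by positivity) fun φ hφ => ?_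
    refine (hmain _ _ (fun j x => P (g j x)) (hPi hr1) (hPm hr2) (hPi hg01) (hPm hg02)
      (fun j => hPi (hg1 j)) (fun j => hPm (hg2 j)) (fun φ hφ => ?_) κ hκ j φ hφ).trans ?_
    · have h1 := congrArg P (heq _ hφ.ofReal)
      simp only [lap_ofReal hφ.1, pderiv_ofReal (hφ.differentiableAt _), map_add, map_sum] at h1
      rw [hPint hr2 hφ.lap, hPint hg02 hφ, h1]
      congr 1
      exact Finset.sum_congr rfl fun j _ => (hPint (hg2 j) (hφ.pderiv j)).symm
    · refine mul_le_mul_of_nonneg_right ?_ (integral_nonneg fun x => sq_nonneg _)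
      rw [mul_pow, Real.sq_sqrt hC.le]
      refine mul_le_mul_of_nonneg_left ?_ hC.le
      have a1 := integral_sq_le_of_norm_le hr2 (hPm hr2) (fun x => hP (r x))
      have a2 := integral_sq_le_of_norm_le hg02 (hPm hg02) (fun x => hP (g0 x))
      have a3 := fun j => integral_sq_le_of_norm_le (hg2 j) (hPm (hg2 j)) (fun x => hP (g j x))
      calc _ ≤ κ ^ 2 * (eLpNorm r 2 volume).toReal ^ 2
            + (∑ j, (eLpNorm (g j) 2 volume).toReal ^ 2)
            + (κ ^ 2)⁻¹ * (eLpNorm g0 2 volume).toReal ^ 2 := by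
            gcongr with j
            exact a3 j
        _ ≤ N ^ 2 := by
            have b1 : 0 ≤ κ * (eLpNorm r 2 volume).toReal := by positivity
            have b2 : 0 ≤ κ⁻¹ * (eLpNorm g0 2 volume).toReal := by positivity
            have b3 : ∀ j, 0 ≤ (eLpNorm (g j) 2 volume).toReal := fun j => ENNReal.toReal_nonneg
            have b4 : ∑ j, (eLpNorm (g j) 2 volume).toReal ^ 2 ≤
                (∑ j, (eLpNorm (g j) 2 volume).toReal) ^ 2 :=
              Finset.sum_sq_le_sq_sum_of_nonneg fun j _ => b3 j
            have b5 : 0 ≤ ∑ j, (eLpNorm (g j) 2 volume).toReal := Finset.sum_nonneg fun j _ => b3 j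
            have b6 : (κ ^ 2)⁻¹ * (eLpNorm g0 2 volume).toReal ^ 2
              = (κ⁻¹ * (eLpNorm g0 2 volume).toReal) ^ 2 := by rw [mul_pow, inv_pow]
            rw [b6, hN]
            nlinarith [mul_nonneg b1 b2, mul_nonneg b1 b5, mul_nonneg b2 b5]
  choose G1 hG1m hG1n hG1 using part Complex.reCLM Complex.abs_re_le_norm
  choose G2 hG2m hG2n hG2 using part Complex.imCLM Complex.abs_im_le_norm
  have hm1 : ∀ j, MemLp (fun x => (G1 j x : ℂ)) 2 := fun j => (hG1m j).ofReal
  have hm2 : ∀ j, MemLp (fun x => Complex.I * (G2 j x : ℂ)) 2 := fun j =>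
    (hG2m j).ofReal.const_mul _
  have hm : ∀ j, MemLp (fun x => (G1 j x : ℂ) + Complex.I * (G2 j x : ℂ)) 2 := fun j =>
    (hm1 j).add (hm2 j)
  refine ⟨fun j x => (G1 j x : ℂ) + Complex.I * (G2 j x : ℂ), fun j => ?_, fun j => ⟨hm j, ?_⟩⟩
  · refine HasWeakPartial.of_integral_eq hΩ (hr2.locallyIntegrable (by norm_num))
      ((hm j).locallyIntegrable (by norm_num)) fun φ hφ => ?_
    have hφ2 := hφ.mono (Metric.ball_subset_ball hR.le)
    have e1 := hG1 j φ hφ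
    have e2 := hG2 j φ hφ
    simp only [Complex.reCLM_apply, Complex.imCLM_apply] at e1 e2
    rw [integral_re_mul (hi hr2 (hφ2.pderiv j))] at e1
    rw [integral_im_mul (hi hr2 (hφ2.pderiv j))] at e2
    have i1 := hi (hm j) hφ2
    refine Complex.ext ?_ ?_
    · rw [e1, Complex.neg_re, ← integral_re_mul i1]
      simp
    · rw [e2, Complex.neg_im, ← integral_im_mul i1]
      simp
  · have t1 := eLpNorm_add_le (hm1 j).1 (hm2 j).1 (p := 2) (by norm_num)
    have t2 : eLpNorm (fun x => (G1 j x : ℂ)) 2 volume = eLpNorm (G1 j) 2 volume :=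
      eLpNorm_congr_norm_ae (Eventually.of_forall fun x => by simp)
    have t3 : eLpNorm (fun x => Complex.I * (G2 j x : ℂ)) 2 volume = eLpNorm (G2 j) 2 volume :=
      eLpNorm_congr_norm_ae (Eventually.of_forall fun x => by simp)
    rw [t2, t3] at t1
    have t4 := ENNReal.toReal_mono (ENNReal.add_ne_top.2 ⟨(hG1m j).2.ne, (hG2m j).2.ne⟩) t1
    rw [ENNReal.toReal_add (hG1m j).2.ne (hG2m j).2.ne] at t4
    refine t4.trans ?_
    have := hG1n j
    have := hG2n j
    linarith

/-! ### Lipschitz functions inside weak formulations. -/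

lemma measurable_pderiv (g : E3 → ℝ) (j : Fin 3) : Measurable (pderiv j g) :=
  measurable_fderiv_apply_const ℝ g (basisVec j)

lemma abs_pderiv_le_of_lipschitz {g : E3 → ℝ} {K : NNReal} (hg : LipschitzWith K g) (j : Fin 3)
    (x : E3) : |pderiv j g x| ≤ K :=
  (norm_pderiv_le j g x).trans (norm_fderiv_le_of_lipschitz ℝ hg)

/-- Integration by parts for Lipschitz functions. -/
lemma integral_pderiv_mul_of_lipschitz {g φ : E3 → ℝ} {K L : NNReal} (hg : LipschitzWith K g)
    (hφ : LipschitzWith L φ) (hc : HasCompactSupport φ) (j : Fin 3) :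
    ∫ x, pderiv j g x * φ x = -∫ x, g x * pderiv j φ x := by
  have h := LipschitzWith.integral_lineDeriv_mul_eq (μ := volume) hg hφ hc (basisVec j)
  have e1 : ∫ x, pderiv j g x * φ x = ∫ x, lineDeriv ℝ g x (basisVec j) * φ x := by
    refine integral_congr_ae ?_
    filter_upwards [hg.ae_differentiableAt (μ := volume)] with x hx
    rw [hx.lineDeriv_eq_fderiv, pderiv]
  rw [e1, h, ← integral_neg]
  refine integral_congr_ae ?_
  filter_upwards [hφ.ae_differentiableAt (μ := volume)] with x hx
  rw [hx.lineDeriv_eq_fderiv, pderiv, map_neg]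
  ring

lemma IsTestFunction.lipschitz {Ω : Set E3} {φ : E3 → ℝ} (hφ : IsTestFunction Ω φ) :
    ∃ L : NNReal, LipschitzWith L φ :=
  hφ.1.lipschitzWith_of_hasCompactSupport hφ.2.1 (by simp)

/-- The derivative on the bump is moved to g by integration by parts for Lipschitz functions, the
classical derivative of g existing almost everywhere. -/
lemma pderiv_molli_of_lipschitz (n : ℕ) {g : E3 → ℝ} {K : NNReal} (hg : LipschitzWith K g)
    (j : Fin 3) (x : E3) : pderiv j (molli n g) x = molli n (pderiv j g) x := by
  rw [pderiv_molli n hg.continuous.locallyIntegrable, molli_apply]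
  have hηd : Differentiable ℝ (eta n) := (contDiff_eta n).differentiable (by simp)
  obtain ⟨L, hL⟩ := (contDiff_eta n).lipschitzWith_of_hasCompactSupport
    (hasCompactSupport_eta n) (by simp)
  have hL' : LipschitzWith L (fun t => eta n (x - t)) := by
    have := hL.comp ((IsometryEquiv.subLeft x).isometry.lipschitz)
    rwa [mul_one] at this
  have hc : HasCompactSupport (fun t => eta n (x - t)) :=
    (hasCompactSupport_eta n).comp_homeomorph (Homeomorph.subLeft x)
  rw [integral_pderiv_mul_of_lipschitz hg hL' hc, ← integral_neg]
  refine integral_congr_ae (Eventually.of_forall fun t => ?_)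
  simp only
  rw [pderiv_comp_sub_left hηd]
  ring

lemma molli_eq_zero (n : ℕ) {f : E3 → ℝ} {s : Set E3} (hf : ∀ x ∉ s, f x = 0) {x : E3}
    (hx : x ∉ Metric.cthickening (1 / (n + 1)) s) : molli n f x = 0 := by
  rw [molli_apply]
  refine integral_eq_zero_of_ae (Eventually.of_forall fun t => ?_)
  by_cases ht : t ∈ s
  · have : eta n (x - t) = 0 := by
      refine image_eq_zero_of_notMem_tsupport fun h => hx ?_
      rw [tsupport_eta, mem_closedBall_zero_iff] at h
      exact Metric.mem_cthickening_of_dist_le x t _ s ht (by rwa [dist_eq_norm])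
    simp [this]
  · simp [hf t ht]

/-- Compactly supported Lipschitz functions are admissible in the definition of weak derivatives. -/
theorem HasWeakPartial.integral_lipschitz {Ω : Set E3} (hΩ : IsOpen Ω) {j : Fin 3} {u v : E3 → ℂ}
    (h : HasWeakPartial Ω j u v) {g : E3 → ℝ} {K : NNReal} (hg : LipschitzWith K g)
    (hgc : HasCompactSupport g) (hgΩ : tsupport g ⊆ Ω) :
    ∫ x in Ω, ((pderiv j g x : ℝ) : ℂ) * u x = -∫ x in Ω, (g x : ℂ) * v x := by
  obtain ⟨δ, hδ, hδΩ⟩ := hgc.isCompact.exists_cthickening_subset_open hΩ hgΩ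
  set S := Metric.cthickening δ (tsupport g) with hS
  have hSc : IsCompact S := hgc.isCompact.cthickening
  have hgli : LocallyIntegrable g := hg.continuous.locallyIntegrable
  have hev : ∀ᶠ n : ℕ in atTop, (1 : ℝ) / (n + 1) ≤ δ :=
    (tendsto_one_div_add_atTop_nhds_zero_nat (𝕜 := ℝ)).eventually_le_const hδ
  have hz : ∀ n : ℕ, (1 : ℝ) / (n + 1) ≤ δ → ∀ f : E3 → ℝ, (∀ x ∉ tsupport g, f x = 0) →
      ∀ x ∉ S, molli n f x = 0 := fun n hn f hf x hx =>
    molli_eq_zero n hf fun h => hx (Metric.cthickening_mono hn _ h)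
  have hg0 : ∀ x ∉ tsupport g, g x = 0 := fun x hx => image_eq_zero_of_notMem_tsupport hx
  have hdg0 : ∀ x ∉ tsupport g, pderiv j g x = 0 := fun x hx =>
    image_eq_zero_of_notMem_tsupport fun h => hx (tsupport_pderiv_subset g j h)
  have htest : ∀ n : ℕ, (1 : ℝ) / (n + 1) ≤ δ → IsTestFunction Ω (molli n g) := by
    intro n hn
    have hts : tsupport (molli n g) ⊆ S := by
      refine closure_minimal (fun x hx => ?_) hSc.isClosed
      by_contra hx'
      exact hx (hz n hn g hg0 x hx')
    exact ⟨contDiff_molli n hgli, hSc.of_isClosed_subset (isClosed_tsupport _) hts, hts.trans hδΩ⟩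
  obtain ⟨B, hB⟩ := hgc.exists_bound_of_continuous hg.continuous
  -- Both sides are limits of integrals against mollifications. These are eventually supported in
  -- the fixed compact set S inside Ω, where w is integrable, so dominated convergence applies to g
  -- as well as to its merely bounded derivative.
  have conv : ∀ {f : E3 → ℝ} {w : E3 → ℂ} {B : ℝ}, (∀ x ∉ tsupport g, f x = 0) → (∀ x, |f x| ≤ B) →
      LocallyIntegrable f → LocallyIntegrableOn w Ω →
      Tendsto (fun n => ∫ x in Ω, (molli n f x : ℂ) * w x) atTop
        (𝓝 (∫ x in Ω, (f x : ℂ) * w x)) := by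
    intro f w B hf0 hfB hfi hw
    refine tendsto_integral_filter_of_dominated_convergence
      (S.indicator fun x => B * ‖w x‖) ?_ ?_ ?_ ?_
    · refine Eventually.of_forall fun n => ?_
      refine AEStronglyMeasurable.mul ?_ hw.aestronglyMeasurable
      exact (Complex.continuous_ofReal.comp (contDiff_molli n hfi).continuous).aestronglyMeasurable
    · filter_upwards [hev] with n hn
      refine Eventually.of_forall fun x => ?_
      by_cases hx : x ∈ S
      · rw [indicator_of_mem hx, norm_mul, Complex.norm_real]
        gcongr
        exact abs_molli_le n hfB x
      · rw [indicator_of_notMem hx, hz n hn f hf0 x hx]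
        simp
    · rw [integrable_indicator_iff hSc.measurableSet, IntegrableOn,
        Measure.restrict_restrict hSc.measurableSet, inter_eq_left.2 hδΩ]
      exact ((hw.integrableOn_compact_subset hδΩ hSc).norm).const_mul B
    · filter_upwards [ae_restrict_of_ae (ae_tendsto_molli hfi)] with x hx
      exact ((Complex.continuous_ofReal.tendsto _).comp hx).mul_const _
  have hdgB := abs_pderiv_le_of_lipschitz hg j
  have hdgi : LocallyIntegrable (pderiv j g) := by
    refine (locallyIntegrable_const (K : ℝ)).mono (measurable_pderiv g j).aestronglyMeasurable
      (Eventually.of_forall fun x => ?_)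
    simpa using hdgB x
  have t1 := conv hdg0 hdgB hdgi h.1
  have t2 := conv hg0 hB hgli h.2.1
  refine tendsto_nhds_unique t1 (t2.neg.congr' ?_)
  filter_upwards [hev] with n hn
  have := h.2.2 _ (htest n hn)
  simp only [pderiv_molli_of_lipschitz n hg, Complex.real_smul] at this
  rw [this]

lemma lipschitzWith_coord {A : E3 → E3} {K : NNReal} (hA : LipschitzWith K A) (i : Fin 3) :
    LipschitzWith K (fun x => A x i) := by
  refine LipschitzWith.of_dist_le_mul fun x y => ?_
  refine le_trans ?_ (hA.dist_le_mul x y)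
  rw [dist_eq_norm, dist_eq_norm, Real.norm_eq_abs]
  exact abs_coord_le (A x - A y) i

/-- The classical partial derivatives of the components of a vector field. -/
def fieldDeriv (A : E3 → E3) (j : Fin 3) (x : E3) : E3 :=
  WithLp.toLp 2 fun i => pderiv j (fun y => A y i) x

lemma measurable_fieldDeriv (A : E3 → E3) (j : Fin 3) : Measurable (fieldDeriv A j) :=
  (WithLp.measurable_toLp 2 _).comp
    (measurable_pi_lambda _ fun i => measurable_pderiv (fun y => A y i) j)

lemma hasWeakGradient_of_lipschitz {Ω : Set E3} {A A' : E3 → E3} {K : NNReal}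
    (hA : LipschitzWith K A') (hAA' : A' =ᵐ[volume.restrict Ω] A) :
    HasWeakGradient Ω A (fieldDeriv A') := by
  intro j
  have hb : ∀ x, ‖fieldDeriv A' j x‖ ≤ ∑ _i : Fin 3, (K : ℝ) := fun x => by
    rw [← sum_smul_basisVec (fieldDeriv A' j x)]
    refine (norm_sum_le _ _).trans (Finset.sum_le_sum fun i _ => ?_)
    rw [norm_smul, norm_basisVec, mul_one]
    exact abs_pderiv_le_of_lipschitz (lipschitzWith_coord hA i) j x
  have hD : LocallyIntegrable (fieldDeriv A' j) := by
    refine (locallyIntegrable_const (∑ _i : Fin 3, (K : ℝ))).mono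
      (measurable_fieldDeriv A' j).aestronglyMeasurable (Eventually.of_forall fun x => ?_)
    exact (hb x).trans (le_abs_self _)
  have hA'i : LocallyIntegrable A' := hA.continuous.locallyIntegrable
  have hint : ∀ {f : E3 → E3}, LocallyIntegrable f → ∀ {φ : E3 → ℝ}, IsTestFunction Ω φ →
      Integrable (fun x => φ x • f x) := fun hf φ hφ =>
    hf.integrable_smul_left_of_hasCompactSupport hφ.continuous hφ.2.1
  refine ⟨?_, hD.locallyIntegrableOn _, fun φ hφ => ?_⟩
  -- Local integrability of A itself is inherited from A', with which it agrees almost everywhere in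
  -- Ω.
  · intro x hx
    obtain ⟨s, hs, hsi⟩ := hA'i.locallyIntegrableOn Ω x hx
    rw [mem_nhdsWithin] at hs
    obtain ⟨u, huo, hxu, hus⟩ := hs
    refine ⟨u ∩ Ω, inter_mem (mem_nhdsWithin_of_mem_nhds (huo.mem_nhds hxu)) self_mem_nhdsWithin, ?_⟩
    refine (hsi.mono_set hus).congr ?_
    exact ae_restrict_of_ae_restrict_of_subset inter_subset_right hAA'
  · have e0 : ∫ x in Ω, pderiv j φ x • A x = ∫ x in Ω, pderiv j φ x • A' x := by
      refine integral_congr_ae ?_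
      filter_upwards [hAA'] with x hx
      rw [hx]
    rw [e0, setIntegral_eq_integral_of_forall_compl_eq_zero,
      setIntegral_eq_integral_of_forall_compl_eq_zero]
    · obtain ⟨L, hL⟩ := hφ.lipschitz
      ext i
      have c1 := (EuclideanSpace.proj (𝕜 := ℝ) i : E3 →L[ℝ] ℝ).integral_comp_comm
        (hint hA'i (hφ.pderiv j))
      have c2 := (EuclideanSpace.proj (𝕜 := ℝ) i : E3 →L[ℝ] ℝ).integral_comp_comm (hint hD hφ)
      simp only [PiLp.proj_apply, PiLp.smul_apply, smul_eq_mul] at c1 c2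
      rw [PiLp.neg_apply, ← c1, ← c2]
      have := integral_pderiv_mul_of_lipschitz (lipschitzWith_coord hA i) hL hφ.2.1 j
      simp only [fieldDeriv, mul_comm (φ _)]
      rw [this, neg_neg]
      simp only [mul_comm]
    · intro x hx; simp [hφ.eq_zero hx]
    · intro x hx; simp [(hφ.pderiv j).eq_zero hx]

section

lemma lipschitzWith_mul {f g : E3 → ℝ} {K L : NNReal} (hf : LipschitzWith K f)
    (hg : LipschitzWith L g) {B B' : NNReal} (hB : ∀ x, |f x| ≤ B) (hB' : ∀ x, |g x| ≤ B') :
    LipschitzWith (K * B' + B * L) (fun x => f x * g x) := by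
  refine LipschitzWith.of_dist_le_mul fun x y => ?_
  have h1 := hf.dist_le_mul x y
  have h2 := hg.dist_le_mul x y
  rw [Real.dist_eq] at *
  have : f x * g x - f y * g y = (f x - f y) * g x + f y * (g x - g y) := by ring
  rw [this]
  refine (abs_add_le _ _).trans ?_
  rw [abs_mul, abs_mul]
  push_cast
  calc |f x - f y| * |g x| + |f y| * |g x - g y| ≤ (K * dist x y) * B' + B * (L * dist x y) := by
        gcongr
        · exact hB' x
        · exact hB y
    _ = _ := by ring

variable {Ω : Set E3}

lemma IsTestFunction.exists_abs_le {φ : E3 → ℝ} (hφ : IsTestFunction Ω φ) :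
    ∃ B : NNReal, ∀ x, |φ x| ≤ B := by
  obtain ⟨B, hB⟩ := hφ.2.1.exists_bound_of_continuous hφ.continuous
  exact ⟨B.toNNReal, fun x => (hB x).trans (Real.le_coe_toNNReal B)⟩

lemma LocallyIntegrableOn.integrable_mul_testFunction {w : E3 → ℂ} (hw : LocallyIntegrableOn w Ω)
    {φ : E3 → ℂ} (hφ : Continuous φ) (hφc : HasCompactSupport φ) (hφΩ : tsupport φ ⊆ Ω) :
    Integrable (fun x => φ x * w x) (volume.restrict Ω) := by
  obtain ⟨B, hB⟩ := hφc.exists_bound_of_continuous hφ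
  have h1 : Integrable ((tsupport φ).indicator fun x => B * ‖w x‖) (volume.restrict Ω) := by
    rw [integrable_indicator_iff (isClosed_tsupport φ).measurableSet, IntegrableOn,
      Measure.restrict_restrict (isClosed_tsupport φ).measurableSet, inter_eq_left.2 hφΩ]
    exact ((hw.integrableOn_compact_subset hφΩ hφc.isCompact).norm).const_mul B
  refine h1.mono' (hφ.aestronglyMeasurable.mul hw.aestronglyMeasurable)
    (Eventually.of_forall fun x => ?_)
  by_cases hx : x ∈ tsupport φ
  · rw [indicator_of_mem hx, norm_mul]
    gcongr
    exact hB x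
  · rw [image_eq_zero_of_notMem_tsupport hx]
    simp [indicator_of_notMem hx]

/-- Complex test functions are admissible in the definition of weak derivatives. -/
lemma HasWeakPartial.integral_complex {j : Fin 3} {u v : E3 → ℂ}
    (h : HasWeakPartial Ω j u v) {φ : E3 → ℂ} (hφ : IsTestFunction Ω φ) :
    ∫ x in Ω, pderiv j φ x * u x = -∫ x in Ω, φ x * v x := by
  have int : ∀ {w : E3 → ℂ}, LocallyIntegrableOn w Ω → ∀ {χ : E3 → ℝ}, IsTestFunction Ω χ →
      Integrable (fun x => (χ x : ℂ) * w x) (volume.restrict Ω) := fun hw χ hχ =>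
    LocallyIntegrableOn.integrable_mul_testFunction hw hχ.ofReal.continuous hχ.ofReal.2.1
      hχ.ofReal.2.2
  have split : ∀ {w : E3 → ℂ}, LocallyIntegrableOn w Ω → ∀ {χ : E3 → ℂ}, IsTestFunction Ω χ →
      ∫ x in Ω, χ x * w x = (∫ x in Ω, ((χ x).re : ℂ) * w x)
        + Complex.I * ∫ x in Ω, ((χ x).im : ℂ) * w x := by
    intro w hw χ hχ
    rw [← integral_const_mul, ← integral_add (int hw hχ.re) ((int hw hχ.im).const_mul _)]
    refine integral_congr_ae (Eventually.of_forall fun x => ?_)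
    simp only
    conv_lhs => rw [← Complex.re_add_im (χ x)]
    ring
  have h1 := h.2.2 _ hφ.re
  have h2 := h.2.2 _ hφ.im
  simp only [pderiv_re (hφ.differentiableAt _), pderiv_im (hφ.differentiableAt _),
    Complex.real_smul] at h1 h2
  rw [split h.1 (hφ.pderiv j), split h.2.1 hφ, h1, h2]
  ring

/-- Products of Lipschitz functions and complex test functions are admissible in the definition of
weak derivatives. -/
lemma HasWeakPartial.integral_lipschitz_mul (hΩ : IsOpen Ω) {j : Fin 3} {u v : E3 → ℂ}
    (h : HasWeakPartial Ω j u v) {a : E3 → ℝ} {K B : NNReal} (ha : LipschitzWith K a)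
    (hB : ∀ x, |a x| ≤ B) {φ : E3 → ℂ} (hφ : IsTestFunction Ω φ) :
    ∫ x in Ω, ((a x : ℂ) * φ x) * v x =
      -∫ x in Ω, (((pderiv j a x : ℝ) : ℂ) * φ x + (a x : ℂ) * pderiv j φ x) * u x := by
  have key : ∀ {χ : E3 → ℝ}, IsTestFunction Ω χ → ∫ x in Ω, ((a x * χ x : ℝ) : ℂ) * v x =
      -∫ x in Ω, ((pderiv j a x * χ x + a x * pderiv j χ x : ℝ) : ℂ) * u x := by
    intro χ hχ
    obtain ⟨L, hL⟩ := hχ.lipschitz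
    obtain ⟨B', hB'⟩ := hχ.exists_abs_le
    have hts : tsupport (fun x => a x * χ x) ⊆ tsupport χ :=
      closure_mono fun x hx hx' => hx (by simp [hx'])
    -- The product aχ is compactly supported and Lipschitz, hence admissible although it is not
    -- smooth.
    have := h.integral_lipschitz hΩ (lipschitzWith_mul ha hL hB hB')
      (hχ.2.1.of_isClosed_subset (isClosed_tsupport _) hts) (hts.trans hχ.2.2)
    rw [eq_neg_iff_add_eq_zero, add_comm, ← eq_neg_iff_add_eq_zero, ← this]
    refine integral_congr_ae (ae_restrict_of_ae ?_)
    filter_upwards [ha.ae_differentiableAt (μ := volume)] with x hx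
    rw [pderiv_mul hx (hχ.differentiableAt x)]
  have int1 : ∀ {χ : E3 → ℝ}, IsTestFunction Ω χ →
      Integrable (fun x => ((a x * χ x : ℝ) : ℂ) * v x) (volume.restrict Ω) := by
    intro χ hχ
    have hts : tsupport (fun x => ((a x * χ x : ℝ) : ℂ)) ⊆ tsupport χ :=
      closure_mono fun x hx hx' => hx (by simp [hx'])
    exact LocallyIntegrableOn.integrable_mul_testFunction h.2.1
      (Complex.continuous_ofReal.comp (ha.continuous.mul hχ.continuous))
      (hχ.2.1.of_isClosed_subset (isClosed_tsupport _) hts) (hts.trans hχ.2.2)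
  have int2 : ∀ {χ : E3 → ℝ}, IsTestFunction Ω χ →
      Integrable (fun x => ((pderiv j a x * χ x + a x * pderiv j χ x : ℝ) : ℂ) * u x)
        (volume.restrict Ω) := by
    intro χ hχ
    have i1 := LocallyIntegrableOn.integrable_mul_testFunction h.1 hχ.ofReal.continuous
      hχ.ofReal.2.1 hχ.ofReal.2.2
    have i2 := LocallyIntegrableOn.integrable_mul_testFunction h.1 (hχ.pderiv j).ofReal.continuous
      (hχ.pderiv j).ofReal.2.1 (hχ.pderiv j).ofReal.2.2
    have i3 := i1.bdd_mul (c := K) (f := fun x => ((pderiv j a x : ℝ) : ℂ))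
      (Complex.measurable_ofReal.comp (measurable_pderiv a j)).aestronglyMeasurable
      (Eventually.of_forall fun x => by simpa using abs_pderiv_le_of_lipschitz ha j x)
    have i4 := i2.bdd_mul (c := B) (f := fun x => (a x : ℂ))
      (Complex.continuous_ofReal.comp ha.continuous).aestronglyMeasurable
      (Eventually.of_forall fun x => by simpa using hB x)
    refine (i3.add i4).congr (Eventually.of_forall fun x => ?_)
    simp only [Pi.add_apply]
    push_cast
    ring
  have k1 := key hφ.re
  have k2 := key hφ.im
  calc ∫ x in Ω, ((a x : ℂ) * φ x) * v x
      = (∫ x in Ω, ((a x * (φ x).re : ℝ) : ℂ) * v x)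
        + Complex.I * ∫ x in Ω, ((a x * (φ x).im : ℝ) : ℂ) * v x := by
        rw [← integral_const_mul, ← integral_add (int1 hφ.re) ((int1 hφ.im).const_mul _)]
        refine integral_congr_ae (Eventually.of_forall fun x => ?_)
        simp only
        conv_lhs => rw [← Complex.re_add_im (φ x)]
        push_cast
        ring
    _ = -∫ x in Ω, (((pderiv j a x : ℝ) : ℂ) * φ x + (a x : ℂ) * pderiv j φ x) * u x := by
        rw [k1, k2, mul_neg, ← neg_add, ← integral_const_mul,
          ← integral_add (int2 hφ.re) ((int2 hφ.im).const_mul _)]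
        congr 1
        refine integral_congr_ae (Eventually.of_forall fun x => ?_)
        simp only [pderiv_re (hφ.differentiableAt x), pderiv_im (hφ.differentiableAt x)]
        conv_rhs => rw [← Complex.re_add_im (φ x), ← Complex.re_add_im (pderiv j φ x)]
        push_cast
        ring

/-- Leibniz rule for the product of a weakly differentiable function and `e^{x·ζ/h}`. -/
lemma HasWeakPartial.phase_mul {j : Fin 3} {u v : E3 → ℂ} (h : HasWeakPartial Ω j u v) (ζ : C3)
    (t : ℝ) (hΩ : IsOpen Ω) : HasWeakPartial Ω j (fun x => phase ζ t x * u x)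
      (fun x => phase ζ t x * (v x + ζ j / t * u x)) := by
  have hE := (contDiff_phase ζ t)
  have hloc : ∀ {w : E3 → ℂ}, LocallyIntegrableOn w Ω →
      LocallyIntegrableOn (fun x => phase ζ t x * w x) Ω := fun hw =>
    hw.continuousOn_mul hE.continuous.continuousOn hΩ.isLocallyClosed
  have hv' : LocallyIntegrableOn (fun x => v x + ζ j / t * u x) Ω :=
    h.2.1.add (h.1.continuousOn_mul continuousOn_const hΩ.isLocallyClosed)
  refine ⟨hloc h.1, hloc hv', fun φ hφ => ?_⟩
  have hφc := hφ.ofReal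
  have hEφ := hφc.mul_left hE
  have key := h.integral_complex hEφ
  have hpd : ∀ x, pderiv j (fun y => phase ζ t y * (φ y : ℂ)) x =
      phase ζ t x * (ζ j / t) * φ x + phase ζ t x * ((pderiv j φ x : ℝ) : ℂ) := fun x => by
    rw [pderiv_mul (hE.differentiable (by simp) x) (hφc.differentiableAt x), pderiv_phase,
      pderiv_ofReal (hφ.differentiableAt x)]
  have i1 : Integrable (fun x => (phase ζ t x * ((pderiv j φ x : ℝ) : ℂ)) * u x)
      (volume.restrict Ω) :=
    LocallyIntegrableOn.integrable_mul_testFunction h.1 ((hφ.pderiv j).ofReal.mul_left hE).continuous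
      ((hφ.pderiv j).ofReal.mul_left hE).2.1 ((hφ.pderiv j).ofReal.mul_left hE).2.2
  have i2 : Integrable (fun x => (phase ζ t x * (φ x : ℂ)) * u x) (volume.restrict Ω) :=
    LocallyIntegrableOn.integrable_mul_testFunction h.1 hEφ.continuous hEφ.2.1 hEφ.2.2
  have i3 : Integrable (fun x => (phase ζ t x * (φ x : ℂ)) * v x) (volume.restrict Ω) :=
    LocallyIntegrableOn.integrable_mul_testFunction h.2.1 hEφ.continuous hEφ.2.1 hEφ.2.2
  have e1 : ∫ x in Ω, pderiv j (fun y => phase ζ t y * (φ y : ℂ)) x * u x =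
      (ζ j / t) * (∫ x in Ω, (phase ζ t x * (φ x : ℂ)) * u x)
        + ∫ x in Ω, (phase ζ t x * ((pderiv j φ x : ℝ) : ℂ)) * u x := by
    rw [← integral_const_mul, ← integral_add (i2.const_mul _) i1]
    refine integral_congr_ae (Eventually.of_forall fun x => ?_)
    simp only [hpd]
    ring
  have e2 : ∫ x in Ω, φ x • (phase ζ t x * (v x + ζ j / t * u x)) =
      (∫ x in Ω, (phase ζ t x * (φ x : ℂ)) * v x)
        + (ζ j / t) * ∫ x in Ω, (phase ζ t x * (φ x : ℂ)) * u x := by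
    rw [← integral_const_mul, ← integral_add i3 (i2.const_mul _)]
    refine integral_congr_ae (Eventually.of_forall fun x => ?_)
    simp only [Complex.real_smul]
    ring
  have e3 : ∫ x in Ω, pderiv j φ x • (phase ζ t x * u x) =
      ∫ x in Ω, (phase ζ t x * ((pderiv j φ x : ℝ) : ℂ)) * u x := by
    refine integral_congr_ae (Eventually.of_forall fun x => ?_)
    simp only [Complex.real_smul]
    ring
  rw [e3, e2]
  rw [e1] at key
  linear_combination key

end

/-! ### From the conjugated equation to the magnetic weak formulation. -/

/-- The first order coefficient of the transposed magnetic operator. -/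
def magB (A : E3 → E3) (j : Fin 3) (x : E3) : ℂ := 2 * Complex.I * (A x j : ℂ)

/-- The zeroth order coefficient of the transposed magnetic operator. -/
def magC (A : E3 → E3) (q : E3 → ℂ) (x : E3) : ℂ :=
  Complex.I * (∑ j, (fieldDeriv A j x j : ℂ)) + (∑ j, (A x j : ℂ) ^ 2) + q x

lemma memLp_mul_of_bounded {Ω : Set E3} {R : ℝ} (hΩ : MeasurableSet Ω)
    (hΩR : Ω ⊆ Metric.ball 0 R) {E : E3 → ℂ} (hE : Continuous E) {w : E3 → ℂ} {p : ℝ≥0∞}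
    (hw : MemLp w p (volume.restrict Ω)) :
    MemLp (fun x => E x * w x) p (volume.restrict Ω) := by
  obtain ⟨B, hB⟩ := (isCompact_closedBall (0 : E3) R).exists_bound_of_continuousOn hE.continuousOn
  refine hw.of_le_mul (c := B) (hE.aestronglyMeasurable.mul hw.1) ?_
  filter_upwards [ae_restrict_mem hΩ] with x hx
  rw [norm_mul]
  gcongr
  exact hB x (Metric.ball_subset_closedBall (hΩR hx))

/-- A distributional solution of the conjugated transposed equation gives rise to a weak solution of
the magnetic Schrödinger equation. -/
theorem isWeakSolution_phase_mul {Ω : Set E3} {R : ℝ} (hΩ : IsOpen Ω) (hΩR : Ω ⊆ Metric.ball 0 R)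
    {A A' : E3 → E3} {q q' : E3 → ℂ} {K B Q : NNReal} (hA : LipschitzWith K A')
    (hB : ∀ x, ‖A' x‖ ≤ B) (hAA' : A' =ᵐ[volume.restrict Ω] A) (hq'm : Measurable q')
    (hQ : ∀ x, ‖q' x‖ ≤ Q) (hqq' : q' =ᵐ[volume.restrict Ω] q)
    {ζ : C3} (hζ : cdot ζ ζ = 0) {h : ℝ} {w : E3 → ℂ} {G : Fin 3 → E3 → ℂ}
    (hw : MemLp w 2 (volume.restrict Ω)) (hG : ∀ j, MemLp (G j) 2 (volume.restrict Ω))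
    (hwG : HasWeakGradient Ω w G)
    (heq : ∀ φ : E3 → ℂ, IsTestFunction Ω φ →
      ∫ x in Ω, w x * ellOp (conjB (magB A') ζ h) (conjC (magB A') (magC A' q') ζ h) φ x = 0) :
    MemH1 Ω (fun x => phase ζ h x * w x) ∧
      IsWeakSolution Ω A q (fun x => phase ζ h x * w x) := by
  set u : E3 → ℂ := fun x => phase ζ h x * w x with hu
  set Gu : Fin 3 → E3 → ℂ := fun j x => phase ζ h x * (G j x + ζ j / h * w x) with hGu
  have hphc : Continuous (phase ζ h) := (contDiff_phase ζ h).continuous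
  have hum : MemLp u 2 (volume.restrict Ω) := memLp_mul_of_bounded hΩ.measurableSet hΩR hphc hw
  have hGum : ∀ j, MemLp (Gu j) 2 (volume.restrict Ω) := fun j =>
    memLp_mul_of_bounded hΩ.measurableSet hΩR hphc ((hG j).add (hw.const_mul _))
  have huG : HasWeakGradient Ω u Gu := fun j => (hwG j).phase_mul ζ h hΩ
  refine ⟨⟨hum, Gu, huG, hGum⟩, Gu, fieldDeriv A', huG, hasWeakGradient_of_lipschitz hA hAA',
    fun v hv => ?_⟩
  -- Replacing v by its conjugate turns the weak formulation into a bilinear pairing, so all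
  -- derivatives can be transposed onto V.
  set V : E3 → ℂ := fun x => conj (v x) with hV
  have hVt : IsTestFunction Ω V := hv.conjugate
  have hcv : ∀ j x, conj (pderiv j v x) = pderiv j V x := fun j x =>
    (pderiv_conj (hv.differentiableAt x) j).symm
  have hVm : MemLp V 2 (volume.restrict Ω) := (hVt.memLp 2).restrict _
  have hdVm : ∀ j, MemLp (pderiv j V) 2 (volume.restrict Ω) := fun j =>
    ((hVt.pderiv j).memLp 2).restrict _
  have hAi : ∀ j, LipschitzWith K (fun x => A' x j) := fun j => lipschitzWith_coord hA j
  have hAB : ∀ j x, |A' x j| ≤ B := fun j x => (abs_coord_le (A' x) j).trans (hB x)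
  have hAm : ∀ j, Measurable (fun x => (A' x j : ℂ)) := fun j =>
    Complex.measurable_ofReal.comp (hAi j).continuous.measurable
  have hdAm : ∀ j, Measurable (fun x => ((pderiv j (fun y => A' y j) x : ℝ) : ℂ)) := fun j =>
    Complex.measurable_ofReal.comp (measurable_pderiv _ j)
  have hdAB : ∀ j x, |pderiv j (fun y => A' y j) x| ≤ K := fun j x =>
    abs_pderiv_le_of_lipschitz (hAi j) j x
  have bdd : ∀ {c f : E3 → ℂ} {C : ℝ}, Measurable c → (∀ x, ‖c x‖ ≤ C) →
      MemLp f 2 (volume.restrict Ω) → MemLp (fun x => c x * f x) 2 (volume.restrict Ω) := by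
    intro c f C hc hC hf
    refine hf.of_le_mul (c := C) (hc.aestronglyMeasurable.mul hf.1) (Eventually.of_forall fun x => ?_)
    rw [norm_mul]
    gcongr
    exact hC x
  have hAVm : ∀ j, MemLp (fun x => (A' x j : ℂ) * V x) 2 (volume.restrict Ω) := fun j =>
    bdd (hAm j) (fun x => by simpa using hAB j x) hVm
  have hAdVm : ∀ j, MemLp (fun x => ((pderiv j (fun y => A' y j) x : ℝ) : ℂ) * V x
      + (A' x j : ℂ) * pderiv j V x) 2 (volume.restrict Ω) := fun j =>
    (bdd (hdAm j) (fun x => by simpa using hdAB j x) hVm).add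
      (bdd (hAm j) (fun x => by simpa using hAB j x) (hdVm j))
  have hddVm : ∀ j, MemLp (pderiv j (pderiv j V)) 2 (volume.restrict Ω) := fun j =>
    (((hVt.pderiv j).pderiv j).memLp 2).restrict _
  set c1 : E3 → ℂ := fun x => -Complex.I * (∑ j, ((pderiv j (fun y => A' y j) x : ℝ) : ℂ))
    + (∑ j, (A' x j : ℂ) ^ 2) + q' x with hc1
  have hc1V : MemLp (fun x => c1 x * V x) 2 (volume.restrict Ω) := by
    refine bdd (C := 3 * K + 3 * B ^ 2 + Q) (by rw [hc1]; fun_prop) (fun x => ?_) hVm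
    refine (norm_add_le _ _).trans (add_le_add ((norm_add_le _ _).trans (add_le_add ?_ ?_)) (hQ x))
    · rw [norm_mul, norm_neg, Complex.norm_I, one_mul]
      refine (norm_sum_le _ _).trans ((Finset.sum_le_card_nsmul _ _ (K : ℝ) fun j _ => ?_).trans ?_)
      · simpa using hdAB j x
      · simp
    · refine (norm_sum_le _ _).trans
        ((Finset.sum_le_card_nsmul _ _ ((B : ℝ) ^ 2) fun j _ => ?_).trans ?_)
      · rw [norm_pow, Complex.norm_real]
        exact pow_le_pow_left₀ (norm_nonneg _) (hAB j x) 2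
      · simp
  -- the three groups of terms in the weak formulation
  have t1 : ∀ j, ∫ x in Ω, Gu j x * pderiv j V x = -∫ x in Ω, u x * pderiv j (pderiv j V) x := by
    intro j
    have := (huG j).integral_complex (hVt.pderiv j)
    simp only [mul_comm (u _), mul_comm (Gu j _)]
    rw [this, neg_neg]
  -- This is where the divergence of A changes sign: moving ∂_j off u produces 2i div A, which
  -- combines with -i div A to the +i div A of `magC`.
  have t2 : ∀ j, ∫ x in Ω, ((A' x j : ℂ) * V x) * Gu j x =
      -∫ x in Ω, (((pderiv j (fun y => A' y j) x : ℝ) : ℂ) * V x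
        + (A' x j : ℂ) * pderiv j V x) * u x := fun j =>
    (huG j).integral_lipschitz_mul hΩ (hAi j) (hAB j) hVt
  have i1 : ∀ j, Integrable (fun x => Gu j x * pderiv j V x) (volume.restrict Ω) := fun j =>
    (hGum j).integrable_mul (hdVm j)
  have i2 : ∀ j, Integrable (fun x => ((A' x j : ℂ) * V x) * Gu j x) (volume.restrict Ω) := fun j =>
    (hAVm j).integrable_mul (hGum j)
  have i3 : Integrable (fun x => (c1 x * V x) * u x) (volume.restrict Ω) :=
    hc1V.integrable_mul hum
  have i4 : ∀ j, Integrable (fun x => u x * pderiv j (pderiv j V) x) (volume.restrict Ω) := fun j =>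
    hum.integrable_mul (hddVm j)
  have i5 : ∀ j, Integrable (fun x => (((pderiv j (fun y => A' y j) x : ℝ) : ℂ) * V x
        + (A' x j : ℂ) * pderiv j V x) * u x) (volume.restrict Ω) := fun j =>
    (hAdVm j).integrable_mul hum
  calc _ = ∫ x in Ω, ((∑ j, Gu j x * pderiv j V x)
        + (-2 * Complex.I) * (∑ j, ((A' x j : ℂ) * V x) * Gu j x) + (c1 x * V x) * u x) := by
        refine integral_congr_ae ?_
        filter_upwards [hAA', hqq'] with x h1 h2
        simp only [hcv, ← h1, ← h2, hc1, fieldDeriv, Fin.sum_univ_three, hV]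
        ring
    _ = (∑ j, ∫ x in Ω, Gu j x * pderiv j V x)
        + (-2 * Complex.I) * (∑ j, ∫ x in Ω, ((A' x j : ℂ) * V x) * Gu j x)
        + ∫ x in Ω, (c1 x * V x) * u x := by
        rw [integral_add _ i3, integral_add, integral_const_mul, integral_finsetSum _ fun j _ => i1 j,
          integral_finsetSum _ fun j _ => i2 j]
        · exact integrable_finsetSum _ fun j _ => i1 j
        · exact (integrable_finsetSum _ fun j _ => i2 j).const_mul _
        · exact (integrable_finsetSum _ fun j _ => i1 j).add
            ((integrable_finsetSum _ fun j _ => i2 j).const_mul _)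
    _ = ∫ x in Ω, ((-∑ j, u x * pderiv j (pderiv j V) x)
        + (2 * Complex.I) * (∑ j, (((pderiv j (fun y => A' y j) x : ℝ) : ℂ) * V x
        + (A' x j : ℂ) * pderiv j V x) * u x) + (c1 x * V x) * u x) := by
        simp only [t1, t2]
        rw [integral_add _ i3, integral_add, integral_const_mul, integral_neg,
          integral_finsetSum _ fun j _ => i4 j, integral_finsetSum _ fun j _ => i5 j]
        · simp only [Finset.sum_neg_distrib]
          ring
        · exact (integrable_finsetSum _ fun j _ => i4 j).neg
        · exact (integrable_finsetSum _ fun j _ => i5 j).const_mul _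
        · exact (integrable_finsetSum _ fun j _ => i4 j).neg.add
            ((integrable_finsetSum _ fun j _ => i5 j).const_mul _)
    _ = ∫ x in Ω, w x * ellOp (conjB (magB A') ζ h) (conjC (magB A') (magC A' q') ζ h)
          (fun y => phase ζ h y * V y) x := by
        refine integral_congr_ae (Eventually.of_forall fun x => ?_)
        -- The conjugation identity is applied to the test function e^{x·ζ/h}V; the opposite
        -- exponential then restores V, so `heq` tested with e^{x·ζ/h}V is the required identity.
        have hcon := ellOp_conj (magB A') (magC A' q') (h := h) hζ
          (hVt.mul_left (contDiff_phase ζ h)).1 x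
        have hVV : (fun y => phase (-ζ) h y * (phase ζ h y * V y)) = V := by
          funext y; rw [← mul_assoc, phase_neg_mul, one_mul]
        rw [hVV] at hcon
        have h5 : phase ζ h x * ellOp (magB A') (magC A' q') V x =
            ellOp (conjB (magB A') ζ h) (conjC (magB A') (magC A' q') ζ h)
              (fun y => phase ζ h y * V y) x := by
          rw [hcon, ← mul_assoc, phase_mul_neg, one_mul]
        simp only
        rw [← h5]
        simp only [ellOp, magB, magC, lap, hc1, hu, fieldDeriv, Fin.sum_univ_three]
        ring
    _ = 0 := heq _ (hVt.mul_left (contDiff_phase ζ h))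

/-! ### The Cauchy transform in planes and the Cauchy-Pompeiu formula. -/

/-- The parametrisation of the plane spanned by `α` and `β`. -/
def planeMap (α β : E3) : ℝ × ℝ →L[ℝ] E3 :=
  (ContinuousLinearMap.fst ℝ ℝ ℝ).smulRight α + (ContinuousLinearMap.snd ℝ ℝ ℝ).smulRight β

lemma planeMap_apply (α β : E3) (s : ℝ × ℝ) : planeMap α β s = s.1 • α + s.2 • β := by
  simp [planeMap]

/-- The Cauchy kernel `1 / (s₁ + i s₂)`. -/
def cauchyKernel (s : ℝ × ℝ) : ℂ := 1 / ((s.1 : ℂ) + Complex.I * (s.2 : ℂ))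

lemma cauchyOp_eq (α β : E3) (f : E3 → ℂ) (x : E3) :
    cauchyOp α β f x =
      (1 / (Real.pi : ℂ)) * shiftInt volume (planeMap α β) cauchyKernel f x := by
  simp only [cauchyOp, shiftInt, planeMap_apply, cauchyKernel, smul_eq_mul]

/-- The constant is 1 since ℝ × ℝ carries the maximum norm, which is at most the Euclidean norm that
the orthonormal parametrisation preserves. -/
lemma norm_le_norm_planeMap {α β : E3} (hα : ‖α‖ = 1) (hβ : ‖β‖ = 1) (hαβ : inner ℝ α β = 0)
    (s : ℝ × ℝ) : ‖s‖ ≤ 1 * ‖planeMap α β s‖ := by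
  rw [one_mul, planeMap_apply]
  have h : ‖s.1 • α + s.2 • β‖ ^ 2 = s.1 ^ 2 + s.2 ^ 2 := by
    rw [norm_add_sq_real, inner_smul_left, inner_smul_right, hαβ, norm_smul, norm_smul, hα, hβ]
    simp
  rw [Prod.norm_def, max_le_iff, Real.norm_eq_abs, Real.norm_eq_abs]
  constructor <;> refine abs_le_of_sq_le_sq ?_ (norm_nonneg _) <;> rw [h] <;> nlinarith [sq_nonneg s.1, sq_nonneg s.2]

lemma norm_cauchyKernel_le (s : ℝ × ℝ) : ‖cauchyKernel s‖ ≤ 1 * ‖s‖ ^ (-(1 : ℝ)) := by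
  rw [one_mul, Real.rpow_neg_one, cauchyKernel, norm_div, norm_one, one_div]
  rcases eq_or_ne s 0 with rfl | hs
  -- At the origin both sides are 0 by the convention on division by zero.
  · simp
  · refine inv_anti₀ (norm_pos_iff.2 hs) ?_
    have h1 := Complex.abs_re_le_norm ((s.1 : ℂ) + Complex.I * (s.2 : ℂ))
    have h2 := Complex.abs_im_le_norm ((s.1 : ℂ) + Complex.I * (s.2 : ℂ))
    simp at h1 h2
    exact max_le h1 h2

lemma measurable_cauchyKernel : Measurable cauchyKernel := by
  unfold cauchyKernel
  have h1 : Measurable fun s : ℝ × ℝ => (s.1 : ℂ) := Complex.measurable_ofReal.comp measurable_fst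
  have h2 : Measurable fun s : ℝ × ℝ => (s.2 : ℂ) := Complex.measurable_ofReal.comp measurable_snd
  exact measurable_const.div (h1.add (h2.const_mul _))

/-- The singularity has order 1, below the dimension 2 of the plane. -/
lemma locallyIntegrable_cauchyKernel : LocallyIntegrable cauchyKernel := by
  refine locallyIntegrable_of_norm_le_rpow (C := 1) (α := 1) ?_ ?_
    (Eventually.of_forall norm_cauchyKernel_le) measurable_cauchyKernel.aestronglyMeasurable
  · simp
  · simp

lemma integrableOn_polar_of_eq_zero {f : ℝ × ℝ → ℂ} (hf : Continuous f) {R : ℝ}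
    (hz : ∀ p : ℝ × ℝ, R < p.1 → f p = 0) :
    IntegrableOn f (Ioi 0 ×ˢ Ioo (-Real.pi) Real.pi) := by
  have h1 : IntegrableOn f (Icc 0 R ×ˢ Icc (-Real.pi) Real.pi) :=
    hf.continuousOn.integrableOn_compact (isCompact_Icc.prod isCompact_Icc)
  refine h1.of_forall_sdiff_eq_zero (measurableSet_Ioi.prod measurableSet_Ioo) ?_
  rintro p ⟨⟨hp1, hp2⟩, hp3⟩
  exact hz p (lt_of_not_ge fun hle => hp3 ⟨⟨le_of_lt hp1, hle⟩, ⟨hp2.1.le, hp2.2.le⟩⟩)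

/-- Along each ray the integral of the radial derivative is minus the value at the centre; the angle
then contributes the factor 2π. -/
lemma integral_polar_radial {G dr : ℝ → ℝ → ℂ} (hc : Continuous fun p : ℝ × ℝ => dr p.1 p.2)
    (hG : ∀ r θ, HasDerivAt (fun r => G r θ) (dr r θ) r) {R : ℝ} (hR : ∀ r θ, R < r → G r θ = 0)
    (hR' : ∀ r θ, R < r → dr r θ = 0) {c : ℂ} (h0 : ∀ θ, G 0 θ = c) :
    ∫ p in Ioi (0 : ℝ) ×ˢ Ioo (-Real.pi) Real.pi, dr p.1 p.2 = -(2 * Real.pi * c) := by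
  have hint := integrableOn_polar_of_eq_zero hc fun p hp => hR' p.1 p.2 hp
  have inner : ∀ θ, ∫ r in Ioi (0 : ℝ), dr r θ = -c := by
    intro θ
    have hz : Tendsto (fun r => G r θ) atTop (𝓝 0) := by
      refine tendsto_const_nhds.congr' ?_
      filter_upwards [eventually_gt_atTop R] with r hr
      exact (hR r θ hr).symm
    have hi : IntegrableOn (fun r => dr r θ) (Ioi 0) := by
      have hcθ : Continuous fun r => dr r θ := hc.comp (Continuous.prodMk_left θ)
      have h1 : IntegrableOn (fun r => dr r θ) (Icc 0 R) :=
        hcθ.continuousOn.integrableOn_compact isCompact_Icc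
      refine h1.of_forall_sdiff_eq_zero measurableSet_Ioi ?_
      rintro r ⟨hr1, hr2⟩
      exact hR' r θ (lt_of_not_ge fun hle => hr2 ⟨le_of_lt hr1, hle⟩)
    rw [integral_Ioi_of_hasDerivAt_of_tendsto' (fun r _ => hG r θ) hi hz, h0, zero_sub]
  have hsw : IntegrableOn (fun z : ℝ × ℝ => dr z.swap.1 z.swap.2)
      (Ioo (-Real.pi) Real.pi ×ˢ Ioi 0) (volume.prod volume) := hint.swap
  rw [Measure.volume_eq_prod, ← setIntegral_prod_swap, setIntegral_prod _ hsw]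
  simp only [Prod.swap_prod_mk, inner]
  rw [setIntegral_const, Real.volume_real_Ioo_of_le (by linarith [Real.pi_pos]), Complex.real_smul]
  push_cast
  ring

/-- Here dθ is the angular derivative divided by r. For fixed r > 0 its integral over a period
vanishes. Keeping the quotient rather than the derivative makes the integrand continuous down to r =
0. -/
lemma integral_polar_angular {G dθ : ℝ → ℝ → ℂ} (hc : Continuous fun p : ℝ × ℝ => dθ p.1 p.2)
    (hG : ∀ r θ : ℝ, HasDerivAt (fun θ => G r θ) (r * dθ r θ) θ) {R : ℝ}
    (hR' : ∀ r θ, R < r → dθ r θ = 0) (hper : ∀ r, G r Real.pi = G r (-Real.pi)) :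
    ∫ p in Ioi (0 : ℝ) ×ˢ Ioo (-Real.pi) Real.pi, dθ p.1 p.2 = 0 := by
  have hint := integrableOn_polar_of_eq_zero hc fun p hp => hR' p.1 p.2 hp
  rw [Measure.volume_eq_prod, setIntegral_prod _ hint]
  refine setIntegral_eq_zero_of_forall_eq_zero fun r hr => ?_
  have hr' : (r : ℂ) ≠ 0 := by exact_mod_cast (ne_of_gt (mem_Ioi.1 hr))
  have hcr : Continuous fun θ => (r : ℂ) * dθ r θ :=
    continuous_const.mul (hc.comp (Continuous.prodMk_right r))
  have h1 := intervalIntegral.integral_eq_sub_of_hasDerivAt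
    (fun θ _ => hG r θ) (hcr.intervalIntegrable (-Real.pi) Real.pi)
  rw [intervalIntegral.integral_of_le (by linarith [Real.pi_pos]), integral_Ioc_eq_integral_Ioo,
    integral_const_mul, hper, sub_self] at h1
  exact (mul_eq_zero.1 h1).resolve_left hr'

set_option maxHeartbeats 400000 in
/-- The Cauchy–Pompeiu formula. -/
theorem shiftInt_cauchyKernel_dbar {α β : E3} (hα : ‖α‖ = 1) (hβ : ‖β‖ = 1)
    (hαβ : inner ℝ α β = 0) {F : E3 → ℂ} (hF : ContDiff ℝ 1 F) (hFc : HasCompactSupport F)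
    (x : E3) :
    shiftInt volume (planeMap α β) cauchyKernel
      (fun y => fderiv ℝ F y α + Complex.I * fderiv ℝ F y β) x = 2 * Real.pi * F x := by
  set P : ℝ → ℝ → E3 := fun r θ => x - planeMap α β (r * Real.cos θ, r * Real.sin θ) with hP
  have hPe : ∀ r θ, P r θ = x - ((r * Real.cos θ) • α + (r * Real.sin θ) • β) := fun r θ => by
    simp only [hP, planeMap_apply]
  set dr : ℝ → ℝ → ℂ := fun r θ =>
    fderiv ℝ F (P r θ) (-(Real.cos θ • α + Real.sin θ • β)) with hdr
  set dθ : ℝ → ℝ → ℂ := fun r θ =>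
    fderiv ℝ F (P r θ) (-(-(Real.sin θ) • α + Real.cos θ • β)) with hdθ
  have hPc : Continuous fun p : ℝ × ℝ => P p.1 p.2 := by simp only [hPe]; fun_prop
  have hFd : Continuous (fderiv ℝ F) := hF.continuous_fderiv (by simp)
  have hdrc : Continuous fun p : ℝ × ℝ => dr p.1 p.2 := by
    refine (hFd.comp hPc).clm_apply ?_
    fun_prop
  have hdθc : Continuous fun p : ℝ × ℝ => dθ p.1 p.2 := by
    refine (hFd.comp hPc).clm_apply ?_
    fun_prop
  have hPr : ∀ r θ, HasDerivAt (fun r => F (P r θ)) (dr r θ) r := by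
    intro r θ
    have h1 : HasDerivAt (fun r => P r θ) (-(Real.cos θ • α + Real.sin θ • β)) r := by
      simp only [hPe]
      have a1 : HasDerivAt (fun r : ℝ => r * Real.cos θ) (Real.cos θ) r := by
        simpa using (hasDerivAt_id r).mul_const (Real.cos θ)
      have a2 : HasDerivAt (fun r : ℝ => r * Real.sin θ) (Real.sin θ) r := by
        simpa using (hasDerivAt_id r).mul_const (Real.sin θ)
      exact ((a1.smul_const α).add (a2.smul_const β)).const_sub x
    exact (hF.differentiable (by simp) _).hasFDerivAt.comp_hasDerivAt r h1
  have hPθ : ∀ r θ, HasDerivAt (fun θ => F (P r θ)) (r * dθ r θ) θ := by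
    intro r θ
    have h1 : HasDerivAt (fun θ => P r θ) (r • -(-(Real.sin θ) • α + Real.cos θ • β)) θ := by
      simp only [hPe]
      have a1 := ((Real.hasDerivAt_cos θ).const_mul r).smul_const α
      have a2 := ((Real.hasDerivAt_sin θ).const_mul r).smul_const β
      have a3 := (a1.add a2).const_sub x
      refine a3.congr_deriv ?_
      module
    have h2 := (hF.differentiable (by simp) (P r θ)).hasFDerivAt.comp_hasDerivAt θ h1
    exact h2.congr_deriv (by rw [map_smul, Complex.real_smul])
  -- Orthonormality gives ‖x - P r θ‖ = r, so the circle leaves the compact support of F once r is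
  -- large.
  obtain ⟨R, hR0, hR⟩ : ∃ R : ℝ, 0 < R ∧ ∀ r θ, R < r → P r θ ∉ tsupport F := by
    obtain ⟨R, hR⟩ := hFc.isCompact.isBounded.exists_norm_le
    refine ⟨max R 0 + ‖x‖ + 1, by positivity, fun r θ hr hmem => ?_⟩
    have h1 := hR _ hmem
    have h0 : 0 ≤ r := by
      have := le_max_right R 0; have := norm_nonneg x; linarith
    have h2 : ‖planeMap α β (r * Real.cos θ, r * Real.sin θ)‖ ^ 2 = r ^ 2 := by
      rw [planeMap_apply, norm_add_sq_real, inner_smul_left, inner_smul_right, hαβ, norm_smul,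
        norm_smul, hα, hβ]
      simp only [Real.norm_eq_abs, mul_one, sq_abs, mul_zero, add_zero]
      nlinarith [Real.sin_sq_add_cos_sq θ]
    have h3 : ‖planeMap α β (r * Real.cos θ, r * Real.sin θ)‖ = r :=
      (pow_left_inj₀ (norm_nonneg _) h0 two_ne_zero).1 h2
    have h4 : r ≤ ‖x‖ + ‖P r θ‖ := by
      have e : x - P r θ = planeMap α β (r * Real.cos θ, r * Real.sin θ) := sub_sub_cancel _ _
      calc r = ‖x - P r θ‖ := by rw [e, h3]
        _ ≤ _ := norm_sub_le _ _
    have := le_max_left R 0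
    linarith
  have hvan : ∀ r θ, R < r → fderiv ℝ F (P r θ) = 0 := fun r θ hr =>
    image_eq_zero_of_notMem_tsupport fun h => hR r θ hr (tsupport_fderiv_subset ℝ h)
  have hr0 : ∀ r θ, R < r → dr r θ = 0 := fun r θ hr => by simp only [hdr, hvan r θ hr]; rfl
  have hθ0 : ∀ r θ, R < r → dθ r θ = 0 := fun r θ hr => by simp only [hdθ, hvan r θ hr]; rfl
  have hr_int := integrableOn_polar_of_eq_zero hdrc fun p hp => hr0 p.1 p.2 hp
  have hθ_int := integrableOn_polar_of_eq_zero hdθc fun p hp => hθ0 p.1 p.2 hp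
  have I1 := integral_polar_radial hdrc hPr
    (fun r θ hr => image_eq_zero_of_notMem_tsupport (hR r θ hr)) hr0 (c := F x)
    (fun θ => by simp [hPe])
  have I2 := integral_polar_angular hdθc hPθ hθ0 (fun r => by simp [hPe])
  -- The Jacobian r removes the singularity, r/(s₁ + is₂) = e^{-iθ}, and e^{-iθ}(∂_α + i∂_β) is ∂_r
  -- + (i/r)∂_θ in polar coordinates. Both signs are reversed because F is evaluated at x minus the
  -- point of the plane.
  have key : ∀ p ∈ Ioi (0 : ℝ) ×ˢ Ioo (-Real.pi) Real.pi,
      p.1 • (cauchyKernel (polarCoord.symm p) • (fderiv ℝ F (x - planeMap α β (polarCoord.symm p)) α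
        + Complex.I * fderiv ℝ F (x - planeMap α β (polarCoord.symm p)) β))
      = -dr p.1 p.2 - Complex.I * dθ p.1 p.2 := by
    rintro ⟨r, θ⟩ ⟨hr, -⟩
    have hr' : (r : ℂ) ≠ 0 := by exact_mod_cast (ne_of_gt (mem_Ioi.1 hr))
    have hsym : polarCoord.symm (r, θ) = (r * Real.cos θ, r * Real.sin θ) := by
      rw [polarCoord_symm_apply]
    rw [hsym]
    change _ = -fderiv ℝ F (P r θ) (-(Real.cos θ • α + Real.sin θ • β))
      - Complex.I * fderiv ℝ F (P r θ) (-(-(Real.sin θ) • α + Real.cos θ • β))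
    change r • (_ • (fderiv ℝ F (P r θ) α + Complex.I * fderiv ℝ F (P r θ) β)) = _
    simp only [map_neg, map_add, map_smul, neg_smul, Complex.real_smul, cauchyKernel, smul_eq_mul]
    have hcs : (Real.cos θ : ℂ) ^ 2 + (Real.sin θ : ℂ) ^ 2 = 1 := by
      exact_mod_cast Real.cos_sq_add_sin_sq θ
    have hden : ((Real.cos θ : ℂ) + Complex.I * (Real.sin θ : ℂ)) *
        ((Real.cos θ : ℂ) - Complex.I * (Real.sin θ : ℂ)) = 1 := by
      linear_combination hcs - (Real.sin θ : ℂ) ^ 2 * Complex.I_sq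
    have hne : (Real.cos θ : ℂ) + Complex.I * (Real.sin θ : ℂ) ≠ 0 := left_ne_zero_of_mul_eq_one hden
    have hker : (r : ℂ) * (1 / (((r * Real.cos θ : ℝ) : ℂ) + Complex.I * ((r * Real.sin θ : ℝ) : ℂ)))
        = (Real.cos θ : ℂ) - Complex.I * (Real.sin θ : ℂ) := by
      have : ((r * Real.cos θ : ℝ) : ℂ) + Complex.I * ((r * Real.sin θ : ℝ) : ℂ)
          = r * ((Real.cos θ : ℂ) + Complex.I * (Real.sin θ : ℂ)) := by push_cast; ring
      rw [this, one_div, mul_inv, ← mul_assoc, mul_inv_cancel₀ hr', one_mul]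
      exact inv_eq_of_mul_eq_one_right hden
    rw [← mul_assoc, hker]
    linear_combination (-(Real.sin θ : ℂ) * fderiv ℝ F (P r θ) β) * Complex.I_sq
  have hr_neg : IntegrableOn (fun p : ℝ × ℝ => -dr p.1 p.2)
      (Ioi 0 ×ˢ Ioo (-Real.pi) Real.pi) := hr_int.neg
  rw [shiftInt, ← integral_comp_polarCoord_symm, polarCoord_target,
    setIntegral_congr_fun (measurableSet_Ioi.prod measurableSet_Ioo) key,
    integral_sub hr_neg (hθ_int.const_mul _), integral_neg, integral_const_mul, I1, I2]
  ring

/-! ### Scaling of derivatives under mollification and the Cauchy transform. -/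

section

section ComplexMollification

variable {ψ : E3 → ℝ} {ε : ℝ}

/-- The scaled mollifier as a complex valued function. -/
def cScaled (ψ : E3 → ℝ) (ε : ℝ) (x : E3) : ℂ := (scaledMollifier ψ ε x : ℂ)

/-- The mollification of a complex valued function. -/
def cMoll (ψ : E3 → ℝ) (ε : ℝ) (f : E3 → ℂ) : E3 → ℂ :=
  shiftInt volume (ContinuousLinearMap.id ℝ E3) f (cScaled ψ ε)

lemma contDiff_cScaled (hψ : IsMollifier ψ) (ε : ℝ) : ContDiff ℝ ∞ (cScaled ψ ε) := by
  have h1 : ContDiff ℝ ∞ (scaledMollifier ψ ε) :=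
    contDiff_const.mul (hψ.contDiff.comp (contDiff_const_smul _))
  exact Complex.ofRealCLM.contDiff.comp h1

lemma scaledMollifier_eq_zero {ρ : ℝ} (hρ : ∀ y, ρ < ‖y‖ → ψ y = 0) (hε : 0 < ε) {y : E3}
    (hy : ε * ρ < ‖y‖) : scaledMollifier ψ ε y = 0 := by
  rw [scaledMollifier, hρ, mul_zero]
  rw [norm_smul, Real.norm_eq_abs, abs_of_pos (inv_pos.2 hε), inv_mul_eq_div, lt_div_iff₀ hε]
  linarith

lemma tsupport_subset_closedBall {V : Type*} [NormedAddCommGroup V] {F : E3 → V} {ρ : ℝ}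
    (hF : ∀ y, ρ < ‖y‖ → F y = 0) : tsupport F ⊆ Metric.closedBall 0 ρ := by
  refine closure_minimal (fun y hy => ?_) Metric.isClosed_closedBall
  rw [mem_closedBall_zero_iff]
  exact le_of_not_gt fun h => hy (hF y h)

lemma hasCompactSupport_of_eq_zero {V : Type*} [NormedAddCommGroup V] {F : E3 → V} {ρ : ℝ}
    (hF : ∀ y, ρ < ‖y‖ → F y = 0) : HasCompactSupport F :=
  (isCompact_closedBall _ _).of_isClosed_subset (isClosed_tsupport _)
    (tsupport_subset_closedBall hF)

lemma hasCompactSupport_cScaled {ρ : ℝ} (hρ : ∀ y, ρ < ‖y‖ → ψ y = 0) (hε : 0 < ε) :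
    HasCompactSupport (cScaled ψ ε) :=
  hasCompactSupport_of_eq_zero (ρ := ε * ρ) fun y hy => by
    rw [cScaled, scaledMollifier_eq_zero hρ hε hy, Complex.ofReal_zero]

lemma norm_iteratedFDeriv_cScaled_le (hψ : IsMollifier ψ) (hε : 0 < ε) (n : ℕ) (x : E3) :
    ‖iteratedFDeriv ℝ n (cScaled ψ ε) x‖ ≤
      (ε ^ 3)⁻¹ * ((ε⁻¹) ^ n * ‖iteratedFDeriv ℝ n (fun y => (ψ y : ℂ)) (ε⁻¹ • x)‖) := by
  have hc : ContDiff ℝ ∞ (fun y => (ψ y : ℂ)) := Complex.ofRealCLM.contDiff.comp hψ.contDiff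
  have hc' : ContDiff ℝ n (fun y => (ψ y : ℂ)) := hc.of_le (by exact_mod_cast le_top)
  have e : cScaled ψ ε = fun x => (ε ^ 3)⁻¹ • (fun x => (fun y => (ψ y : ℂ)) (ε⁻¹ • x)) x := by
    funext x
    simp only [cScaled, scaledMollifier, Complex.real_smul]
    push_cast
    ring
  have hcc : ContDiffAt ℝ n (fun x => (fun y => (ψ y : ℂ)) (ε⁻¹ • x)) x :=
    (hc'.comp (contDiff_const_smul _)).contDiffAt
  rw [e, iteratedFDeriv_const_smul_apply' hcc,
    iteratedFDeriv_comp_const_smul _ hc', norm_smul, norm_smul, norm_pow, Real.norm_eq_abs,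
    Real.norm_eq_abs, abs_of_pos (inv_pos.2 hε), abs_of_pos (inv_pos.2 (pow_pos hε 3))]

/-- The prefactor ε⁻³ is cancelled by the change of variables in dimension 3, leaving one ε⁻¹ for
each derivative. -/
lemma integral_norm_iteratedFDeriv_cScaled_le (hψ : IsMollifier ψ) (hε : 0 < ε) (n : ℕ) (x : E3) :
    ∫ y, ‖iteratedFDeriv ℝ n (cScaled ψ ε) (x - y)‖ ≤
      (ε⁻¹) ^ n * ∫ y, ‖iteratedFDeriv ℝ n (fun y => (ψ y : ℂ)) y‖ := by
  have hc : ContDiff ℝ ∞ (fun y => (ψ y : ℂ)) := Complex.ofRealCLM.contDiff.comp hψ.contDiff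
  have hs : HasCompactSupport (fun y => (ψ y : ℂ)) :=
    hψ.hasCompactSupport.comp_left Complex.ofReal_zero
  have hi : Integrable (fun y => ‖iteratedFDeriv ℝ n (fun y => (ψ y : ℂ)) y‖) :=
    ((hc.continuous_iteratedFDeriv (by exact_mod_cast le_top)).integrable_of_hasCompactSupport
      (hs.iteratedFDeriv n)).norm
  rw [integral_sub_left_eq_self (fun y => ‖iteratedFDeriv ℝ n (cScaled ψ ε) y‖)]
  have hi2 : Integrable (fun y => ‖iteratedFDeriv ℝ n (fun y => (ψ y : ℂ)) (ε⁻¹ • y)‖) :=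
    hi.comp_smul (inv_ne_zero hε.ne')
  calc ∫ y, ‖iteratedFDeriv ℝ n (cScaled ψ ε) y‖
      ≤ ∫ y, (ε ^ 3)⁻¹ * ((ε⁻¹) ^ n * ‖iteratedFDeriv ℝ n (fun y => (ψ y : ℂ)) (ε⁻¹ • y)‖) := by
        refine integral_mono_of_nonneg (Eventually.of_forall fun _ => norm_nonneg _)
          ((hi2.const_mul _).const_mul _)
          (Eventually.of_forall fun y => norm_iteratedFDeriv_cScaled_le hψ hε n y)
    _ = _ := by
        rw [integral_const_mul, integral_const_mul, Measure.integral_comp_inv_smul_of_nonneg volume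
          (fun y => ‖iteratedFDeriv ℝ n (fun y => (ψ y : ℂ)) y‖) hε.le,
          finrank_euclideanSpace_fin, smul_eq_mul]
        have : (ε ^ 3)⁻¹ * ε ^ 3 = 1 := inv_mul_cancel₀ (pow_pos hε 3).ne'
        linear_combination ((ε⁻¹) ^ n * ∫ y, ‖iteratedFDeriv ℝ n (fun y => (ψ y : ℂ)) y‖) * this

lemma contDiff_cMoll (hψ : IsMollifier ψ) {ρ : ℝ} (hρ : ∀ y, ρ < ‖y‖ → ψ y = 0) (hε : 0 < ε)
    {f : E3 → ℂ} (hf : LocallyIntegrable f) : ContDiff ℝ ∞ (cMoll ψ ε f) :=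
  contDiff_shiftInt zero_le_one norm_le_one_mul_id hf (contDiff_cScaled hψ ε)
    (hasCompactSupport_cScaled hρ hε)

lemma cMoll_eq_zero {ρ : ℝ} (hρ : ∀ y, ρ < ‖y‖ → ψ y = 0) (hε : 0 < ε) {f : E3 → ℂ} {R : ℝ}
    (hf : ∀ y, R < ‖y‖ → f y = 0) {x : E3} (hx : R + ε * ρ < ‖x‖) : cMoll ψ ε f x = 0 := by
  refine integral_eq_zero_of_ae (Eventually.of_forall fun y => ?_)
  change f y • cScaled ψ ε (x - y) = 0
  by_cases hy : R < ‖y‖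
  · rw [hf y hy, zero_smul]
  · rw [cScaled, scaledMollifier_eq_zero hρ hε, Complex.ofReal_zero, smul_zero]
    have : ‖x‖ ≤ ‖x - y‖ + ‖y‖ := by simpa using norm_add_le (x - y) y
    linarith

/-- All derivatives are put on the mollifier, so only the boundedness of f is used. This allows f to
be an almost everywhere derivative of the field. -/
lemma norm_iteratedFDeriv_cMoll_le (hψ : IsMollifier ψ) {ρ : ℝ} (hρ : ∀ y, ρ < ‖y‖ → ψ y = 0)
    (hε : 0 < ε) {f : E3 → ℂ} (hf : LocallyIntegrable f) {B : ℝ} (hB : ∀ y, ‖f y‖ ≤ B) (n : ℕ)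
    (x : E3) : ‖iteratedFDeriv ℝ n (cMoll ψ ε f) x‖ ≤
      B * ((ε⁻¹) ^ n * ∫ y, ‖iteratedFDeriv ℝ n (fun y => (ψ y : ℂ)) y‖) := by
  have hB0 : 0 ≤ B := (norm_nonneg _).trans (hB 0)
  have hs := hasCompactSupport_cScaled (ψ := ψ) hρ hε
  have hi : Integrable (fun y => ‖iteratedFDeriv ℝ n (cScaled ψ ε) (x - y)‖) :=
    (((contDiff_cScaled hψ ε).continuous_iteratedFDeriv
      (by exact_mod_cast le_top)).integrable_of_hasCompactSupport
      (hs.iteratedFDeriv n)).comp_sub_left x |>.norm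
  calc _ ≤ ∫ y, ‖f y‖ * ‖iteratedFDeriv ℝ n (cScaled ψ ε) (x - y)‖ :=
        norm_iteratedFDeriv_shiftInt_le zero_le_one norm_le_one_mul_id hf (contDiff_cScaled hψ ε)
          hs n x
    _ ≤ ∫ y, B * ‖iteratedFDeriv ℝ n (cScaled ψ ε) (x - y)‖ :=
        integral_mono_of_nonneg (Eventually.of_forall fun _ => by positivity) (hi.const_mul B)
          (Eventually.of_forall fun y => mul_le_mul_of_nonneg_right (hB y) (norm_nonneg _))
    _ ≤ _ := by
        rw [integral_const_mul]
        exact mul_le_mul_of_nonneg_left (integral_norm_iteratedFDeriv_cScaled_le hψ hε n x) hB0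

/-- The Cauchy operator does not lose derivatives. -/
lemma norm_iteratedFDeriv_shiftInt_cauchyKernel_le {α β : E3} (hα : ‖α‖ = 1) (hβ : ‖β‖ = 1)
    (hαβ : inner ℝ α β = 0) {F : E3 → ℂ} (hF : ContDiff ℝ ∞ F) {R R' D : ℝ}
    (hR : ∀ y, R < ‖y‖ → F y = 0) {n : ℕ} (hD : ∀ y, ‖iteratedFDeriv ℝ n F y‖ ≤ D) {x : E3}
    (hx : ‖x‖ ≤ R') :
    ‖iteratedFDeriv ℝ n (shiftInt volume (planeMap α β) cauchyKernel F) x‖ ≤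
      (∫ s in Metric.closedBall (0 : ℝ × ℝ) (1 * (R + R')), ‖cauchyKernel s‖) * D := by
  have hℓ := norm_le_norm_planeMap hα hβ hαβ
  refine (norm_iteratedFDeriv_shiftInt_le zero_le_one hℓ locallyIntegrable_cauchyKernel hF
    (hasCompactSupport_of_eq_zero hR) n x).trans ?_
  rw [← integral_mul_const, ← integral_indicator measurableSet_closedBall]
  refine integral_mono_of_nonneg (Eventually.of_forall fun _ => by positivity)
    (integrable_shift_bound locallyIntegrable_cauchyKernel _ _)
    (Eventually.of_forall fun s => ?_)
  have := norm_smul_shift_le (k := cauchyKernel) zero_le_one hℓ hD (R := R) (fun y hy => ?_) hx s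
  · simpa only [norm_smul] using this
  · refine image_eq_zero_of_notMem_tsupport fun h => ?_
    have := tsupport_subset_closedBall hR (tsupport_iteratedFDeriv_subset n h)
    rw [mem_closedBall_zero_iff] at this
    exact absurd hy (not_lt.2 this)

/-- Bounds for the Cauchy operator applied to mollifications. -/
theorem exists_bound_cauchy_cMoll (hψ : IsMollifier ψ) {α β : E3} (hα : ‖α‖ = 1) (hβ : ‖β‖ = 1)
    (hαβ : inner ℝ α β = 0) (R R' : ℝ) (n : ℕ) :
    ∃ C, 0 ≤ C ∧ ∀ ε, 0 < ε → ε ≤ 1 → ∀ (f : E3 → ℂ) (B : ℝ), LocallyIntegrable f →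
      (∀ y, ‖f y‖ ≤ B) → (∀ y, R < ‖y‖ → f y = 0) → ∀ x, ‖x‖ ≤ R' →
      ‖iteratedFDeriv ℝ n (shiftInt volume (planeMap α β) cauchyKernel (cMoll ψ ε f)) x‖ ≤
        C * B * (ε⁻¹) ^ n := by
  obtain ⟨ρ, _, hρ0, -, hρ⟩ := exists_bound_of_hasCompactSupport hψ.contDiff.continuous
    hψ.hasCompactSupport
  -- For ε ≤ 1 the mollification is supported in a ball of radius R + ρ, so the kernel is integrated
  -- over a ball independent of ε.
  refine ⟨(∫ s in Metric.closedBall (0 : ℝ × ℝ) (1 * ((R + ρ) + R')), ‖cauchyKernel s‖) *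
    ∫ y, ‖iteratedFDeriv ℝ n (fun y => (ψ y : ℂ)) y‖, ?_, fun ε hε hε1 f B hf hB hR x hx => ?_⟩
  · exact mul_nonneg (integral_nonneg fun _ => norm_nonneg _) (integral_nonneg fun _ => norm_nonneg _)
  · have hz : ∀ y, R + ρ < ‖y‖ → cMoll ψ ε f y = 0 := fun y hy =>
      cMoll_eq_zero hρ hε hR (by nlinarith)
    refine (norm_iteratedFDeriv_shiftInt_cauchyKernel_le hα hβ hαβ (contDiff_cMoll hψ hρ hε hf) hz
      (norm_iteratedFDeriv_cMoll_le hψ hρ hε hf hB n) hx).trans (le_of_eq ?_)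
    ring

end ComplexMollification

end

/-! ### The phase correction and its transport equation. -/

section

/-- The linear map `v ↦ -i ζ₀ · v`. -/
def sourceMap (α β : E3) : E3 →L[ℝ] ℂ :=
  ∑ j, (-Complex.I * zetaZero α β j) • (Complex.ofRealCLM.comp (EuclideanSpace.proj j))

lemma sourceMap_eq_sum (α β v : E3) :
    sourceMap α β v = ∑ j, (-Complex.I * zetaZero α β j) * (v j : ℂ) := by
  simp [sourceMap]

lemma sourceMap_apply (α β v : E3) :
    sourceMap α β v = -Complex.I * cdot (zetaZero α β) (toC3 v) := by
  rw [sourceMap_eq_sum, cdot, Finset.mul_sum]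
  exact Finset.sum_congr rfl fun j _ => by simp only [toC3]; ring

variable {α β : E3} {ψ : E3 → ℝ} {A : E3 → E3} {ε : ℝ}

lemma contDiff_scaledMollifier (hψ : IsMollifier ψ) (ε : ℝ) :
    ContDiff ℝ ∞ (scaledMollifier ψ ε) :=
  contDiff_const.mul (hψ.contDiff.comp (contDiff_const_smul _))

lemma exists_mollifier_radius (hψ : IsMollifier ψ) :
    ∃ ρ : ℝ, 0 ≤ ρ ∧ ∀ y, ρ < ‖y‖ → ψ y = 0 := by
  obtain ⟨ρ, _, hρ0, -, hρ⟩ := exists_bound_of_hasCompactSupport hψ.contDiff.continuous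
    hψ.hasCompactSupport
  exact ⟨ρ, hρ0, hρ⟩

/-- A linear form commutes with convolution, which reduces the vector field to one complex function.
-/
lemma sourceMap_mollify (hψ : IsMollifier ψ) (hε : 0 < ε) (hA : Continuous A) (x : E3) :
    sourceMap α β (mollify ψ ε A x) = cMoll ψ ε (fun y => sourceMap α β (A y)) x := by
  obtain ⟨ρ, -, hρ⟩ := exists_mollifier_radius hψ
  have hs : HasCompactSupport (scaledMollifier ψ ε) :=
    hasCompactSupport_of_eq_zero (ρ := ε * ρ) fun y hy => scaledMollifier_eq_zero hρ hε hy
  rw [mollify, convolution_lsmul_swap, ← ContinuousLinearMap.integral_comp_comm]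
  · refine integral_congr_ae (Eventually.of_forall fun y => ?_)
    simp only [map_smul, cScaled, ContinuousLinearMap.id_apply, smul_eq_mul, Complex.real_smul]
    ring
  · refine Continuous.integrable_of_hasCompactSupport ?_ ?_
    · exact ((contDiff_scaledMollifier hψ ε).continuous.comp (continuous_sub_left x)).smul hA
    · exact (hs.comp_homeomorph (Homeomorph.subLeft x)).smul_right

lemma Phi_eq (hψ : IsMollifier ψ) (hε : 0 < ε) (hA : Continuous A) :
    Phi α β ψ A ε = fun x => (1 / (2 * Real.pi) : ℂ) *
      shiftInt volume (planeMap α β) cauchyKernel (cMoll ψ ε (fun y => sourceMap α β (A y))) x := by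
  funext x
  have h : (fun y => -Complex.I * cdot (zetaZero α β) (toC3 (mollify ψ ε A y))) =
      cMoll ψ ε (fun y => sourceMap α β (A y)) :=
    funext fun y => by rw [← sourceMap_apply, sourceMap_mollify hψ hε hA]
  rw [Phi, cauchyOp_eq, h, ← mul_assoc]
  congr 1
  field_simp

lemma exists_source_bound (hA : Continuous A) (hAc : HasCompactSupport A) :
    ∃ R B : ℝ, (∀ y, ‖sourceMap α β (A y)‖ ≤ B) ∧ ∀ y, R < ‖y‖ → sourceMap α β (A y) = 0 := by
  obtain ⟨R, B, -, hB, hR⟩ := exists_bound_of_hasCompactSupport hA hAc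
  refine ⟨R, ‖sourceMap α β‖ * B, fun y => ?_, fun y hy => by rw [hR y hy, map_zero]⟩
  exact ((sourceMap α β).le_opNorm _).trans
    (mul_le_mul_of_nonneg_left (hB y) (norm_nonneg _))

lemma contDiff_source_cMoll (hψ : IsMollifier ψ) (hε : 0 < ε) (hA : Continuous A) :
    ContDiff ℝ ∞ (cMoll ψ ε (fun y => sourceMap α β (A y))) := by
  obtain ⟨ρ, -, hρ⟩ := exists_mollifier_radius hψ
  exact contDiff_cMoll hψ hρ hε ((sourceMap α β).continuous.comp hA).locallyIntegrable

lemma hasCompactSupport_source_cMoll (hψ : IsMollifier ψ) (hε : 0 < ε) (hA : Continuous A)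
    (hAc : HasCompactSupport A) :
    HasCompactSupport (cMoll ψ ε (fun y => sourceMap α β (A y))) := by
  obtain ⟨ρ, -, hρ⟩ := exists_mollifier_radius hψ
  obtain ⟨R, B, -, hR⟩ := exists_source_bound (α := α) (β := β) hA hAc
  exact hasCompactSupport_of_eq_zero fun y hy => cMoll_eq_zero hρ hε hR hy

lemma contDiff_Phi (hψ : IsMollifier ψ) (hα : ‖α‖ = 1) (hβ : ‖β‖ = 1) (hαβ : inner ℝ α β = 0)
    (hε : 0 < ε) (hA : Continuous A) (hAc : HasCompactSupport A) :
    ContDiff ℝ ∞ (Phi α β ψ A ε) := by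
  rw [Phi_eq hψ hε hA]
  exact contDiff_const.mul (contDiff_shiftInt zero_le_one (norm_le_norm_planeMap hα hβ hαβ)
    locallyIntegrable_cauchyKernel (contDiff_source_cMoll hψ hε hA)
    (hasCompactSupport_source_cMoll hψ hε hA hAc))

lemma sum_zetaZero_mul_pderiv (f : E3 → ℂ) (x : E3) :
    ∑ j, zetaZero α β j * pderiv j f x = fderiv ℝ f x α + Complex.I * fderiv ℝ f x β := by
  rw [fderiv_apply_eq_sum f x α, fderiv_apply_eq_sum f x β, Finset.mul_sum,
    ← Finset.sum_add_distrib]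
  refine Finset.sum_congr rfl fun j _ => ?_
  simp only [zetaZero, toC3, PiLp.add_apply, PiLp.smul_apply, smul_eq_mul, Complex.real_smul]
  ring

/-- The `∂̄`-equation `ζ₀ · ∇Φ = -i ζ₀ · A♯`. -/
theorem transport_Phi (hψ : IsMollifier ψ) (hα : ‖α‖ = 1) (hβ : ‖β‖ = 1) (hαβ : inner ℝ α β = 0)
    (hε : 0 < ε) (hA : Continuous A) (hAc : HasCompactSupport A) (x : E3) :
    ∑ j, zetaZero α β j * pderiv j (Phi α β ψ A ε) x = sourceMap α β (mollify ψ ε A x) := by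
  set F := cMoll ψ ε (fun y => sourceMap α β (A y)) with hF
  have hF1 : ContDiff ℝ 1 F := (contDiff_source_cMoll hψ hε hA).of_le (by norm_cast)
  have hFc : HasCompactSupport F := hasCompactSupport_source_cMoll hψ hε hA hAc
  have hℓ := norm_le_norm_planeMap hα hβ hαβ
  have hi := integrable_shift zero_le_one hℓ locallyIntegrable_cauchyKernel
    (hF1.continuous_fderiv (by simp)) (hFc.fderiv ℝ) x
  have hd := hasFDerivAt_shiftInt zero_le_one hℓ locallyIntegrable_cauchyKernel hF1 hFc x
  have happ : ∀ v, fderiv ℝ (shiftInt volume (planeMap α β) cauchyKernel F) x v =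
      ∫ s, cauchyKernel s • fderiv ℝ F (x - planeMap α β s) v := fun v => by
    rw [hd.fderiv, shiftInt, ContinuousLinearMap.integral_apply hi]
    rfl
  have hiv : ∀ v, Integrable (fun s => cauchyKernel s • fderiv ℝ F (x - planeMap α β s) v) :=
    fun v => hi.apply_continuousLinearMap v
  have e1 : shiftInt volume (planeMap α β) cauchyKernel
      (fun y => fderiv ℝ F y α + Complex.I * fderiv ℝ F y β) x =
      (∫ s, cauchyKernel s • fderiv ℝ F (x - planeMap α β s) α) +
        Complex.I * ∫ s, cauchyKernel s • fderiv ℝ F (x - planeMap α β s) β := by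
    rw [← integral_const_mul, ← integral_add (hiv α) ((hiv β).const_mul _)]
    refine integral_congr_ae (Eventually.of_forall fun s => ?_)
    simp only [smul_eq_mul]
    ring
  rw [Phi_eq hψ hε hA, sourceMap_mollify hψ hε hA, ← hF]
  simp only [pderiv_const_mul hd.differentiableAt]
  have e2 := sum_zetaZero_mul_pderiv (α := α) (β := β)
    (shiftInt volume (planeMap α β) cauchyKernel F) x
  rw [happ, happ, ← e1, shiftInt_cauchyKernel_dbar hα hβ hαβ hF1 hFc] at e2
  have hpi : (Real.pi : ℂ) ≠ 0 := by exact_mod_cast Real.pi_ne_zero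
  calc _ = (1 / (2 * Real.pi) : ℂ) * ∑ j, zetaZero α β j *
        pderiv j (shiftInt volume (planeMap α β) cauchyKernel F) x := by
        rw [Finset.mul_sum]
        exact Finset.sum_congr rfl fun j _ => by ring
    _ = F x := by
        -- The factor 2π of the Cauchy-Pompeiu formula cancels the normalisation of Φ.
        rw [e2]
        field_simp

/-- The mollified source differs from the source by the mollification scale. -/
lemma norm_sub_cMoll_le (hψ : IsMollifier ψ) {ρ : ℝ} (hρ : ∀ y, ρ < ‖y‖ → ψ y = 0) (hε : 0 < ε)
    {f : E3 → ℂ} {K : NNReal} (hf : LipschitzWith K f) (x : E3) :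
    ‖cMoll ψ ε f x - f x‖ ≤ K * (ε * ρ) := by
  have hs : HasCompactSupport (cScaled ψ ε) := hasCompactSupport_cScaled hρ hε
  have hc : Continuous (cScaled ψ ε) := (contDiff_cScaled hψ ε).continuous
  have hsr : HasCompactSupport (scaledMollifier ψ ε) :=
    hasCompactSupport_of_eq_zero (ρ := ε * ρ) fun y hy => scaledMollifier_eq_zero hρ hε hy
  have hir : Integrable (fun y => scaledMollifier ψ ε (x - y)) :=
    ((contDiff_scaledMollifier hψ ε).continuous.integrable_of_hasCompactSupport hsr).comp_sub_left x
  have h1r : ∫ y, scaledMollifier ψ ε (x - y) = 1 := by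
    rw [integral_sub_left_eq_self (scaledMollifier ψ ε)]
    simp only [scaledMollifier]
    rw [integral_const_mul, Measure.integral_comp_inv_smul_of_nonneg volume ψ hε.le,
      finrank_euclideanSpace_fin, hψ.integral_eq_one, smul_eq_mul, mul_one]
    exact inv_mul_cancel₀ (pow_pos hε 3).ne'
  have hnn : ∀ y, 0 ≤ scaledMollifier ψ ε y := fun y =>
    mul_nonneg (inv_nonneg.2 (pow_pos hε 3).le) (hψ.nonneg _)
  have h1 : ∫ y, f x * cScaled ψ ε (x - y) = f x := by
    rw [integral_const_mul]
    simp only [cScaled]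
    rw [integral_complex_ofReal, h1r, Complex.ofReal_one, mul_one]
  have hi1 : Integrable (fun y => f y * cScaled ψ ε (x - y)) :=
    integrable_shift (k := f) (ℓ := ContinuousLinearMap.id ℝ E3) zero_le_one norm_le_one_mul_id
      hf.continuous.locallyIntegrable hc hs x
  have hi2 : Integrable (fun y => f x * cScaled ψ ε (x - y)) := hir.ofReal.const_mul _
  have e : cMoll ψ ε f x - f x = ∫ y, (f y * cScaled ψ ε (x - y) - f x * cScaled ψ ε (x - y)) := by
    rw [integral_sub hi1 hi2, h1]
    rfl
  rw [e]
  calc _ ≤ ∫ y, K * (ε * ρ) * scaledMollifier ψ ε (x - y) := by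
        refine norm_integral_le_of_norm_le (hir.const_mul _) (Eventually.of_forall fun y => ?_)
        rw [← sub_mul, norm_mul, cScaled, Complex.norm_real, Real.norm_eq_abs, abs_of_nonneg (hnn _)]
        by_cases hy : ε * ρ < ‖x - y‖
        · rw [scaledMollifier_eq_zero hρ hε hy, mul_zero, mul_zero]
        · refine mul_le_mul_of_nonneg_right ?_ (hnn _)
          refine (hf.norm_sub_le y x).trans (mul_le_mul_of_nonneg_left ?_ K.2)
          rw [norm_sub_rev]
          exact not_lt.1 hy
    _ = _ := by rw [integral_const_mul, h1r, mul_one]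

end

/-! ### Derivative bounds for Φ and e^Φ. -/

section

variable {α β : E3} {ψ : E3 → ℝ} {A : E3 → E3} {ε : ℝ}

lemma norm_iteratedFDeriv_pderiv_le {f : E3 → ℂ} (hf : ContDiff ℝ ∞ f) (j : Fin 3) (n : ℕ)
    (x : E3) : ‖iteratedFDeriv ℝ n (pderiv j f) x‖ ≤ ‖iteratedFDeriv ℝ (n + 1) f x‖ := by
  set L : (E3 →L[ℝ] ℂ) →L[ℝ] ℂ := ContinuousLinearMap.apply ℝ ℂ (basisVec j) with hL
  have hL1 : ‖L‖ ≤ 1 := by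
    refine ContinuousLinearMap.opNorm_le_bound _ zero_le_one fun T => ?_
    have := T.le_opNorm (basisVec j)
    rw [norm_basisVec, mul_one] at this
    rwa [one_mul]
  have hd : ContDiff ℝ ∞ (fderiv ℝ f) := hf.fderiv_right (by simp)
  have h := L.norm_iteratedFDeriv_comp_left (f := fderiv ℝ f) (x := x) (n := n) hd.contDiffAt
    (by exact_mod_cast le_top)
  rw [norm_iteratedFDeriv_fderiv] at h
  exact h.trans (mul_le_of_le_one_left (norm_nonneg _) hL1)

lemma contDiff_pderiv_iterate {f : E3 → ℂ} (hf : ContDiff ℝ ∞ f) (j : Fin 3) (k : ℕ) :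
    ContDiff ℝ ∞ ((pderiv j)^[k] f) := by
  induction k with
  | zero => exact hf
  | succ k ih =>
    rw [Function.iterate_succ_apply']
    exact ih.pderiv j

lemma norm_iteratedFDeriv_pderiv_iterate_le {f : E3 → ℂ} (hf : ContDiff ℝ ∞ f) (j : Fin 3)
    (k n : ℕ) (x : E3) :
    ‖iteratedFDeriv ℝ n ((pderiv j)^[k] f) x‖ ≤ ‖iteratedFDeriv ℝ (n + k) f x‖ := by
  induction k generalizing n with
  | zero => exact le_rfl
  | succ k ih =>
    rw [Function.iterate_succ_apply']
    refine (norm_iteratedFDeriv_pderiv_le (contDiff_pderiv_iterate hf j k) j n x).trans ?_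
    refine (ih (n + 1)).trans (le_of_eq ?_)
    rw [show n + 1 + k = n + (k + 1) by ring]

lemma norm_multiDeriv_le {f : E3 → ℂ} (hf : ContDiff ℝ ∞ f) (κ : Fin 3 → ℕ) (x : E3) :
    ‖multiDeriv κ f x‖ ≤ ‖iteratedFDeriv ℝ (∑ j, κ j) f x‖ := by
  rw [← norm_iteratedFDeriv_zero (𝕜 := ℝ), multiDeriv]
  have h2 := contDiff_pderiv_iterate hf 2 (κ 2)
  have h1 := contDiff_pderiv_iterate h2 1 (κ 1)
  refine (norm_iteratedFDeriv_pderiv_iterate_le h1 0 _ _ x).trans ?_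
  refine (norm_iteratedFDeriv_pderiv_iterate_le h2 1 _ _ x).trans ?_
  refine (norm_iteratedFDeriv_pderiv_iterate_le hf 2 _ _ x).trans (le_of_eq ?_)
  rw [Fin.sum_univ_three, zero_add]

lemma exists_bound_Phi (hψ : IsMollifier ψ) (hα : ‖α‖ = 1) (hβ : ‖β‖ = 1)
    (hαβ : inner ℝ α β = 0) (hA : Continuous A) (hAc : HasCompactSupport A) (R' : ℝ) (n : ℕ) :
    ∃ C, 0 ≤ C ∧ ∀ ε, 0 < ε → ε ≤ 1 → ∀ x, ‖x‖ ≤ R' →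
      ‖iteratedFDeriv ℝ n (Phi α β ψ A ε) x‖ ≤ C * (ε⁻¹) ^ n := by
  obtain ⟨R, B, hB, hR⟩ := exists_source_bound (α := α) (β := β) hA hAc
  obtain ⟨C, hC, h⟩ := exists_bound_cauchy_cMoll hψ hα hβ hαβ R R' n
  have hB0 : 0 ≤ B := (norm_nonneg _).trans (hB 0)
  refine ⟨‖(1 / (2 * Real.pi) : ℂ)‖ * (C * B), by positivity, fun ε hε hε1 x hx => ?_⟩
  have hs : ContDiff ℝ ∞ (shiftInt volume (planeMap α β) cauchyKernel
      (cMoll ψ ε (fun y => sourceMap α β (A y)))) :=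
    contDiff_shiftInt zero_le_one (norm_le_norm_planeMap hα hβ hαβ)
    locallyIntegrable_cauchyKernel (contDiff_source_cMoll hψ hε hA)
    (hasCompactSupport_source_cMoll hψ hε hA hAc)
  have hs' : ContDiffAt ℝ n (shiftInt volume (planeMap α β) cauchyKernel
      (cMoll ψ ε (fun y => sourceMap α β (A y)))) x :=
    (hs.of_le (by exact_mod_cast le_top)).contDiffAt
  rw [Phi_eq hψ hε hA]
  simp only [← smul_eq_mul (a := (1 / (2 * Real.pi) : ℂ))]
  rw [iteratedFDeriv_const_smul_apply' hs', norm_smul, mul_assoc]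
  exact mul_le_mul_of_nonneg_left (h ε hε hε1 _ B
    ((sourceMap α β).continuous.comp hA).locallyIntegrable hB hR x hx) (norm_nonneg _)

lemma integral_ofReal_mul_pderiv_cScaled (hψ : IsMollifier ψ) (hε : 0 < ε) {g : E3 → ℝ}
    {K : NNReal} (hg : LipschitzWith K g) (j : Fin 3) (x : E3) :
    ∫ y, (g y : ℂ) * pderiv j (cScaled ψ ε) (x - y) =
      ∫ y, ((pderiv j g y : ℝ) : ℂ) * cScaled ψ ε (x - y) := by
  obtain ⟨ρ, -, hρ⟩ := exists_mollifier_radius hψ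
  have hs : HasCompactSupport (scaledMollifier ψ ε) :=
    hasCompactSupport_of_eq_zero (ρ := ε * ρ) fun y hy => scaledMollifier_eq_zero hρ hε hy
  have hc := contDiff_scaledMollifier hψ ε
  have hd : Differentiable ℝ (scaledMollifier ψ ε) := hc.differentiable (by simp)
  obtain ⟨L, hL⟩ := hc.lipschitzWith_of_hasCompactSupport hs (by simp)
  have hL' : LipschitzWith L (fun t => scaledMollifier ψ ε (x - t)) := by
    have := hL.comp ((IsometryEquiv.subLeft x).isometry.lipschitz)
    rwa [mul_one] at this
  have hcs : HasCompactSupport (fun t => scaledMollifier ψ ε (x - t)) :=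
    hs.comp_homeomorph (Homeomorph.subLeft x)
  have key := integral_pderiv_mul_of_lipschitz hg hL' hcs j
  have e1 : ∀ y, (g y : ℂ) * pderiv j (cScaled ψ ε) (x - y) =
      ((-(g y * pderiv j (fun t => scaledMollifier ψ ε (x - t)) y) : ℝ) : ℂ) := fun y => by
    rw [pderiv_comp_sub_left hd, show cScaled ψ ε = fun y => (scaledMollifier ψ ε y : ℂ) from rfl,
      pderiv_ofReal (hd _)]
    push_cast
    ring
  have e2 : ∀ y, ((pderiv j g y : ℝ) : ℂ) * cScaled ψ ε (x - y) =
      ((pderiv j g y * scaledMollifier ψ ε (x - y) : ℝ) : ℂ) := fun y => by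
    rw [cScaled]
    push_cast
    ring
  simp only [e1, e2]
  rw [integral_complex_ofReal, integral_complex_ofReal, key, integral_neg]

/-- The almost everywhere defined derivative of the source. -/
def sourceDeriv (α β : E3) (A : E3 → E3) (j : Fin 3) (y : E3) : ℂ :=
  ∑ l, (-Complex.I * zetaZero α β l) * ((pderiv j (fun z => A z l) y : ℝ) : ℂ)

lemma norm_sourceDeriv_le {K : NNReal} (hA : LipschitzWith K A) (j : Fin 3) (y : E3) :
    ‖sourceDeriv α β A j y‖ ≤ ∑ l, ‖-Complex.I * zetaZero α β l‖ * K := by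
  refine (norm_sum_le _ _).trans (Finset.sum_le_sum fun l _ => ?_)
  rw [norm_mul, Complex.norm_real]
  exact mul_le_mul_of_nonneg_left (abs_pderiv_le_of_lipschitz (lipschitzWith_coord hA l) j y)
    (norm_nonneg _)

lemma measurable_sourceDeriv (j : Fin 3) : Measurable (sourceDeriv α β A j) :=
  Finset.measurable_sum _ fun _ _ =>
    (Complex.measurable_ofReal.comp (measurable_pderiv _ j)).const_mul _

lemma locallyIntegrable_of_bounded {f : E3 → ℂ} (hf : Measurable f) {B : ℝ} (hB : ∀ y, ‖f y‖ ≤ B) :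
    LocallyIntegrable f :=
  (locallyIntegrable_const B).mono hf.aestronglyMeasurable
    (Eventually.of_forall fun y => (hB y).trans (le_abs_self B))

/-- One derivative passes from the mollifier to the Lipschitz field, where it is bounded almost
everywhere. This saves one power of ε⁻¹ compared with differentiating the mollifier. -/
lemma pderiv_source_cMoll (hψ : IsMollifier ψ) (hε : 0 < ε) {K : NNReal} (hA : LipschitzWith K A)
    (j : Fin 3) : pderiv j (cMoll ψ ε (fun y => sourceMap α β (A y))) =
      cMoll ψ ε (sourceDeriv α β A j) := by
  funext x
  obtain ⟨ρ, -, hρ⟩ := exists_mollifier_radius hψ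
  have hc := contDiff_cScaled hψ ε
  have hs := hasCompactSupport_cScaled (ψ := ψ) hρ hε
  have hli : LocallyIntegrable (fun y => sourceMap α β (A y)) :=
    ((sourceMap α β).continuous.comp hA.continuous).locallyIntegrable
  rw [cMoll, pderiv_shiftInt zero_le_one norm_le_one_mul_id hli (hc.of_le (by norm_cast)) hs]
  simp only [shiftInt, cMoll, sourceMap_eq_sum, sourceDeriv, smul_eq_mul, Finset.sum_mul,
    ContinuousLinearMap.id_apply]
  have i1 : ∀ l, Integrable (fun y => -Complex.I * zetaZero α β l * ((A y l : ℝ) : ℂ) *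
      pderiv j (cScaled ψ ε) (x - y)) := fun l => by
    refine integrable_shift (k := fun y => -Complex.I * zetaZero α β l * ((A y l : ℝ) : ℂ))
      (ℓ := ContinuousLinearMap.id ℝ E3) zero_le_one norm_le_one_mul_id
      ?_ (hc.pderiv j).continuous (hs.pderiv j) x
    exact (continuous_const.mul
      (Complex.continuous_ofReal.comp (lipschitzWith_coord hA l).continuous)).locallyIntegrable
  have i2 : ∀ l, Integrable (fun y => -Complex.I * zetaZero α β l *
      ((pderiv j (fun z => A z l) y : ℝ) : ℂ) * cScaled ψ ε (x - y)) := fun l => by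
    refine integrable_shift (k := fun y => -Complex.I * zetaZero α β l *
        ((pderiv j (fun z => A z l) y : ℝ) : ℂ))
      (ℓ := ContinuousLinearMap.id ℝ E3) zero_le_one norm_le_one_mul_id
      ?_ hc.continuous hs x
    refine locallyIntegrable_of_bounded (B := ‖-Complex.I * zetaZero α β l‖ * K)
      ((Complex.measurable_ofReal.comp (measurable_pderiv _ j)).const_mul _) fun y => ?_
    rw [norm_mul, Complex.norm_real]
    exact mul_le_mul_of_nonneg_left (abs_pderiv_le_of_lipschitz (lipschitzWith_coord hA l) j y)
      (norm_nonneg _)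
  rw [integral_finsetSum _ fun l _ => i1 l, integral_finsetSum _ fun l _ => i2 l]
  refine Finset.sum_congr rfl fun l _ => ?_
  simp only [mul_assoc (-Complex.I * zetaZero α β l)]
  rw [integral_const_mul, integral_const_mul,
    integral_ofReal_mul_pderiv_cScaled hψ hε (lipschitzWith_coord hA l)]

lemma pderiv_Phi (hψ : IsMollifier ψ) (hα : ‖α‖ = 1) (hβ : ‖β‖ = 1) (hαβ : inner ℝ α β = 0)
    (hε : 0 < ε) {K : NNReal} (hA : LipschitzWith K A) (hAc : HasCompactSupport A) (j : Fin 3) :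
    pderiv j (Phi α β ψ A ε) = fun x => (1 / (2 * Real.pi) : ℂ) *
      shiftInt volume (planeMap α β) cauchyKernel (cMoll ψ ε (sourceDeriv α β A j)) x := by
  funext x
  have hℓ := norm_le_norm_planeMap hα hβ hαβ
  have hF1 : ContDiff ℝ 1 (cMoll ψ ε (fun y => sourceMap α β (A y))) :=
    (contDiff_source_cMoll hψ hε hA.continuous).of_le (by norm_cast)
  have hFc := hasCompactSupport_source_cMoll (α := α) (β := β) hψ hε hA.continuous hAc
  rw [Phi_eq hψ hε hA.continuous, pderiv_const_mul (hasFDerivAt_shiftInt zero_le_one hℓ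
    locallyIntegrable_cauchyKernel hF1 hFc x).differentiableAt, pderiv_shiftInt zero_le_one hℓ
    locallyIntegrable_cauchyKernel hF1 hFc, pderiv_source_cMoll hψ hε hA]

lemma sourceDeriv_eq_zero {R : ℝ} (hR : ∀ y, R < ‖y‖ → A y = 0) (j : Fin 3) {y : E3}
    (hy : R < ‖y‖) : sourceDeriv α β A j y = 0 := by
  refine Finset.sum_eq_zero fun l _ => ?_
  have h0 : pderiv j (fun z => A z l) y = 0 := by
    refine image_eq_zero_of_notMem_tsupport fun h => ?_
    have := tsupport_subset_closedBall (F := fun z => A z l) (ρ := R)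
      (fun z hz => by rw [hR z hz]; rfl) (tsupport_pderiv_subset _ j h)
    rw [mem_closedBall_zero_iff] at this
    exact absurd hy (not_lt.2 this)
  rw [h0, Complex.ofReal_zero, mul_zero]

/-- The general bound applied to the differentiated source: derivatives of order n + 1 of Φ cost
only ε⁻ⁿ. -/
lemma exists_bound_pderiv_Phi (hψ : IsMollifier ψ) (hα : ‖α‖ = 1) (hβ : ‖β‖ = 1)
    (hαβ : inner ℝ α β = 0) {K : NNReal} (hA : LipschitzWith K A) (hAc : HasCompactSupport A)
    (R' : ℝ) (n : ℕ) :
    ∃ C, 0 ≤ C ∧ ∀ ε, 0 < ε → ε ≤ 1 → ∀ j x, ‖x‖ ≤ R' →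
      ‖iteratedFDeriv ℝ n (pderiv j (Phi α β ψ A ε)) x‖ ≤ C * (ε⁻¹) ^ n := by
  obtain ⟨R, _, -, -, hR⟩ := exists_bound_of_hasCompactSupport hA.continuous hAc
  obtain ⟨C, hC, h⟩ := exists_bound_cauchy_cMoll hψ hα hβ hαβ R R' n
  obtain ⟨ρ, -, hρ⟩ := exists_mollifier_radius hψ
  set B : ℝ := ∑ l, ‖-Complex.I * zetaZero α β l‖ * K with hB
  have hB0 : 0 ≤ B := Finset.sum_nonneg fun _ _ => by positivity
  refine ⟨‖(1 / (2 * Real.pi) : ℂ)‖ * (C * B), by positivity, fun ε hε hε1 j x hx => ?_⟩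
  have hli := locallyIntegrable_of_bounded (measurable_sourceDeriv (α := α) (β := β) (A := A) j)
    (norm_sourceDeriv_le hA j)
  have hz : ∀ y, R < ‖y‖ → sourceDeriv α β A j y = 0 := fun y hy => sourceDeriv_eq_zero hR j hy
  have hs : ContDiff ℝ ∞ (shiftInt volume (planeMap α β) cauchyKernel
      (cMoll ψ ε (sourceDeriv α β A j))) :=
    contDiff_shiftInt zero_le_one (norm_le_norm_planeMap hα hβ hαβ)
    locallyIntegrable_cauchyKernel (contDiff_cMoll hψ hρ hε hli)
    (hasCompactSupport_of_eq_zero fun y hy => cMoll_eq_zero hρ hε hz hy)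
  have hs' : ContDiffAt ℝ n (shiftInt volume (planeMap α β) cauchyKernel
      (cMoll ψ ε (sourceDeriv α β A j))) x :=
    (hs.of_le (by exact_mod_cast le_top)).contDiffAt
  rw [pderiv_Phi hψ hα hβ hαβ hε hA hAc]
  simp only [← smul_eq_mul (a := (1 / (2 * Real.pi) : ℂ))]
  rw [iteratedFDeriv_const_smul_apply' hs', norm_smul, mul_assoc]
  exact mul_le_mul_of_nonneg_left (h ε hε hε1 _ B hli (norm_sourceDeriv_le hA j) hz x hx)
    (norm_nonneg _)

/-- Derivatives of `exp ∘ Φ` when the derivatives of `Φ` scale like powers of `ε⁻¹`. -/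
lemma exists_bound_iteratedFDeriv_cexp_comp (C : ℕ → ℝ) (hC : ∀ n, 0 ≤ C n) (n : ℕ) :
    ∃ D, ∀ ε : ℝ, 0 < ε → ∀ (f : E3 → ℂ) (x : E3), ContDiff ℝ ∞ f →
      (∀ m ≤ n, ‖iteratedFDeriv ℝ m f x‖ ≤ C m * (ε⁻¹) ^ m) →
      ‖iteratedFDeriv ℝ n (fun y => Complex.exp (f y)) x‖ ≤ D * (ε⁻¹) ^ n := by
  have hexp : ContDiff ℝ ∞ Complex.exp := Complex.contDiff_exp
  have hb : ∀ i : ℕ, ∃ b, ∀ z ∈ Metric.closedBall (0 : ℂ) (C 0),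
      ‖iteratedFDeriv ℝ i Complex.exp z‖ ≤ b := fun i =>
    (isCompact_closedBall _ _).exists_bound_of_continuousOn
      (hexp.continuous_iteratedFDeriv (by exact_mod_cast le_top)).continuousOn
  choose b hb using hb
  set b' : ℝ := ∑ i ∈ Finset.range (n + 1), |b i| with hb'
  -- The summand 1 ensures c' ≥ 1, hence C i ≤ c' ≤ c'^i for i ≥ 1, the form of bound required for
  -- compositions.
  set c' : ℝ := 1 + ∑ i ∈ Finset.range (n + 1), C i with hc'
  have hc1 : 1 ≤ c' := le_add_of_nonneg_right (Finset.sum_nonneg fun i _ => hC i)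
  refine ⟨n.factorial * b' * c' ^ n, fun ε hε f x hf h => ?_⟩
  have hfx : f x ∈ Metric.closedBall (0 : ℂ) (C 0) := by
    simpa using h 0 (Nat.zero_le _)
  have key := norm_iteratedFDeriv_comp_le (n := n) (C := b') (D := c' * ε⁻¹) hexp hf
    (by exact_mod_cast le_top) x (fun i hi => ?_) (fun i hi1 hi => ?_)
  · refine key.trans (le_of_eq ?_)
    rw [mul_pow]
    ring
  · refine (hb i _ hfx).trans ((le_abs_self _).trans ?_)
    exact Finset.single_le_sum (f := fun i => |b i|) (fun _ _ => abs_nonneg _)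
      (Finset.mem_range.2 (Nat.lt_succ_of_le hi))
  · refine (h i hi).trans ?_
    rw [mul_pow]
    refine mul_le_mul_of_nonneg_right ?_ (by positivity)
    have h1 : C i ≤ c' := by
      have := Finset.single_le_sum (f := C) (fun i _ => hC i)
        (Finset.mem_range.2 (Nat.lt_succ_of_le hi))
      linarith
    exact h1.trans (le_self_pow₀ hc1 (by omega))

end

section

variable {α β : E3} {ψ : E3 → ℝ} {A : E3 → E3} {ε : ℝ}

lemma contDiff_exp_Phi (hψ : IsMollifier ψ) (hα : ‖α‖ = 1) (hβ : ‖β‖ = 1) (hαβ : inner ℝ α β = 0)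
    (hε : 0 < ε) (hA : Continuous A) (hAc : HasCompactSupport A) :
    ContDiff ℝ ∞ (fun x => Complex.exp (Phi α β ψ A ε x)) :=
  (contDiff_Phi hψ hα hβ hαβ hε hA hAc).cexp

lemma pderiv_exp_Phi (hψ : IsMollifier ψ) (hα : ‖α‖ = 1) (hβ : ‖β‖ = 1) (hαβ : inner ℝ α β = 0)
    (hε : 0 < ε) (hA : Continuous A) (hAc : HasCompactSupport A) (j : Fin 3) (x : E3) :
    pderiv j (fun x => Complex.exp (Phi α β ψ A ε x)) x =
      Complex.exp (Phi α β ψ A ε x) * pderiv j (Phi α β ψ A ε) x :=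
  pderiv_cexp ((contDiff_Phi hψ hα hβ hαβ hε hA hAc).differentiable (by simp) x) j

lemma transport_exp_Phi (hψ : IsMollifier ψ) (hα : ‖α‖ = 1) (hβ : ‖β‖ = 1)
    (hαβ : inner ℝ α β = 0) (hε : 0 < ε) (hA : Continuous A) (hAc : HasCompactSupport A) (x : E3) :
    ∑ j, zetaZero α β j * pderiv j (fun x => Complex.exp (Phi α β ψ A ε x)) x =
      sourceMap α β (mollify ψ ε A x) * Complex.exp (Phi α β ψ A ε x) := by
  simp only [pderiv_exp_Phi hψ hα hβ hαβ hε hA hAc]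
  rw [← transport_Phi hψ hα hβ hαβ hε hA hAc, Finset.sum_mul]
  exact Finset.sum_congr rfl fun j _ => by ring

lemma exists_bound_multiDeriv_exp_Phi (hψ : IsMollifier ψ) (hα : ‖α‖ = 1) (hβ : ‖β‖ = 1)
    (hαβ : inner ℝ α β = 0) (hA : Continuous A) (hAc : HasCompactSupport A) (R' : ℝ)
    (κ : Fin 3 → ℕ) :
    ∃ D, ∀ ε, 0 < ε → ε ≤ 1 → ∀ x, ‖x‖ ≤ R' →
      ‖multiDeriv κ (fun x => Complex.exp (Phi α β ψ A ε x)) x‖ ≤ D * (ε⁻¹) ^ (∑ j, κ j) := by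
  choose C hC h using exists_bound_Phi hψ hα hβ hαβ hA hAc R'
  obtain ⟨D, hD⟩ := exists_bound_iteratedFDeriv_cexp_comp C hC (∑ j, κ j)
  refine ⟨D, fun ε hε hε1 x hx => ?_⟩
  exact (norm_multiDeriv_le (contDiff_exp_Phi hψ hα hβ hαβ hε hA hAc) κ x).trans
    (hD ε hε _ x (contDiff_Phi hψ hα hβ hαβ hε hA hAc) fun m _ => h m ε hε hε1 x hx)

/-- The improved bounds for the first two derivatives of the amplitude of a Lipschitz field. -/
theorem exists_bound_exp_Phi (hψ : IsMollifier ψ) (hα : ‖α‖ = 1) (hβ : ‖β‖ = 1)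
    (hαβ : inner ℝ α β = 0) {K : NNReal} (hA : LipschitzWith K A) (hAc : HasCompactSupport A)
    (R' : ℝ) :
    ∃ C, 0 ≤ C ∧ ∀ ε, 0 < ε → ε ≤ 1 → ∀ x, ‖x‖ ≤ R' →
      ‖Complex.exp (Phi α β ψ A ε x)‖ ≤ C ∧
      (∀ j, ‖pderiv j (fun x => Complex.exp (Phi α β ψ A ε x)) x‖ ≤ C) ∧
      ∀ j, ‖pderiv j (pderiv j (fun x => Complex.exp (Phi α β ψ A ε x))) x‖ ≤ C * ε⁻¹ := by
  have hAcont := hA.continuous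
  obtain ⟨C0, hC0, h0⟩ := exists_bound_Phi hψ hα hβ hαβ hAcont hAc R' 0
  obtain ⟨C1, hC1, h1⟩ := exists_bound_pderiv_Phi hψ hα hβ hαβ hA hAc R' 0
  obtain ⟨C2, hC2, h2⟩ := exists_bound_pderiv_Phi hψ hα hβ hαβ hA hAc R' 1
  have hE := (Real.exp_pos C0).le
  refine ⟨Real.exp C0 * (1 + C1 + C1 ^ 2 + C2), by positivity, fun ε hε hε1 x hx => ?_⟩
  have hΦ := contDiff_Phi hψ hα hβ hαβ hε hAcont hAc
  have hinv : 1 ≤ ε⁻¹ := (one_le_inv₀ hε).2 hε1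
  have b0 : ‖Complex.exp (Phi α β ψ A ε x)‖ ≤ Real.exp C0 := by
    rw [Complex.norm_exp]
    have := h0 ε hε hε1 x hx
    simp only [norm_iteratedFDeriv_zero, pow_zero, mul_one] at this
    exact Real.exp_le_exp.2 ((Complex.re_le_norm _).trans this)
  have b1 : ∀ j, ‖pderiv j (Phi α β ψ A ε) x‖ ≤ C1 := fun j => by
    simpa only [norm_iteratedFDeriv_zero, pow_zero, mul_one] using h1 ε hε hε1 j x hx
  have b2 : ∀ j, ‖pderiv j (pderiv j (Phi α β ψ A ε)) x‖ ≤ C2 * ε⁻¹ := fun j => by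
    have := h2 ε hε hε1 j x hx
    rw [norm_iteratedFDeriv_one, pow_one] at this
    exact (norm_pderiv_le j _ x).trans this
  have e2 : ∀ j, pderiv j (pderiv j (fun x => Complex.exp (Phi α β ψ A ε x))) x =
      Complex.exp (Phi α β ψ A ε x) *
        (pderiv j (Phi α β ψ A ε) x ^ 2 + pderiv j (pderiv j (Phi α β ψ A ε)) x) := fun j => by
    have : pderiv j (fun x => Complex.exp (Phi α β ψ A ε x)) = fun x =>
        Complex.exp (Phi α β ψ A ε x) * pderiv j (Phi α β ψ A ε) x :=
      funext fun x => pderiv_exp_Phi hψ hα hβ hαβ hε hAcont hAc j x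
    rw [this, pderiv_mul (hΦ.cexp.differentiable (by simp) x)
      ((hΦ.pderiv j).differentiable (by simp) x), pderiv_exp_Phi hψ hα hβ hαβ hε hAcont hAc]
    ring
  refine ⟨b0.trans ?_, fun j => ?_, fun j => ?_⟩
  · nlinarith [sq_nonneg C1]
  · rw [pderiv_exp_Phi hψ hα hβ hαβ hε hAcont hAc, norm_mul]
    exact mul_le_mul b0 ((b1 j).trans (by nlinarith [sq_nonneg C1])) (norm_nonneg _) hE
  · rw [e2, norm_mul, mul_assoc]
    refine mul_le_mul b0 ((norm_add_le _ _).trans ?_) (norm_nonneg _) hE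
    rw [norm_pow]
    have := pow_le_pow_left₀ (norm_nonneg _) (b1 j) 2
    have := b2 j
    nlinarith [sq_nonneg C1, mul_nonneg hC1 (by positivity : 0 ≤ ε⁻¹)]

/-- The amplitude solves the transport equation of the field itself up to `O(ε)`. -/
lemma exists_transport_error (hψ : IsMollifier ψ) {K : NNReal} (hA : LipschitzWith K A) :
    ∃ C, 0 ≤ C ∧ ∀ ε, 0 < ε → ∀ x,
      ‖sourceMap α β (mollify ψ ε A x) - sourceMap α β (A x)‖ ≤ C * ε := by
  obtain ⟨ρ, hρ0, hρ⟩ := exists_mollifier_radius hψ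
  refine ⟨‖sourceMap α β‖ * K * ρ, by positivity, fun ε hε x => ?_⟩
  rw [sourceMap_mollify hψ hε hA.continuous]
  refine (norm_sub_cMoll_le hψ hρ hε ((sourceMap α β).lipschitz.comp hA) x).trans (le_of_eq ?_)
  push_cast
  ring

end

/-! ### The residual of the amplitude in the conjugated equation. -/

/-- The conjugated magnetic Schrödinger operator, transpose of
`ellOp (conjB (magB A) ζ h) (conjC (magB A) (magC A q) ζ h)`. -/
def conjOp (A : E3 → E3) (q : E3 → ℂ) (ζ : C3) (h : ℝ) (a : E3 → ℂ) (x : E3) : ℂ :=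
  -lap a x - ∑ j, conjB (magB A) ζ h j x * pderiv j a x +
    (conjC (magB A) (magC A q) ζ h x - 2 * Complex.I * ∑ j, (fieldDeriv A j x j : ℂ)) * a x

lemma integral_ofReal_lipschitz_mul_pderiv {g : E3 → ℝ} {K : NNReal} (hg : LipschitzWith K g)
    {χ : E3 → ℂ} (hχ : IsTestFunction univ χ) (j : Fin 3) :
    ∫ x, (g x : ℂ) * pderiv j χ x = -∫ x, ((pderiv j g x : ℝ) : ℂ) * χ x := by
  have hw : HasWeakPartial univ j (fun x => (g x : ℂ)) (fun x => ((pderiv j g x : ℝ) : ℂ)) := by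
    refine HasWeakPartial.of_integral_eq (U := univ) (subset_univ _)
      (Complex.continuous_ofReal.comp hg.continuous).locallyIntegrable
      (locallyIntegrable_of_bounded (Complex.measurable_ofReal.comp (measurable_pderiv g j))
        (B := K) fun y => ?_) fun φ hφ => ?_
    · rw [Complex.norm_real]
      exact abs_pderiv_le_of_lipschitz hg j y
    · obtain ⟨L, hL⟩ := hφ.lipschitz
      simp only [← Complex.ofReal_mul]
      rw [integral_complex_ofReal, integral_complex_ofReal,
        integral_pderiv_mul_of_lipschitz hg hL hφ.2.1]
      push_cast
      ring
  have := hw.integral_complex hχ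
  simp only [Measure.restrict_univ] at this
  simpa only [mul_comm] using this

/-- Transposition of the conjugated operator. -/
theorem integral_mul_ellOp_eq {A : E3 → E3} {q : E3 → ℂ} {K : NNReal} (hA : LipschitzWith K A)
    {Ω : Set E3} {a φ : E3 → ℂ} (ha : ContDiff ℝ ∞ a) (hφ : IsTestFunction Ω φ) (ζ : C3) (h : ℝ)
    (hi : Integrable (fun x => conjOp A q ζ h a x * φ x)) :
    ∫ x, a x * ellOp (conjB (magB A) ζ h) (conjC (magB A) (magC A q) ζ h) φ x =
      ∫ x, conjOp A q ζ h a x * φ x := by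
  have had : Differentiable ℝ a := ha.differentiable (by simp)
  have hχ : IsTestFunction univ (fun x => a x * φ x) :=
    (hφ.mul_left ha).mono (subset_univ _)
  have hφd : ∀ j, IsTestFunction Ω (pderiv j φ) := fun j => hφ.pderiv j
  have hφdd : ∀ j, IsTestFunction Ω (pderiv j (pderiv j φ)) := fun j => (hφd j).pderiv j
  have hadd : ∀ j, ContDiff ℝ ∞ (pderiv j (pderiv j a)) := fun j => (ha.pderiv j).pderiv j
  have one : ∀ {f : E3 → ℂ}, ContDiff ℝ ∞ f → ContDiff ℝ 1 f := fun hf => hf.of_le (by norm_cast)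
  have z1 : ∀ j, ∫ x, a x * pderiv j (pderiv j φ) x = ∫ x, pderiv j (pderiv j a) x * φ x :=
    fun j => by
      rw [integral_mul_pderiv (one ha) (one (hφd j).1) (hφd j).2.1,
        integral_mul_pderiv (one (ha.pderiv j)) (one hφ.1) hφ.2.1, neg_neg]
  have i1 : ∀ j, Integrable (fun x => a x * pderiv j (pderiv j φ) x) := fun j =>
    ((hφdd j).mul_left ha).integrable
  have i2 : ∀ j, Integrable (fun x => pderiv j (pderiv j a) x * φ x) := fun j =>
    (hφ.mul_left (hadd j)).integrable
  have i3 : ∀ j, Integrable (fun x => (A x j : ℂ) * pderiv j (fun x => a x * φ x) x) := fun j =>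
    ((Complex.continuous_ofReal.comp (lipschitzWith_coord hA j).continuous).mul
      (hχ.pderiv j).continuous).integrable_of_hasCompactSupport (hχ.pderiv j).2.1.mul_left
  have i4 : ∀ j, Integrable (fun x => ((pderiv j (fun y => A y j) x : ℝ) : ℂ) * (a x * φ x)) :=
    fun j => by
      refine hχ.integrable.bdd_mul (c := K)
        (Complex.measurable_ofReal.comp (measurable_pderiv _ j)).aestronglyMeasurable
        (Eventually.of_forall fun x => ?_)
      rw [Complex.norm_real]
      exact abs_pderiv_le_of_lipschitz (lipschitzWith_coord hA j) j x
  have i5 : ∀ j, Integrable (pderiv j (fun x => a x * φ x)) := fun j => (hχ.pderiv j).integrable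
  -- Where A is differentiable this is the j-th derivative of (∂_j a)φ - a∂_jφ + 2iA_j aφ +
  -- 2(ζ_j/h)aφ, expanded so that each summand can be integrated by itself. The sum over j is the
  -- difference between an operator and its transpose.
  set D : Fin 3 → E3 → ℂ := fun j x =>
    (pderiv j (pderiv j a) x * φ x - a x * pderiv j (pderiv j φ) x)
    + 2 * Complex.I * ((A x j : ℂ) * pderiv j (fun x => a x * φ x) x
      + ((pderiv j (fun y => A y j) x : ℝ) : ℂ) * (a x * φ x))
    + 2 * (ζ j / h) * pderiv j (fun x => a x * φ x) x with hD
  have hDi : ∀ j, Integrable (D j) := fun j =>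
    (((i2 j).sub (i1 j)).add (((i3 j).add (i4 j)).const_mul _)).add ((i5 j).const_mul _)
  have hD0 : ∀ j, ∫ x, D j x = 0 := fun j => by
    have j1 : Integrable (fun x => pderiv j (pderiv j a) x * φ x - a x * pderiv j (pderiv j φ) x) :=
      (i2 j).sub (i1 j)
    have j2 : Integrable (fun x => 2 * Complex.I * ((A x j : ℂ) * pderiv j (fun x => a x * φ x) x
      + ((pderiv j (fun y => A y j) x : ℝ) : ℂ) * (a x * φ x))) := ((i3 j).add (i4 j)).const_mul _
    have j3 : Integrable (fun x => pderiv j (pderiv j a) x * φ x - a x * pderiv j (pderiv j φ) x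
      + 2 * Complex.I * ((A x j : ℂ) * pderiv j (fun x => a x * φ x) x
      + ((pderiv j (fun y => A y j) x : ℝ) : ℂ) * (a x * φ x))) := j1.add j2
    simp only [hD]
    rw [integral_add j3 ((i5 j).const_mul _), integral_add j1 j2, integral_sub (i2 j) (i1 j), z1,
      sub_self, integral_const_mul, integral_add (i3 j) (i4 j),
      integral_ofReal_lipschitz_mul_pderiv (lipschitzWith_coord hA j) hχ, integral_const_mul,
      integral_pderiv_eq_zero (one hχ.1) hχ.2.1]
    ring
  have hpt : ∀ x, a x * ellOp (conjB (magB A) ζ h) (conjC (magB A) (magC A q) ζ h) φ x =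
      conjOp A q ζ h a x * φ x + ∑ j, D j x := fun x => by
    simp only [hD, conjOp, ellOp, lap, conjB, magB, fieldDeriv, Fin.sum_univ_three,
      pderiv_mul (had x) (hφ.differentiableAt x)]
    ring
  simp only [hpt]
  rw [integral_add hi (integrable_finsetSum _ fun j _ => hDi j),
    integral_finsetSum _ fun j _ => hDi j]
  simp [hD0]

lemma norm_sum_fin_three_le {f : Fin 3 → ℂ} {C : ℝ} (h : ∀ j, ‖f j‖ ≤ C) : ‖∑ j, f j‖ ≤ 3 * C := by
  refine (norm_sum_le _ _).trans ((Finset.sum_le_card_nsmul _ _ C fun j _ => h j).trans ?_)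
  simp

/-- An approximate solution of the transport equation is an approximate solution of the conjugated
equation. -/
lemma norm_conjOp_le {α β : E3} {A : E3 → E3} {q : E3 → ℂ} {a : E3 → ℂ} {x : E3} {s : ℂ} {ζ : C3}
    {ε C M L : ℝ} (hε : 0 < ε) (hε1 : ε ≤ 1) (h0 : ‖a x‖ ≤ C) (h1 : ∀ j, ‖pderiv j a x‖ ≤ C)
    (h2 : ∀ j, ‖pderiv j (pderiv j a) x‖ ≤ C * ε⁻¹)
    (htr : ∑ j, zetaZero α β j * pderiv j a x = s * a x)
    (hs : ‖s - sourceMap α β (A x)‖ ≤ L * ε) (hζ : ‖ζ - zetaZero α β‖ ≤ L * ε ^ 3)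
    (hA : ‖A x‖ ≤ M) (hdA : ∀ j, ‖(fieldDeriv A j x j : ℂ)‖ ≤ M) (hc : ‖magC A q x‖ ≤ M) :
    ‖conjOp A q ζ (ε ^ 3) a x‖ ≤
      (3 * C + 13 * (M * C) + 2 * (L * C + 3 * (L * C) + 3 * (M * L * C))) * (ε⁻¹) ^ 2 := by
  have hC0 : 0 ≤ C := (norm_nonneg _).trans h0
  have hM0 : 0 ≤ M := (norm_nonneg _).trans hA
  have hL0 : 0 ≤ L := by
    by_contra hneg
    have : L * ε < 0 := mul_neg_of_neg_of_pos (not_le.1 hneg) hε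
    linarith [norm_nonneg (s - sourceMap α β (A x))]
  set δ : Fin 3 → ℂ := fun j => ζ j - zetaZero α β j with hδ
  have hδb : ∀ j, ‖δ j‖ ≤ L * ε ^ 3 := fun j => (PiLp.norm_apply_le (ζ - zetaZero α β) j).trans hζ
  have hAj : ∀ j, ‖(A x j : ℂ)‖ ≤ M := fun j => by
    rw [Complex.norm_real]
    exact (abs_coord_le _ _).trans hA
  have hε0 : (ε : ℂ) ≠ 0 := by exact_mod_cast hε.ne'
  -- All terms carrying 1/h = ε⁻³ are collected in the last bracket. Writing ζ = ζ₀ + δ and using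
  -- the transport equation, the ζ₀ part reduces to the mollification error times a, of size ε; the
  -- δ parts are of size ε³.
  have e : conjOp A q ζ (ε ^ 3) a x =
      -(∑ j, pderiv j (pderiv j a) x) - 2 * Complex.I * (∑ j, (A x j : ℂ) * pderiv j a x)
      + (magC A q x - 2 * Complex.I * ∑ j, (fieldDeriv A j x j : ℂ)) * a x
      - 2 * ((ε : ℂ)⁻¹) ^ 3 * ((s - sourceMap α β (A x)) * a x + (∑ j, δ j * pderiv j a x)
        + Complex.I * (∑ j, (A x j : ℂ) * δ j) * a x) := by
    rw [sub_mul s, ← htr, sourceMap_eq_sum]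
    simp only [conjOp, lap, conjB, conjC, magB, hδ, Fin.sum_univ_three]
    push_cast
    field_simp
    ring
  have hi1 : 1 ≤ ε⁻¹ := (one_le_inv₀ hε).2 hε1
  have hi2 : ε⁻¹ ≤ (ε⁻¹) ^ 2 := by nlinarith
  have n2 : ‖2 * Complex.I‖ = 2 := by simp
  have b1 : ‖∑ j, pderiv j (pderiv j a) x‖ ≤ 3 * (C * ε⁻¹) := norm_sum_fin_three_le h2
  have b2 : ‖2 * Complex.I * (∑ j, (A x j : ℂ) * pderiv j a x)‖ ≤ 2 * (3 * (M * C)) := by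
    rw [norm_mul, n2]
    refine mul_le_mul_of_nonneg_left (norm_sum_fin_three_le fun j => ?_) (by norm_num)
    rw [norm_mul]
    exact mul_le_mul (hAj j) (h1 j) (norm_nonneg _) hM0
  have b3 : ‖(magC A q x - 2 * Complex.I * ∑ j, (fieldDeriv A j x j : ℂ)) * a x‖ ≤
      (M + 2 * (3 * M)) * C := by
    rw [norm_mul]
    refine mul_le_mul ((norm_sub_le _ _).trans (add_le_add hc ?_)) h0 (norm_nonneg _)
      (by positivity)
    rw [norm_mul, n2]
    exact mul_le_mul_of_nonneg_left (norm_sum_fin_three_le hdA) (by norm_num)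
  have b4 : ‖(s - sourceMap α β (A x)) * a x‖ ≤ L * ε * C := by
    rw [norm_mul]
    exact mul_le_mul hs h0 (norm_nonneg _) (by positivity)
  have b5 : ‖∑ j, δ j * pderiv j a x‖ ≤ 3 * (L * ε ^ 3 * C) := norm_sum_fin_three_le fun j => by
    rw [norm_mul]
    exact mul_le_mul (hδb j) (h1 j) (norm_nonneg _) (by positivity)
  have b6 : ‖Complex.I * (∑ j, (A x j : ℂ) * δ j) * a x‖ ≤ 3 * (M * (L * ε ^ 3)) * C := by
    rw [norm_mul, norm_mul, Complex.norm_I, one_mul]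
    refine mul_le_mul (norm_sum_fin_three_le fun j => ?_) h0 (norm_nonneg _) (by positivity)
    rw [norm_mul]
    exact mul_le_mul (hAj j) (hδb j) (norm_nonneg _) hM0
  have b7 : ‖2 * ((ε : ℂ)⁻¹) ^ 3 * ((s - sourceMap α β (A x)) * a x + (∑ j, δ j * pderiv j a x)
        + Complex.I * (∑ j, (A x j : ℂ) * δ j) * a x)‖ ≤
      2 * (ε⁻¹) ^ 3 * (L * ε * C + 3 * (L * ε ^ 3 * C) + 3 * (M * (L * ε ^ 3)) * C) := by
    have n3 : ‖2 * ((ε : ℂ)⁻¹) ^ 3‖ = 2 * (ε⁻¹) ^ 3 := by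
      rw [norm_mul, norm_pow, norm_inv, Complex.norm_real, Real.norm_of_nonneg hε.le]
      simp
    rw [norm_mul, n3]
    refine mul_le_mul_of_nonneg_left ?_ (by positivity)
    exact (norm_add_le _ _).trans (add_le_add ((norm_add_le _ _).trans (add_le_add b4 b5)) b6)
  -- Only the mollification error keeps a factor ε⁻²; the contributions of δ are bounded.
  have e7 : 2 * (ε⁻¹) ^ 3 * (L * ε * C + 3 * (L * ε ^ 3 * C) + 3 * (M * (L * ε ^ 3)) * C) =
      2 * (L * C * (ε⁻¹) ^ 2 + 3 * (L * C) + 3 * (M * L * C)) := by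
    field_simp
  rw [e7] at b7
  rw [e]
  refine (norm_sub_le _ _).trans ((add_le_add ((norm_add_le _ _).trans (add_le_add
    ((norm_sub_le _ _).trans (add_le_add ((norm_neg _).trans_le b1) b2)) b3)) b7).trans ?_)
  have hi3 : 1 ≤ (ε⁻¹) ^ 2 := hi1.trans hi2
  have m1 := mul_le_mul_of_nonneg_left hi2 hC0
  have m2 := mul_le_mul_of_nonneg_left hi3 (mul_nonneg hM0 hC0)
  have m3 := mul_le_mul_of_nonneg_left hi3 (mul_nonneg hL0 hC0)
  have m4 := mul_le_mul_of_nonneg_left hi3 (mul_nonneg (mul_nonneg hM0 hL0) hC0)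
  nlinarith

lemma toReal_eLpNorm_le_of_norm_le_mul {f g : E3 → ℂ} {C : ℝ} (hC : 0 ≤ C) (hg : MemLp g 2)
    (h : ∀ x, ‖f x‖ ≤ C * ‖g x‖) :
    (eLpNorm f 2 volume).toReal ≤ C * (eLpNorm g 2 volume).toReal := by
  have h1 := eLpNorm_le_mul_eLpNorm_of_ae_le_mul (Eventually.of_forall h) 2 (μ := volume)
  have h2 := ENNReal.toReal_mono (ENNReal.mul_ne_top ENNReal.ofReal_ne_top hg.2.ne) h1
  rwa [ENNReal.toReal_mul, ENNReal.toReal_ofReal hC] at h2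

lemma integrable_of_memLp_of_eq_zero {f : E3 → ℂ} (hf : MemLp f 2) {R : ℝ}
    (h : ∀ x ∉ Metric.ball (0 : E3) R, f x = 0) : Integrable f := by
  have : IsFiniteMeasure (volume.restrict (Metric.ball (0 : E3) R)) :=
    ⟨by rw [Measure.restrict_apply_univ]; exact measure_ball_lt_top⟩
  have h1 : IntegrableOn f (Metric.ball (0 : E3) R) :=
    (hf.restrict _).integrable (by norm_num)
  exact h1.integrable_of_forall_notMem_eq_zero h

lemma ellOp_eq_zero {b : Fin 3 → E3 → ℂ} {c : E3 → ℂ} {U : Set E3} {φ : E3 → ℂ}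
    (hφ : IsTestFunction U φ) {x : E3} (hx : x ∉ U) : ellOp b c φ x = 0 := by
  simp [ellOp, hφ.lap.eq_zero hx, hφ.eq_zero hx, fun j => (hφ.pderiv j).eq_zero hx]

/-! ### Solving for the remainder with gradient control. -/

/-- Solvability of the conjugated equation with control of the weak gradient. -/
theorem exists_solution_conj_gradient {R₁ R₂ : ℝ} (hR₁ : 0 < R₁) (hR : R₁ < R₂) (M : ℝ)
    (hM : 0 ≤ M) : ∃ C h₀ : ℝ, 0 < C ∧ 0 < h₀ ∧
    ∀ h : ℝ, 0 < h → h < h₀ → ∀ ζ : C3, cdot ζ ζ = 0 → 1 / 4 ≤ ‖reVec ζ‖ ^ 2 → ‖reVec ζ‖ ≤ 2 →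
    ‖ζ‖ ≤ 4 → ∀ (b : Fin 3 → E3 → ℂ) (c : E3 → ℂ), (∀ j x, ‖b j x‖ ≤ M) → (∀ x, ‖c x‖ ≤ M) →
      (∀ j, Measurable (b j)) → Measurable c →
    ∀ f : E3 → ℂ, MemLp f 2 volume → (∀ x ∉ Metric.ball (0 : E3) R₂, f x = 0) →
    ∀ Ω : Set E3, Ω ⊆ Metric.ball 0 R₁ →
    ∃ (r : E3 → ℂ) (G : Fin 3 → E3 → ℂ), MemLp r 2 volume ∧
      (eLpNorm r 2 volume).toReal ≤ C * h * (eLpNorm f 2 volume).toReal ∧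
      (∀ φ : E3 → ℂ, IsTestFunction (Metric.ball 0 R₂) φ →
        ∫ x, r x * ellOp (conjB b ζ h) (conjC b c ζ h) φ x = ∫ x, f x * φ x) ∧
      HasWeakGradient Ω r G ∧ ∀ j, MemLp (G j) 2 volume ∧
        (eLpNorm (G j) 2 volume).toReal ≤ C * (eLpNorm f 2 volume).toReal := by
  obtain ⟨K, h₁, hK, hh₁, hsol⟩ := exists_solution_conj R₂ M (hR₁.trans hR)
  obtain ⟨C, hC, hgrad⟩ := exists_weakGradient hR₁ hR
  refine ⟨K + C * (K + 3 * ((M + 8) * K) + ((13 * M) * K + 1)), min h₁ 1, by positivity,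
    lt_min hh₁ one_pos, ?_⟩
  intro h hh hhlt ζ hζ hζ1 hζ2 hζ4 b c hb hc hbm hcm f hf hf0 Ω hΩ
  have hh1 : h < h₁ := hhlt.trans_le (min_le_left _ _)
  have hh2 : h < 1 := hhlt.trans_le (min_le_right _ _)
  obtain ⟨r₀, hr₀, hr₀n, hr₀e⟩ := hsol h hh hh1 ζ hζ hζ1 hζ2 b c hb hc hbm hcm f hf
  set U := Metric.ball (0 : E3) R₂ with hU
  -- Cutting off outside the ball does not affect the equation tested there, and makes r and the
  -- sources built from it integrable as well as square integrable.
  set r : E3 → ℂ := U.indicator r₀ with hr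
  have hrm : MemLp r 2 := hr₀.indicator measurableSet_ball
  have hr0 : ∀ x ∉ U, r x = 0 := fun x hx => indicator_of_notMem hx _
  set F := (eLpNorm f 2 volume).toReal with hF
  have hF0 : 0 ≤ F := ENNReal.toReal_nonneg
  set N := (eLpNorm r 2 volume).toReal with hN
  have hN0 : 0 ≤ N := ENNReal.toReal_nonneg
  have hrn : N ≤ K * h * F :=
    (ENNReal.toReal_mono hr₀.2.ne (eLpNorm_indicator_le _)).trans hr₀n
  have hre : ∀ φ : E3 → ℂ, IsTestFunction U φ →
      ∫ x, r x * ellOp (conjB b ζ h) (conjC b c ζ h) φ x = ∫ x, f x * φ x := fun φ hφ => by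
    rw [← hr₀e φ hφ]
    refine integral_congr_ae (Eventually.of_forall fun x => ?_)
    by_cases hx : x ∈ U
    · simp only [hr, indicator_of_mem hx]
    · simp only [ellOp_eq_zero hφ hx, mul_zero]
  have hBb : ∀ j x, ‖conjB b ζ h j x‖ ≤ M + 8 / h := fun j x =>
    (norm_conjB_le hb ζ hh j x).trans (by
      have : ‖ζ‖ / h ≤ 4 / h := by gcongr
      have e : 8 / h = 2 * (4 / h) := by ring
      linarith)
  have hCb : ∀ x, ‖conjC b c ζ h x‖ ≤ M + 12 * M / h := fun x =>
    (norm_conjC_le hb hc ζ hh x).trans (by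
      have : M * (‖ζ‖ / h) ≤ M * (4 / h) := by gcongr
      have e : 12 * M / h = 3 * (M * (4 / h)) := by ring
      linarith)
  set g : Fin 3 → E3 → ℂ := fun j x => conjB b ζ h j x * r x with hg
  set g1 : E3 → ℂ := fun x => conjC b c ζ h x * r x with hg1
  have hgb : ∀ j x, ‖g j x‖ ≤ (M + 8 / h) * ‖r x‖ := fun j x => by
    rw [hg, norm_mul]
    exact mul_le_mul_of_nonneg_right (hBb j x) (norm_nonneg _)
  have hg1b : ∀ x, ‖g1 x‖ ≤ (M + 12 * M / h) * ‖r x‖ := fun x => by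
    rw [hg1, norm_mul]
    exact mul_le_mul_of_nonneg_right (hCb x) (norm_nonneg _)
  have hgm : ∀ j, MemLp (g j) 2 := fun j => hrm.of_le_mul
    ((measurable_conjB hbm ζ h j).aestronglyMeasurable.mul hrm.1) (Eventually.of_forall (hgb j))
  have hg1m : MemLp g1 2 := hrm.of_le_mul
    ((measurable_conjC hbm hcm ζ h).aestronglyMeasurable.mul hrm.1) (Eventually.of_forall hg1b)
  have hg0m : MemLp (fun x => g1 x - f x) 2 := hg1m.sub hf
  have int : ∀ {u : E3 → ℂ}, MemLp u 2 → ∀ {φ : E3 → ℂ}, IsTestFunction U φ →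
      Integrable (fun x => u x * φ x) := fun hu _ hφ => hu.integrable_mul (hφ.memLp 2)
  -- The first and zeroth order terms are moved to the right as sources conjB·r and conjC·r - f,
  -- giving the form treated by interior regularity.
  have heq : ∀ φ : E3 → ℂ, IsTestFunction U φ →
      ∫ x, r x * lap φ x = (∑ j, ∫ x, g j x * pderiv j φ x) + ∫ x, (g1 x - f x) * φ x := by
    intro φ hφ
    have e1 := hre φ hφ
    have i1 := int hrm hφ.lap
    have i2 : ∀ j, Integrable (fun x => g j x * pderiv j φ x) := fun j => int (hgm j) (hφ.pderiv j)
    have i3 := int hg1m hφ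
    have i4 := int hf hφ
    have i5 : Integrable (fun x => ∑ j, g j x * pderiv j φ x) :=
      integrable_finsetSum _ fun j _ => i2 j
    have e2 : ∀ x, r x * ellOp (conjB b ζ h) (conjC b c ζ h) φ x =
        (∑ j, g j x * pderiv j φ x) + g1 x * φ x - r x * lap φ x := fun x => by
      simp only [ellOp, hg, hg1, Fin.sum_univ_three]
      ring
    have i6 : Integrable (fun x => (∑ j, g j x * pderiv j φ x) + g1 x * φ x) := i5.add i3
    simp only [e2] at e1
    rw [integral_sub i6 i1, integral_add i5 i3, integral_finsetSum _ fun j _ => i2 j] at e1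
    simp only [sub_mul]
    rw [integral_sub i3 i4]
    linear_combination -e1
  have hz : ∀ x ∉ U, g1 x - f x = 0 := fun x hx => by simp [hg1, hr0 x hx, hf0 x hx]
  -- With κ = 1/h each of the three contributions is at most a constant times ‖f‖: r gains h, while
  -- both coefficients are O(1/h), so the sources are O(1) relative to f.
  obtain ⟨G, hG, hGn⟩ := hgrad r (fun x => g1 x - f x) g (integrable_of_memLp_of_eq_zero hrm hr0) hrm
    (integrable_of_memLp_of_eq_zero hg0m hz) hg0m
    (fun j => integrable_of_memLp_of_eq_zero (R := R₂) (hgm j) fun x hx => by simp [hg, hr0 x hx]) hgm heq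
    h⁻¹ ((one_le_inv₀ hh).2 hh2.le) Ω hΩ
  have hb1 : ∀ j, (eLpNorm (g j) 2 volume).toReal ≤ (M + 8) * K * F := fun j => by
    refine (toReal_eLpNorm_le_of_norm_le_mul (by positivity) hrm (hgb j)).trans ?_
    calc (M + 8 / h) * N ≤ (M + 8 / h) * (K * h * F) := by gcongr
      _ = (M * h + 8) * K * F := by field_simp
      _ ≤ (M * 1 + 8) * K * F := by gcongr
      _ = _ := by ring
  have hb2 : (eLpNorm (fun x => g1 x - f x) 2 volume).toReal ≤ (13 * M) * K * F + F := by
    have h1 : (eLpNorm (fun x => g1 x - f x) 2 volume).toReal ≤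
        (eLpNorm g1 2 volume).toReal + F := by
      rw [hF, ← ENNReal.toReal_add hg1m.2.ne hf.2.ne]
      exact ENNReal.toReal_mono (ENNReal.add_ne_top.2 ⟨hg1m.2.ne, hf.2.ne⟩)
        (eLpNorm_sub_le hg1m.1 hf.1 (by norm_num))
    refine h1.trans (add_le_add_left ?_ _)
    refine (toReal_eLpNorm_le_of_norm_le_mul (by positivity) hrm hg1b).trans ?_
    calc (M + 12 * M / h) * N ≤ (M + 12 * M / h) * (K * h * F) := by gcongr
      _ = (M * h + 12 * M) * K * F := by field_simp
      _ ≤ (M * 1 + 12 * M) * K * F := by gcongr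
      _ = _ := by ring
  refine ⟨r, G, hrm, hrn.trans ?_, hre, hG, fun j => ⟨(hGn j).1, (hGn j).2.trans ?_⟩⟩
  · have : K ≤ K + C * (K + 3 * ((M + 8) * K) + ((13 * M) * K + 1)) :=
      le_add_of_nonneg_right (by positivity)
    gcongr
  · have s1 : h⁻¹ * N ≤ K * F := by
      calc h⁻¹ * N ≤ h⁻¹ * (K * h * F) := by gcongr
        _ = K * F := by field_simp
    have s2 : ∑ j, (eLpNorm (g j) 2 volume).toReal ≤ 3 * ((M + 8) * K * F) := by
      refine (Finset.sum_le_card_nsmul _ _ _ fun j _ => hb1 j).trans (le_of_eq ?_)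
      simp
    have s3 : h⁻¹⁻¹ * (eLpNorm (fun x => g1 x - f x) 2 volume).toReal ≤
        1 * ((13 * M) * K * F + F) := by
      rw [inv_inv]
      exact mul_le_mul hh2.le hb2 ENNReal.toReal_nonneg zero_le_one
    calc _ ≤ C * (K * F + 3 * ((M + 8) * K * F) + 1 * ((13 * M) * K * F + F)) :=
          mul_le_mul_of_nonneg_left (add_le_add (add_le_add s1 s2) s3) hC.le
      _ ≤ _ := by
          have : 0 ≤ K * F := by positivity
          nlinarith

section

variable {α β : E3} {ψ : E3 → ℝ} {A : E3 → E3} {q : E3 → ℂ}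

lemma norm_toC3 (x : E3) : ‖toC3 x‖ = ‖x‖ := by
  simp [toC3, EuclideanSpace.norm_eq]

lemma norm_zetaZero_le (hα : ‖α‖ = 1) (hβ : ‖β‖ = 1) : ‖zetaZero α β‖ ≤ 2 := by
  refine (norm_add_le _ _).trans ?_
  rw [norm_smul, norm_toC3, norm_toC3, hα, hβ, Complex.norm_I]
  norm_num

lemma norm_reVec_le (z : C3) : ‖reVec z‖ ≤ ‖z‖ := by
  rw [EuclideanSpace.norm_eq, EuclideanSpace.norm_eq]
  refine Real.sqrt_le_sqrt (Finset.sum_le_sum fun j _ => ?_)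
  exact pow_le_pow_left₀ (norm_nonneg _) (Complex.abs_re_le_norm _) 2

lemma reVec_sub_zetaZero (z : C3) : reVec (z - zetaZero α β) = reVec z - α := by
  ext j
  simp [reVec, zetaZero, toC3]

lemma norm_fieldDeriv_le {K : NNReal} (hA : LipschitzWith K A) (j : Fin 3) (x : E3) :
    ‖(fieldDeriv A j x j : ℂ)‖ ≤ K := by
  rw [Complex.norm_real]
  exact abs_pderiv_le_of_lipschitz (lipschitzWith_coord hA j) j x

lemma norm_magB_le {B : ℝ} (hB : ∀ x, ‖A x‖ ≤ B) (j : Fin 3) (x : E3) :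
    ‖magB A j x‖ ≤ 2 * B := by
  have : |A x j| ≤ B := (abs_coord_le _ _).trans (hB x)
  simp only [magB, norm_mul, Complex.norm_real, Complex.norm_I, RCLike.norm_ofNat, mul_one,
    Real.norm_eq_abs]
  linarith

lemma norm_magC_le {K : NNReal} {B Q : ℝ} (hA : LipschitzWith K A) (hB : ∀ x, ‖A x‖ ≤ B)
    (hQ : ∀ x, ‖q x‖ ≤ Q) (x : E3) : ‖magC A q x‖ ≤ 3 * K + 3 * B ^ 2 + Q := by
  refine (norm_add_le _ _).trans (add_le_add ((norm_add_le _ _).trans (add_le_add ?_ ?_)) (hQ x))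
  · rw [norm_mul, Complex.norm_I, one_mul]
    exact norm_sum_fin_three_le fun j => norm_fieldDeriv_le hA j x
  · refine norm_sum_fin_three_le fun j => ?_
    rw [norm_pow, Complex.norm_real]
    exact pow_le_pow_left₀ (norm_nonneg _) ((abs_coord_le _ _).trans (hB x)) 2

lemma measurable_magB (hA : Continuous A) (j : Fin 3) : Measurable (magB A j) := by
  have h : Continuous fun x => A x j := (EuclideanSpace.proj (𝕜 := ℝ) j).continuous.comp hA
  exact (Complex.measurable_ofReal.comp h.measurable).const_mul _

lemma measurable_magC (hA : Continuous A) (hq : Measurable q) : Measurable (magC A q) := by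
  have h : ∀ j, Measurable fun x => (A x j : ℂ) := fun j =>
    Complex.measurable_ofReal.comp
      ((EuclideanSpace.proj (𝕜 := ℝ) j).continuous.comp hA).measurable
  have h2 : ∀ j, Measurable fun x => (fieldDeriv A j x j : ℂ) := fun j =>
    Complex.measurable_ofReal.comp (measurable_pderiv (fun y => A y j) j)
  unfold magC
  fun_prop

lemma measurable_conjOp (hA : Continuous A) (hq : Measurable q) (ζ : C3) (h : ℝ) {a : E3 → ℂ}
    (ha : ContDiff ℝ ∞ a) : Measurable (conjOp A q ζ h a) := by
  have h1 : ∀ j, Measurable (pderiv j a) := fun j => (ha.pderiv j).continuous.measurable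
  have h2 : Measurable (lap a) :=
    Finset.measurable_sum _ fun j _ => ((ha.pderiv j).pderiv j).continuous.measurable
  have h3 := fun j => measurable_conjB (measurable_magB hA) ζ h j
  have h4 := measurable_conjC (measurable_magB hA) (measurable_magC hA hq) ζ h
  have h5 : ∀ j, Measurable fun x => (fieldDeriv A j x j : ℂ) := fun j =>
    Complex.measurable_ofReal.comp (measurable_pderiv (fun y => A y j) j)
  have h6 : Measurable a := ha.continuous.measurable
  unfold conjOp
  fun_prop

/-- The amplitude solves the conjugated equation up to `O(h^{-2/3})`. -/
lemma exists_bound_conjOp_exp_Phi (hψ : IsMollifier ψ) (hα : ‖α‖ = 1) (hβ : ‖β‖ = 1)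
    (hαβ : inner ℝ α β = 0) {K : NNReal} (hA : LipschitzWith K A) (hAc : HasCompactSupport A)
    {B : ℝ} (hB : ∀ x, ‖A x‖ ≤ B) {M : ℝ} (hM : ∀ x, ‖magC A q x‖ ≤ M) (R : ℝ) {L : ℝ}
    (hL : 0 < L) : ∃ C : ℝ, 0 ≤ C ∧
    ∀ ε : ℝ, 0 < ε → ε ≤ 1 → ∀ ζ : C3, ‖ζ - zetaZero α β‖ ≤ L * ε ^ 3 →
    ∀ x ∈ Metric.ball (0 : E3) R,
      ‖conjOp A q ζ (ε ^ 3) (fun x => Complex.exp (Phi α β ψ A ε x)) x‖ ≤ C * (ε⁻¹) ^ 2 := by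
  have hB0 : 0 ≤ B := (norm_nonneg _).trans (hB 0)
  have hM0 : 0 ≤ M := (norm_nonneg _).trans (hM 0)
  have hK0 : (0 : ℝ) ≤ K := K.2
  obtain ⟨Ca, hCa, ha⟩ := exists_bound_exp_Phi hψ hα hβ hαβ hA hAc R
  obtain ⟨Ct, hCt, ht⟩ := exists_transport_error (α := α) (β := β) hψ hA
  set M' := M + B + K with hM'
  set L' := Ct + L with hL'
  refine ⟨3 * Ca + 13 * (M' * Ca) + 2 * (L' * Ca + 3 * (L' * Ca) + 3 * (M' * L' * Ca)),
    by positivity, fun ε hε hε1 ζ hζ x hx => ?_⟩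
  rw [mem_ball_zero_iff] at hx
  obtain ⟨a0, a1, a2⟩ := ha ε hε hε1 x hx.le
  refine norm_conjOp_le (α := α) (β := β) (s := sourceMap α β (mollify ψ ε A x)) hε hε1 a0 a1 a2
    (transport_exp_Phi hψ hα hβ hαβ hε hA.continuous hAc x) ?_ ?_ ?_ ?_ ?_
  · exact (ht ε hε x).trans (mul_le_mul_of_nonneg_right (le_add_of_nonneg_right hL.le) hε.le)
  · exact hζ.trans (mul_le_mul_of_nonneg_right (le_add_of_nonneg_left hCt) (by positivity))
  · exact (hB x).trans (by linarith)
  · exact fun j => (norm_fieldDeriv_le hA j x).trans (by linarith)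
  · exact (hM x).trans (by linarith)

/-- Adding a solution of the inhomogeneous equation corrects an approximate solution. -/
lemma setIntegral_add_mul_ellOp_eq_zero {K : NNReal} (hA : LipschitzWith K A) {M : ℝ}
    (hb : ∀ j x, ‖magB A j x‖ ≤ M) (hc : ∀ x, ‖magC A q x‖ ≤ M) (hqm : Measurable q)
    {R : ℝ} {Ω : Set E3} (hΩ : Ω ⊆ Metric.ball 0 R) {h : ℝ} (hh : 0 < h) {ζ : C3} {a r φ : E3 → ℂ}
    (ha : ContDiff ℝ ∞ a) (hr : MemLp r 2 volume) (hφ : IsTestFunction Ω φ)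
    (hf : MemLp ((Metric.ball 0 R).indicator fun x => -conjOp A q ζ h a x) 2 volume)
    (heq : ∫ x, r x * ellOp (conjB (magB A) ζ h) (conjC (magB A) (magC A q) ζ h) φ x =
      ∫ x, (Metric.ball 0 R).indicator (fun x => -conjOp A q ζ h a x) x * φ x) :
    ∫ x in Ω, (a x + r x) *
      ellOp (conjB (magB A) ζ h) (conjC (magB A) (magC A q) ζ h) φ x = 0 := by
  have hbm := measurable_magB hA.continuous
  have hcm := measurable_magC hA.continuous hqm
  have hfφ : ∀ x, conjOp A q ζ h a x * φ x =
      -((Metric.ball 0 R).indicator (fun x => -conjOp A q ζ h a x) x * φ x) := fun x => by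
    by_cases hx : x ∈ Metric.ball 0 R
    · rw [indicator_of_mem hx]
      ring
    · rw [hφ.eq_zero fun h => hx (hΩ h), mul_zero, mul_zero, neg_zero]
  have hi : Integrable (fun x => conjOp A q ζ h a x * φ x) := by
    simp only [hfφ]
    exact (hf.integrable_mul (hφ.memLp 2)).neg
  have e1 := integral_mul_ellOp_eq hA ha hφ ζ h hi
  simp only [hfφ] at e1
  rw [integral_neg, ← heq] at e1
  have hEm : MemLp (ellOp (conjB (magB A) ζ h) (conjC (magB A) (magC A q) ζ h) φ) 2 volume :=
    memLp_ellOp (M := max (M + 2 * (‖ζ‖ / h)) (M + 3 * (M * (‖ζ‖ / h))))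
      (fun j x => (norm_conjB_le hb ζ hh j x).trans (le_max_left _ _))
      (fun x => (norm_conjC_le hb hc ζ hh x).trans (le_max_right _ _))
      (measurable_conjB hbm ζ h) (measurable_conjC hbm hcm ζ h) hφ 2
  have hE0 : ∀ x ∉ Ω, ellOp (conjB (magB A) ζ h) (conjC (magB A) (magC A q) ζ h) φ x = 0 :=
    fun x hx => ellOp_eq_zero hφ hx
  generalize ellOp (conjB (magB A) ζ h) (conjC (magB A) (magC A q) ζ h) φ = E at *
  have hrE : Integrable (fun x => r x * E x) := hr.integrable_mul hEm
  have haE : Integrable (fun x => a x * E x) := by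
    obtain ⟨ba, hba⟩ := (isCompact_closedBall (0 : E3) R).exists_bound_of_continuousOn
      ha.continuous.continuousOn
    have hEi : Integrable E := integrable_of_memLp_of_eq_zero (R := R) hEm fun x hx =>
      hE0 x fun h => hx (hΩ h)
    refine (hEi.norm.const_mul ba).mono' (ha.continuous.aestronglyMeasurable.mul hEm.1)
      (Eventually.of_forall fun x => ?_)
    by_cases hx : x ∈ Ω
    · rw [norm_mul]
      exact mul_le_mul_of_nonneg_right (hba x (Metric.ball_subset_closedBall (hΩ hx)))
        (norm_nonneg _)
    · rw [hE0 x hx]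
      simp
  rw [setIntegral_eq_integral_of_forall_compl_eq_zero fun x hx => by rw [hE0 x hx, mul_zero]]
  simp only [add_mul]
  rw [integral_add haE hrE, e1]
  ring

/-- The real part of ζ₀ is the unit vector α, so a perturbation of size 1/2 keeps Re ζ in the range
of directions for which the Carleman constants are uniform. -/
lemma bounds_of_norm_sub_zetaZero_le (hα : ‖α‖ = 1) (hβ : ‖β‖ = 1) {ζ : C3}
    (h : ‖ζ - zetaZero α β‖ ≤ 1 / 2) : 1 / 4 ≤ ‖reVec ζ‖ ^ 2 ∧ ‖reVec ζ‖ ≤ 2 ∧ ‖ζ‖ ≤ 4 := by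
  have hre : ‖reVec ζ - α‖ ≤ 1 / 2 := by
    rw [← reVec_sub_zetaZero (β := β)]
    exact (norm_reVec_le _).trans h
  have h1 := norm_sub_norm_le α (reVec ζ)
  have h2 := norm_sub_norm_le (reVec ζ) α
  have h3 := norm_sub_norm_le ζ (zetaZero α β)
  have h4 := norm_zetaZero_le hα hβ
  rw [norm_sub_rev, hα] at h1
  rw [hα] at h2
  have h5 : 1 / 2 ≤ ‖reVec ζ‖ := by linarith
  exact ⟨by nlinarith, by linarith, by linarith⟩

/-- The remainder of the complex geometrical optics solution. -/
theorem exists_cgo_remainder (hψ : IsMollifier ψ) (hα : ‖α‖ = 1) (hβ : ‖β‖ = 1)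
    (hαβ : inner ℝ α β = 0) {K : NNReal} (hA : LipschitzWith K A) (hAc : HasCompactSupport A)
    (hqm : Measurable q) {Q : ℝ} (hQ : ∀ x, ‖q x‖ ≤ Q) {R₁ : ℝ} (hR₁ : 0 < R₁) {L : ℝ}
    (hL : 0 < L) : ∃ C h₀ : ℝ, 0 < C ∧ 0 < h₀ ∧ h₀ ≤ 1 ∧
    ∀ h : ℝ, 0 < h → h < h₀ → ∀ ζ : C3, cdot ζ ζ = 0 → ‖ζ - zetaZero α β‖ ≤ L * h →
    ∀ Ω : Set E3, Ω ⊆ Metric.ball 0 R₁ →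
    ∃ (r : E3 → ℂ) (G : Fin 3 → E3 → ℂ), MemLp r 2 volume ∧
      (eLpNorm r 2 volume).toReal ≤ C * h ^ (1 / 3 : ℝ) ∧
      HasWeakGradient Ω r G ∧ (∀ j, MemLp (G j) 2 volume ∧
        h * (eLpNorm (G j) 2 volume).toReal ≤ C * h ^ (1 / 3 : ℝ)) ∧
      ∀ φ : E3 → ℂ, IsTestFunction Ω φ → ∫ x in Ω, (amplitude α β ψ A h x + r x) *
        ellOp (conjB (magB A) ζ h) (conjC (magB A) (magC A q) ζ h) φ x = 0 := by
  obtain ⟨RA, B, -, hB, -⟩ := exists_bound_of_hasCompactSupport hA.continuous hAc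
  have hB0 : 0 ≤ B := (norm_nonneg _).trans (hB 0)
  have hQ0 : 0 ≤ Q := (norm_nonneg _).trans (hQ 0)
  have hK0 : (0 : ℝ) ≤ K := K.2
  -- The equation is solved in a ball with radius larger by one, leaving room for interior
  -- regularity on the ball containing Ω.
  have hR : R₁ < R₁ + 1 := lt_add_one _
  obtain ⟨M, hM0, hb, hc⟩ : ∃ M : ℝ, 0 ≤ M ∧ (∀ j x, ‖magB A j x‖ ≤ M) ∧
      ∀ x, ‖magC A q x‖ ≤ M :=
    ⟨2 * B + (3 * K + 3 * B ^ 2 + Q), by positivity,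
      fun j x => (norm_magB_le hB j x).trans (le_add_of_nonneg_right (by positivity)),
      fun x => (norm_magC_le hA hB hQ x).trans (le_add_of_nonneg_left (by positivity))⟩
  obtain ⟨Cf, hCf0, hCf⟩ := exists_bound_conjOp_exp_Phi (q := q) hψ hα hβ hαβ hA hAc hB hc
    (R₁ + 1) hL
  obtain ⟨C₁, h₁, hC₁, hh₁, hsol⟩ := exists_solution_conj_gradient hR₁ hR M hM0
  generalize R₁ + 1 = R₂ at *
  have hone : MemLp ((Metric.ball (0 : E3) R₂).indicator fun _ => (1 : ℂ)) 2 volume :=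
    memLp_indicator_const 2 measurableSet_ball 1 (Or.inr measure_ball_lt_top.ne)
  obtain ⟨V, hVdef⟩ : ∃ V, V = (eLpNorm ((Metric.ball (0 : E3) R₂).indicator
    fun _ => (1 : ℂ)) 2 volume).toReal := ⟨_, rfl⟩
  have hV0 : 0 ≤ V := hVdef ▸ ENNReal.toReal_nonneg
  -- The restriction h < 1/(2L) gives ‖ζ - ζ₀‖ ≤ 1/2, and h < 1 gives ε ≤ 1. The +1 only keeps the
  -- constant positive. V is the L² norm of the indicator of the ball.
  refine ⟨C₁ * (Cf * V + 1), min h₁ (min 1 (1 / (2 * L))), by positivity,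
    lt_min hh₁ (lt_min one_pos (by positivity)), (min_le_right _ _).trans (min_le_left _ _), ?_⟩
  intro h hh hhlt ζ hζ hζL Ω hΩR
  have hlt1 : h < h₁ := hhlt.trans_le (min_le_left _ _)
  have hlt2 : h < 1 := hhlt.trans_le ((min_le_right _ _).trans (min_le_left _ _))
  have hlt3 : L * h ≤ 1 / 2 := by
    have h3 : h < 1 / (2 * L) := hhlt.trans_le ((min_le_right _ _).trans (min_le_right _ _))
    rw [lt_div_iff₀ (by positivity)] at h3
    linarith
  obtain ⟨hre1, hre2, hζ4⟩ := bounds_of_norm_sub_zetaZero_le hα hβ (hζL.trans hlt3)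
  obtain ⟨ε, hεdef⟩ : ∃ ε : ℝ, ε = h ^ (1 / 3 : ℝ) := ⟨_, rfl⟩
  have hε : 0 < ε := hεdef ▸ Real.rpow_pos_of_pos hh _
  have hε1 : ε ≤ 1 := hεdef ▸ Real.rpow_le_one hh.le hlt2.le (by norm_num)
  have hε3 : ε ^ 3 = h := by
    rw [hεdef, ← Real.rpow_natCast, ← Real.rpow_mul hh.le]
    norm_num
  have hamp : amplitude α β ψ A h = fun x => Complex.exp (Phi α β ψ A ε x) := by
    rw [hεdef]
    rfl
  have has : ContDiff ℝ ∞ (fun x => Complex.exp (Phi α β ψ A ε x)) :=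
    contDiff_exp_Phi hψ hα hβ hαβ hε hA.continuous hAc
  have hP := hCf ε hε hε1 ζ (by rwa [hε3])
  rw [hε3] at hP
  rw [hamp, ← hεdef]
  generalize (fun x => Complex.exp (Phi α β ψ A ε x)) = a at *
  have hfb : ∀ x, ‖(Metric.ball (0 : E3) R₂).indicator (fun x => -conjOp A q ζ h a x) x‖ ≤
      Cf * (ε⁻¹) ^ 2 * ‖(Metric.ball (0 : E3) R₂).indicator (fun _ => (1 : ℂ)) x‖ := fun x => by
    by_cases hx : x ∈ Metric.ball (0 : E3) R₂
    · rw [indicator_of_mem hx, indicator_of_mem hx, norm_neg, norm_one, mul_one]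
      exact hP x hx
    · rw [indicator_of_notMem hx, indicator_of_notMem hx]
      simp
  have hfmeas : Measurable ((Metric.ball (0 : E3) R₂).indicator
      (fun x => -conjOp A q ζ h a x)) :=
    (measurable_conjOp hA.continuous hqm ζ h has).neg.indicator measurableSet_ball
  have hfm : MemLp ((Metric.ball (0 : E3) R₂).indicator (fun x => -conjOp A q ζ h a x)) 2 volume :=
    hone.of_le_mul hfmeas.aestronglyMeasurable (Eventually.of_forall hfb)
  have hfn := toReal_eLpNorm_le_of_norm_le_mul (by positivity) hone hfb
  rw [← hVdef] at hfn
  obtain ⟨r, G, hr, hrn, hre', hG, hGn⟩ := hsol h hh hlt1 ζ hζ hre1 hre2 hζ4 (magB A)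
    (magC A q) hb hc (measurable_magB hA.continuous) (measurable_magC hA.continuous hqm) _ hfm
    (fun x hx => indicator_of_notMem hx _) Ω hΩR
  have hΩR₂ : Ω ⊆ Metric.ball 0 R₂ := hΩR.trans (Metric.ball_subset_ball hR.le)
  refine ⟨r, G, hr, ?_, hG, fun j => ⟨(hGn j).1, ?_⟩, fun φ hφ => ?_⟩
  rotate_left 2
  · exact setIntegral_add_mul_ellOp_eq_zero hA hb hc hqm hΩR₂ hh has hr hφ hfm
      (hre' φ (hφ.mono hΩR₂))
  all_goals
    generalize (eLpNorm ((Metric.ball (0 : E3) R₂).indicator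
      (fun x => -conjOp A q ζ h a x)) 2 volume).toReal = N at *
    -- The final count of powers: h · ε⁻² = ε³ · ε⁻² = ε = h^{1/3}.
    have hhf : h * N ≤ (Cf * V + 1) * ε := by
      calc h * N ≤ ε ^ 3 * (Cf * (ε⁻¹) ^ 2 * V) := by
            rw [hε3]
            gcongr
        _ = Cf * V * ε := by field_simp
        _ ≤ _ := by nlinarith
  · calc _ ≤ C₁ * (h * N) := by rw [← mul_assoc]; exact hrn
      _ ≤ C₁ * ((Cf * V + 1) * ε) := by gcongr
      _ = _ := by ring
  · calc _ ≤ h * (C₁ * N) := by gcongr; exact (hGn j).2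
      _ = C₁ * (h * N) := by ring
      _ ≤ C₁ * ((Cf * V + 1) * ε) := by gcongr
      _ = _ := by ring

end

/-! ### Assembly of the complex geometrical optics solution. -/

/-- Functions in `L^∞` are almost everywhere bounded. -/
lemma exists_ae_norm_le {α V : Type*} [MeasurableSpace α] [NormedAddCommGroup V] {μ : Measure α}
    {f : α → V} (hf : MemLp f ∞ μ) : ∃ Q : NNReal, ∀ᵐ x ∂μ, ‖f x‖ ≤ Q := by
  refine ⟨(eLpNorm f ∞ μ).toNNReal, ?_⟩
  filter_upwards [ae_le_eLpNormEssSup (f := f) (μ := μ)] with x hx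
  rw [← eLpNorm_exponent_top, ← ENNReal.coe_toNNReal hf.2.ne] at hx
  exact_mod_cast (ENNReal.coe_le_coe.1 hx : ‖f x‖₊ ≤ _)

/-- A bounded measurable representative of an essentially bounded function. -/
lemma exists_bounded_representative {Ω : Set E3} {q : E3 → ℂ}
    (hq : MemLp q ∞ (volume.restrict Ω)) :
    ∃ (q' : E3 → ℂ) (Q : NNReal), Measurable q' ∧ (∀ x, ‖q' x‖ ≤ Q) ∧
      q' =ᵐ[volume.restrict Ω] q := by
  obtain ⟨Q, hqQ⟩ := exists_ae_norm_le hq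
  obtain ⟨q0, hq0m, hq0⟩ := hq.1
  have hs : MeasurableSet {x | ‖q0 x‖ ≤ Q} :=
    measurableSet_le hq0m.measurable.norm measurable_const
  refine ⟨{x | ‖q0 x‖ ≤ Q}.indicator q0, Q, hq0m.measurable.indicator hs, fun x => ?_, ?_⟩
  · by_cases hx : x ∈ {x | ‖q0 x‖ ≤ Q}
    · rw [indicator_of_mem hx]
      exact hx
    · rw [indicator_of_notMem hx, norm_zero]
      exact Q.2
  · filter_upwards [hq0, hqQ] with x h1 h2
    have hx : x ∈ {x | ‖q0 x‖ ≤ Q} := by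
      rw [mem_ofPred_eq, ← h1]
      exact h2
    rw [indicator_of_mem hx, h1]

/-- The 4 counts r and the three components of its gradient, the Euclidean norm being at most the
sum of the components. -/
lemma h1sclNorm_le {Ω : Set E3} {h : ℝ} (hh : 0 ≤ h) {r : E3 → ℂ} {G : Fin 3 → E3 → ℂ}
    (hr : MemLp r 2 volume) (hG : HasWeakGradient Ω r G) (hGm : ∀ j, MemLp (G j) 2 volume)
    {D : ℝ} (hD : (eLpNorm r 2 volume).toReal ≤ D)
    (hGD : ∀ j, h * (eLpNorm (G j) 2 volume).toReal ≤ D) :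
    h1sclNorm Ω h r ≤ ENNReal.ofReal (4 * D) := by
  have hD0 : 0 ≤ D := ENNReal.toReal_nonneg.trans hD
  refine (iInf₂_le G hG).trans ?_
  have h1 : eLpNorm r 2 (volume.restrict Ω) ≤ ENNReal.ofReal D :=
    (eLpNorm_mono_measure r Measure.restrict_le_self).trans
      (ENNReal.le_ofReal_iff_toReal_le hr.2.ne hD0 |>.2 hD)
  have h2 : ∀ j, eLpNorm (fun x => (h : ℂ) * G j x) 2 (volume.restrict Ω) ≤ ENNReal.ofReal D := by
    intro j
    refine (eLpNorm_mono_measure _ Measure.restrict_le_self).trans ?_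
    have hm : MemLp (fun x => (h : ℂ) * G j x) 2 volume := (hGm j).const_mul _
    refine (ENNReal.le_ofReal_iff_toReal_le hm.2.ne hD0).2 ?_
    refine (toReal_eLpNorm_le_of_norm_le_mul hh (hGm j) fun x => ?_).trans (hGD j)
    rw [norm_mul, Complex.norm_real, Real.norm_of_nonneg hh]
  have h3 : eLpNorm (fun x => (WithLp.toLp 2 (fun j => (h : ℂ) * G j x) : C3)) 2
      (volume.restrict Ω) ≤ ∑ j, eLpNorm (fun x => (h : ℂ) * G j x) 2 (volume.restrict Ω) := by
    have e : ∀ x, ‖(WithLp.toLp 2 (fun j => (h : ℂ) * G j x) : C3)‖ ≤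
        ‖∑ j, ‖(h : ℂ) * G j x‖‖ := fun x => by
      rw [Real.norm_of_nonneg (Finset.sum_nonneg fun _ _ => norm_nonneg _)]
      refine (le_of_eq ?_).trans (norm_sum_le Finset.univ
        fun j => (EuclideanSpace.single j ((h : ℂ) * G j x) : C3)) |>.trans (le_of_eq ?_)
      · congr 1
        ext i
        simp [Finset.sum_apply]
      · simp
    refine (eLpNorm_mono e).trans ?_
    have e2 : (fun x => ∑ j, ‖(h : ℂ) * G j x‖) = ∑ j, fun x => ‖(h : ℂ) * G j x‖ := by
      funext x
      simp
    rw [e2]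
    refine (eLpNorm_sum_le (fun j _ => ?_) (by norm_num)).trans (le_of_eq ?_)
    · exact (((hGm j).1.restrict).const_mul _).norm
    · simp only [eLpNorm_norm]
  calc _ ≤ ENNReal.ofReal D + ∑ _j : Fin 3, ENNReal.ofReal D :=
        add_le_add h1 (h3.trans (Finset.sum_le_sum fun j _ => h2 j))
    _ = ENNReal.ofReal (4 * D) := by
        rw [Fin.sum_univ_three, ← ENNReal.ofReal_add hD0 hD0, ← ENNReal.ofReal_add (by positivity) hD0,
          ← ENNReal.ofReal_add hD0 (by positivity)]
        congr 1
        ring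

lemma hasWeakPartial_of_contDiff {Ω : Set E3} {a : E3 → ℂ} (ha : ContDiff ℝ ∞ a) (j : Fin 3) :
    HasWeakPartial Ω j a (pderiv j a) := by
  refine HasWeakPartial.of_integral_eq (U := univ) (subset_univ _) ha.continuous.locallyIntegrable
    (ha.pderiv j).continuous.locallyIntegrable fun φ hφ => ?_
  have := integral_mul_pderiv (𝕜 := ℂ) (ha.of_le (by norm_cast))
    (hφ.ofReal.1.of_le (by norm_cast)) hφ.ofReal.2.1 j
  simpa only [pderiv_ofReal (hφ.differentiableAt _)] using this

lemma HasWeakPartial.add' {Ω : Set E3} {j : Fin 3} {u v u' v' : E3 → ℂ}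
    (h : HasWeakPartial Ω j u v) (h' : HasWeakPartial Ω j u' v') :
    HasWeakPartial Ω j (fun x => u x + u' x) (fun x => v x + v' x) := by
  refine ⟨h.1.add h'.1, h.2.1.add h'.2.1, fun φ hφ => ?_⟩
  have int : ∀ {w : E3 → ℂ}, LocallyIntegrableOn w Ω → ∀ {χ : E3 → ℝ}, IsTestFunction Ω χ →
      Integrable (fun x => χ x • w x) (volume.restrict Ω) := fun hw χ hχ => by
    simpa only [Complex.real_smul] using LocallyIntegrableOn.integrable_mul_testFunction hw
      hχ.ofReal.continuous hχ.ofReal.2.1 hχ.ofReal.2.2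
  simp only [smul_add]
  rw [integral_add (int h.1 (hφ.pderiv j)) (int h'.1 (hφ.pderiv j)), h.2.2 φ hφ, h'.2.2 φ hφ,
    integral_add (int h.2.1 hφ) (int h'.2.1 hφ)]
  ring

lemma memLp_restrict_of_continuous {Ω : Set E3} (hΩ : Bornology.IsBounded Ω)
    (hm : MeasurableSet Ω) {a : E3 → ℂ} (ha : Continuous a) :
    MemLp a 2 (volume.restrict Ω) := by
  obtain ⟨B, hB⟩ := hΩ.isCompact_closure.exists_bound_of_continuousOn ha.continuousOn
  have : IsFiniteMeasure (volume.restrict Ω) :=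
    ⟨by rw [Measure.restrict_apply_univ]; exact hΩ.measure_lt_top⟩
  refine MemLp.of_bound ha.aestronglyMeasurable B ?_
  filter_upwards [ae_restrict_mem hm] with x hx
  exact hB x (subset_closure hx)

/-- Construction of complex geometrical optics solutions. -/
theorem exists_cgo_solutions {Ω Ω' : Set E3} (hΩ : IsOpen Ω) (hΩb : Bornology.IsBounded Ω)
    {A : E3 → E3} {q : E3 → ℂ} (hq : MemLp q ∞ (volume.restrict Ω))
    {A' : E3 → E3} (hA' : IsLipschitzExtension Ω Ω' A A') {ψ : E3 → ℝ} (hψ : IsMollifier ψ)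
    {α β : E3} (hα : ‖α‖ = 1) (hβ : ‖β‖ = 1) (hαβ : inner ℝ α β = 0) {ζ : ℝ → C3}
    (hζ : ∀ᶠ h in 𝓝[>] (0 : ℝ), cdot (ζ h) (ζ h) = 0)
    (hζO : (fun h => ζ h - zetaZero α β) =O[𝓝[>] (0 : ℝ)] (fun h => h)) :
    ∃ h₀ : ℝ, 0 < h₀ ∧ ∃ (C : ℝ) (Cα : (Fin 3 → ℕ) → ℝ), ∀ h : ℝ, 0 < h → h < h₀ →
      ContDiff ℝ ∞ (amplitude α β ψ A' h) ∧
      (∀ x ∈ Ω, ∑ j, zetaZero α β j * pderiv j (amplitude α β ψ A' h) x =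
        -Complex.I * cdot (zetaZero α β) (toC3 (mollify ψ (h ^ (1 / 3 : ℝ)) A' x)) *
          amplitude α β ψ A' h x) ∧
      (∀ κ : Fin 3 → ℕ,
        eLpNorm (multiDeriv κ (amplitude α β ψ A' h)) ∞ (volume.restrict Ω) ≤
          ENNReal.ofReal (Cα κ * h ^ (-((∑ j, κ j : ℕ) : ℝ) / 3))) ∧
      ∃ r : E3 → ℂ, MemH1 Ω r ∧
        h1sclNorm Ω h r ≤ ENNReal.ofReal (C * h ^ (1 / 3 : ℝ)) ∧
        MemH1 Ω (fun x => Complex.exp (cdot (toC3 x) (ζ h) / (h : ℂ)) *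
          (amplitude α β ψ A' h x + r x)) ∧
        IsWeakSolution Ω A q (fun x => Complex.exp (cdot (toC3 x) (ζ h) / (h : ℂ)) *
          (amplitude α β ψ A' h x + r x)) := by
  obtain ⟨K, hK⟩ := hA'.lipschitz
  have hAc := hA'.hasCompactSupport
  have hAcont := hK.continuous
  obtain ⟨_, B, -, hB, -⟩ := exists_bound_of_hasCompactSupport hAcont hAc
  -- The Carleman estimate requires coefficients bounded at every point of space, so q is replaced
  -- by a representative that is measurable and bounded everywhere.
  obtain ⟨q', Q, hq'm, hQ, hqq'⟩ := exists_bounded_representative hq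
  obtain ⟨R₁, hR₁, hΩR⟩ : ∃ R₁ : ℝ, 0 < R₁ ∧ Ω ⊆ Metric.ball 0 R₁ := by
    obtain ⟨R, hR⟩ := hΩb.subset_ball 0
    exact ⟨max R 1, lt_max_of_lt_right one_pos, hR.trans (Metric.ball_subset_ball (le_max_left _ _))⟩
  obtain ⟨L, hL, hLb⟩ := hζO.exists_pos
  obtain ⟨h₁, hh₁, hev⟩ := mem_nhdsGT_iff_exists_Ioo_subset.1 (hζ.and hLb.bound)
  obtain ⟨C, h₂, hC, hh₂, hh₂1, hrem⟩ := exists_cgo_remainder hψ hα hβ hαβ hK hAc hq'm hQ hR₁ hL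
  choose D hD using exists_bound_multiDeriv_exp_Phi hψ hα hβ hαβ hAcont hAc R₁
  refine ⟨min h₁ h₂, lt_min hh₁ hh₂, 4 * C, D, fun h hh hhlt => ?_⟩
  obtain ⟨hζh, hζL⟩ := hev ⟨hh, hhlt.trans_le (min_le_left _ _)⟩
  have hlt2 : h < h₂ := hhlt.trans_le (min_le_right _ _)
  have hε : 0 < h ^ (1 / 3 : ℝ) := Real.rpow_pos_of_pos hh _
  have hε1 : h ^ (1 / 3 : ℝ) ≤ 1 := Real.rpow_le_one hh.le (hlt2.le.trans hh₂1) (by norm_num)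
  have has : ContDiff ℝ ∞ (amplitude α β ψ A' h) := contDiff_exp_Phi hψ hα hβ hαβ hε hAcont hAc
  refine ⟨has, fun x _ => ?_, fun κ => ?_, ?_⟩
  · rw [← sourceMap_apply]
    exact transport_exp_Phi hψ hα hβ hαβ hε hAcont hAc x
  · rw [eLpNorm_exponent_top]
    refine eLpNormEssSup_le_of_ae_bound ?_
    filter_upwards [ae_restrict_mem hΩ.measurableSet] with x hx
    refine (hD κ _ hε hε1 x (mem_ball_zero_iff.1 (hΩR hx)).le).trans (le_of_eq ?_)
    rw [← Real.rpow_neg hh.le, ← Real.rpow_natCast, ← Real.rpow_mul hh.le]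
    congr 2
    ring
  · rw [Real.norm_of_nonneg hh.le] at hζL
    obtain ⟨r, G, hr, hrn, hG, hGn, heq⟩ := hrem h hh hlt2 (ζ h) hζh hζL Ω hΩR
    have hrm : MemLp r 2 (volume.restrict Ω) := hr.restrict _
    have hGm : ∀ j, MemLp (G j) 2 (volume.restrict Ω) := fun j => (hGn j).1.restrict _
    have ham := memLp_restrict_of_continuous hΩb hΩ.measurableSet has.continuous
    have hdam := fun j => memLp_restrict_of_continuous hΩb hΩ.measurableSet (has.pderiv j).continuous
    refine ⟨r, ⟨hrm, G, hG, hGm⟩, ?_, ?_⟩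
    · rw [mul_assoc]
      exact h1sclNorm_le hh.le hr hG (fun j => (hGn j).1) hrn fun j => (hGn j).2
    · exact isWeakSolution_phase_mul (B := B.toNNReal) hΩ hΩR hK
        (fun x => (hB x).trans (Real.le_coe_toNNReal B)) hA'.ae_eq hq'm hQ hqq' hζh
        (ham.add hrm) (fun j => (hdam j).add (hGm j))
        (fun j => (hasWeakPartial_of_contDiff has j).add' (hG j)) heq

/-! ### Lipschitz extension of W^{1,∞} fields. -/

/-- Mollification preserves bounds on weak derivatives in the interior. -/
lemma abs_pderiv_molli_le {Ω : Set E3} (hΩ : MeasurableSet Ω) {j : Fin 3} {u v : E3 → ℝ} {M : ℝ}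
    (h : HasWeakPartial Ω j u v) (hv : ∀ᵐ x ∂(volume.restrict Ω), |v x| ≤ M)
    (hu : LocallyIntegrable (Ω.indicator u)) {n : ℕ} {x : E3}
    (hx : Metric.closedBall x (1 / (n + 1)) ⊆ Ω) :
    |pderiv j (molli n (Ω.indicator u)) x| ≤ M := by
  have hηd : Differentiable ℝ (eta n) := (contDiff_eta n).differentiable (by simp)
  have hts : tsupport (fun t => eta n (x - t)) ⊆ Metric.closedBall x (1 / (n + 1)) := by
    refine closure_minimal (fun t ht => ?_) Metric.isClosed_closedBall
    have h1 : x - t ∈ tsupport (eta n) := subset_tsupport _ ht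
    rw [tsupport_eta, mem_closedBall_zero_iff] at h1
    rwa [Metric.mem_closedBall, dist_comm, dist_eq_norm]
  have hφ : IsTestFunction Ω (fun t => eta n (x - t)) :=
    ⟨(contDiff_eta n).comp (contDiff_const.sub contDiff_id),
      (hasCompactSupport_eta n).comp_homeomorph (Homeomorph.subLeft x), hts.trans hx⟩
  have hint : Integrable (fun t => eta n (x - t)) := integrable_eta_sub n x
  have e1 : pderiv j (molli n (Ω.indicator u)) x = ∫ t in Ω, eta n (x - t) * v t := by
    rw [pderiv_molli n hu]
    have e2 := h.2.2 _ hφ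
    simp only [smul_eq_mul, pderiv_comp_sub_left hηd] at e2
    have e3 : ∫ t, Ω.indicator u t * pderiv j (eta n) (x - t) =
        ∫ t in Ω, u t * pderiv j (eta n) (x - t) := by
      rw [← integral_indicator hΩ]
      refine integral_congr_ae (Eventually.of_forall fun t => ?_)
      by_cases ht : t ∈ Ω <;> simp [ht]
    rw [e3, ← neg_inj, ← e2, ← integral_neg]
    refine integral_congr_ae (Eventually.of_forall fun t => ?_)
    simp only
    ring
  -- A negative M would force Ω to be null, but Ω contains a ball of positive measure.
  have hM : 0 ≤ M := by
    by_contra hneg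
    have h0 : ∀ᵐ x ∂(volume.restrict Ω), False := hv.mono fun y hy =>
      absurd (abs_nonneg (v y)) (not_le.2 (hy.trans_lt (not_le.1 hneg)))
    have h1 : volume Ω = 0 := by
      rw [ae_iff] at h0
      simpa using h0
    have h2 := measure_mono_null hx h1
    exact (Metric.measure_closedBall_pos volume x (by positivity : (0 : ℝ) < 1 / (n + 1))).ne' h2
  rw [e1, ← Real.norm_eq_abs]
  calc _ ≤ ∫ t in Ω, eta n (x - t) * M := by
        refine norm_integral_le_of_norm_le (hint.restrict.mul_const M) ?_
        filter_upwards [hv] with t ht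
        rw [norm_mul, Real.norm_of_nonneg (eta_nonneg n _)]
        exact mul_le_mul_of_nonneg_left ht (eta_nonneg n _)
    _ = (∫ t in Ω, eta n (x - t)) * M := integral_mul_const _ _
    _ ≤ 1 * M := by
        refine mul_le_mul_of_nonneg_right ?_ hM
        rw [← integral_eta_sub n x]
        exact setIntegral_le_integral hint (Eventually.of_forall fun t => eta_nonneg n _)
    _ = M := one_mul M

/-- A segment in Ω is compact, so for large n the mollification uses only values in Ω and the weak
gradient bound holds along it. The 3 comes from adding the partial derivatives. -/
lemma eventually_abs_molli_sub_le {Ω : Set E3} (hΩ : IsOpen Ω) {u : E3 → ℝ} {v : Fin 3 → E3 → ℝ}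
    {M : ℝ} (h : HasWeakGradient Ω u v)
    (hv : ∀ j, ∀ᵐ x ∂(volume.restrict Ω), |v j x| ≤ M)
    (hu : LocallyIntegrable (Ω.indicator u)) {x y : E3} (hxy : segment ℝ x y ⊆ Ω) :
    ∀ᶠ n in atTop, |molli n (Ω.indicator u) x - molli n (Ω.indicator u) y| ≤
      3 * M * ‖x - y‖ := by
  have hcomp : IsCompact (segment ℝ x y) := by
    rw [segment_eq_image_lineMap]
    exact isCompact_Icc.image (by fun_prop)
  obtain ⟨δ, hδ, hδΩ⟩ := hcomp.exists_cthickening_subset_open hΩ hxy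
  have hev : ∀ᶠ n : ℕ in atTop, (1 : ℝ) / (n + 1) ≤ δ :=
    (tendsto_one_div_add_atTop_nhds_zero_nat (𝕜 := ℝ)).eventually_le_const hδ
  filter_upwards [hev] with n hn
  rw [← Real.norm_eq_abs]
  refine (convex_segment x y).norm_image_sub_le_of_norm_fderiv_le (𝕜 := ℝ)
    (fun z _ => (contDiff_molli n hu).differentiable (by simp) z) (fun z hz => ?_)
    (right_mem_segment ℝ x y) (left_mem_segment ℝ x y)
  have hball : Metric.closedBall z (1 / (n + 1)) ⊆ Ω := fun w hw =>
    hδΩ (Metric.mem_cthickening_of_dist_le w z δ _ hz ((Metric.mem_closedBall.1 hw).trans hn))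
  refine (norm_fderiv_le_sum _ z).trans ((Finset.sum_le_card_nsmul _ _ M fun j _ => ?_).trans ?_)
  · exact abs_pderiv_molli_le hΩ.measurableSet (h j) (hv j) hu hball
  · simp

/-- The value of a weakly differentiable function at its mollification limits changes along
polygonal paths by at most the gradient bound times the length. -/
lemma abs_sub_le_of_path {Ω : Set E3} (hΩ : IsOpen Ω) {u : E3 → ℝ} {v : Fin 3 → E3 → ℝ}
    {M : ℝ} (h : HasWeakGradient Ω u v)
    (hv : ∀ j, ∀ᵐ x ∂(volume.restrict Ω), |v j x| ≤ M)
    (hu : LocallyIntegrable (Ω.indicator u)) {x y x' y' : E3}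
    (hx : Tendsto (fun n => molli n (Ω.indicator u) x) atTop (𝓝 (u x)))
    (hy : Tendsto (fun n => molli n (Ω.indicator u) y) atTop (𝓝 (u y)))
    (h1 : segment ℝ x x' ⊆ Ω) (h2 : segment ℝ x' y' ⊆ Ω) (h3 : segment ℝ y' y ⊆ Ω) :
    |u x - u y| ≤ 3 * M * (‖x - x'‖ + ‖x' - y'‖ + ‖y' - y‖) := by
  refine le_of_tendsto (hx.sub hy).abs ?_
  filter_upwards [eventually_abs_molli_sub_le hΩ h hv hu h1,
    eventually_abs_molli_sub_le hΩ h hv hu h2, eventually_abs_molli_sub_le hΩ h hv hu h3]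
    with n e1 e2 e3
  have t1 := abs_sub_le (molli n (Ω.indicator u) x) (molli n (Ω.indicator u) x')
    (molli n (Ω.indicator u) y)
  have t2 := abs_sub_le (molli n (Ω.indicator u) x') (molli n (Ω.indicator u) y')
    (molli n (Ω.indicator u) y)
  rw [mul_add, mul_add]
  linarith

/-- Points of a smooth domain close to a boundary point are joined by short polygonal paths. -/
lemma exists_path_near_frontier {Ω : Set E3} (hΩ : IsSmoothBoundedDomain Ω) {p : E3}
    (hp : p ∈ frontier Ω) : ∃ C δ : ℝ, 0 ≤ C ∧ 0 < δ ∧ ∀ x ∈ Metric.ball p δ, ∀ y ∈ Metric.ball p δ,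
      x ∈ Ω → y ∈ Ω → ∃ x' y' : E3, segment ℝ x x' ⊆ Ω ∧ segment ℝ x' y' ⊆ Ω ∧
        segment ℝ y' y ⊆ Ω ∧ ‖x - x'‖ + ‖x' - y'‖ + ‖y' - y‖ ≤ C * ‖x - y‖ := by
  obtain ⟨U, ρ, hU, hpU, hρ, hρ0, hiff⟩ := hΩ.smooth_boundary p hp
  set D := fderiv ℝ ρ p with hD
  obtain ⟨e, he⟩ : ∃ e, D e = 1 := by
    obtain ⟨e0, he0⟩ : ∃ e0, D e0 ≠ 0 := by
      by_contra hcon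
      push Not at hcon
      exact hρ0 (ContinuousLinearMap.ext hcon)
    exact ⟨(D e0)⁻¹ • e0, by rw [map_smul, smul_eq_mul, inv_mul_cancel₀ he0]⟩
  have he0 : 0 < ‖e‖ := norm_pos_iff.2 fun h => by simp [h] at he
  -- Since D e = 1 and the linearisation error over t e is at most η t‖e‖ = t/2, moving by -t e
  -- lowers ρ by at least t/2.
  set η : ℝ := 1 / (2 * ‖e‖) with hη
  have hη0 : 0 < η := by positivity
  have hηe : η * ‖e‖ = 1 / 2 := by rw [hη]; field_simp
  have hstrict : HasStrictFDerivAt ρ D p := hρ.contDiffAt.hasStrictFDerivAt (by simp)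
  obtain ⟨s, hs, happ⟩ := hstrict.approximates_deriv_on_nhds (c := η.toNNReal)
    (Or.inr (Real.toNNReal_pos.2 hη0))
  obtain ⟨δ₀, hδ₀, hball⟩ := Metric.mem_nhds_iff.1 (inter_mem hs (hU.mem_nhds hpU))
  have happ' : ∀ z ∈ Metric.ball p δ₀, ∀ w ∈ Metric.ball p δ₀,
      |ρ z - ρ w - D (z - w)| ≤ η * ‖z - w‖ := fun z hz w hw => by
    have := happ _ (hball hz).1 _ (hball hw).1
    rwa [Real.coe_toNNReal _ hη0.le, Real.norm_eq_abs] at this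
  have hin : ∀ z ∈ Metric.ball p δ₀, ρ z < 0 → z ∈ Ω := fun z hz h => (hiff z (hball hz).2).2 h
  have hin' : ∀ z ∈ Metric.ball p δ₀, z ∈ Ω → ρ z < 0 := fun z hz h => (hiff z (hball hz).2).1 h
  -- Descending by kd lowers ρ by at least (‖D‖ + η)d, which is the most that a displacement of
  -- length d can raise it. The cross segment at that depth therefore stays in {ρ < 0}.
  set k : ℝ := 2 * (‖D‖ + η) with hk
  have hk0 : 0 < k := by positivity
  set C := 2 * (k * ‖e‖) + 1 with hC
  have hC0 : 0 < C := by positivity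
  -- C adds two vertical legs of length kd‖e‖ to the cross segment of length d. As d < 2δ, the
  -- radius δ with δ + 2Cδ = δ₀ keeps the whole path in the ball where the linearisation is valid.
  refine ⟨C, δ₀ / (2 * C + 1), hC0.le, by positivity, fun x hx y hy hxΩ hyΩ => ?_⟩
  set δ := δ₀ / (2 * C + 1) with hδ
  have hδpos : 0 < δ := by positivity
  have hδe : δ + 2 * C * δ = δ₀ := by rw [hδ]; field_simp; ring
  set d := ‖x - y‖ with hd
  have hd0 : 0 ≤ d := norm_nonneg _
  have hxp : ‖x - p‖ < δ := by rwa [← dist_eq_norm]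
  have hyp : ‖y - p‖ < δ := by rwa [← dist_eq_norm]
  have hd2 : d < 2 * δ := by
    calc d = ‖(x - p) - (y - p)‖ := by rw [hd]; congr 1; abel
      _ ≤ ‖x - p‖ + ‖y - p‖ := norm_sub_le _ _
      _ < 2 * δ := by linarith
  have hCd : C * d ≤ 2 * C * δ := by nlinarith
  have down : ∀ z, ‖z - p‖ < δ → z ∈ Ω → ∀ t, 0 ≤ t → t ≤ k * d →
      z - t • e ∈ Metric.ball p δ₀ ∧ ρ (z - t • e) ≤ ρ z - t / 2 ∧ ρ z < 0 := by
    intro z hz hzΩ t ht htk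
    have hzb : z ∈ Metric.ball p δ₀ := by
      rw [Metric.mem_ball, dist_eq_norm]
      nlinarith
    have hte : t * ‖e‖ ≤ C * d := by
      have : t * ‖e‖ ≤ k * d * ‖e‖ := mul_le_mul_of_nonneg_right htk he0.le
      rw [hC]
      nlinarith [mul_nonneg (mul_nonneg hk0.le hd0) he0.le]
    have hb : z - t • e ∈ Metric.ball p δ₀ := by
      rw [Metric.mem_ball, dist_eq_norm]
      calc ‖z - t • e - p‖ = ‖(z - p) - t • e‖ := by congr 1; abel
        _ ≤ ‖z - p‖ + ‖t • e‖ := norm_sub_le _ _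
        _ < δ + 2 * C * δ := by
            rw [norm_smul, Real.norm_of_nonneg ht]
            linarith
        _ = δ₀ := hδe
    refine ⟨hb, ?_, hin' z hzb hzΩ⟩
    have h1 := happ' _ hb z hzb
    rw [sub_sub_cancel_left, map_neg, map_smul, he, norm_neg, norm_smul, Real.norm_of_nonneg ht,
      smul_eq_mul, mul_one] at h1
    have h2 := (abs_le.1 h1).2
    have h3 : η * (t * ‖e‖) = t / 2 := by
      calc η * (t * ‖e‖) = t * (η * ‖e‖) := by ring
        _ = t / 2 := by rw [hηe]; ring
    linarith
  have vert : ∀ z, ‖z - p‖ < δ → z ∈ Ω → segment ℝ z (z - (k * d) • e) ⊆ Ω := by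
    intro z hz hzΩ w hw
    rw [segment_eq_image'] at hw
    obtain ⟨θ, ⟨hθ0, hθ1⟩, rfl⟩ := hw
    have hkd : 0 ≤ k * d := by positivity
    obtain ⟨g1, g2, g3⟩ := down z hz hzΩ (θ * (k * d)) (by positivity) (by nlinarith)
    have e1 : z + θ • (z - (k * d) • e - z) = z - (θ * (k * d)) • e := by module
    simp only [e1]
    refine hin _ g1 ?_
    have : 0 ≤ θ * (k * d) := by positivity
    linarith
  refine ⟨x - (k * d) • e, y - (k * d) • e, vert x hxp hxΩ, ?_, ?_, ?_⟩
  · intro w hw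
    rw [segment_eq_image'] at hw
    obtain ⟨θ, ⟨hθ0, hθ1⟩, rfl⟩ := hw
    obtain ⟨g1, g2, g3⟩ := down x hxp hxΩ (k * d) (by positivity) le_rfl
    simp only
    set w := x - (k * d) • e + θ • (y - (k * d) • e - (x - (k * d) • e)) with hw
    have e1 : w - (x - (k * d) • e) = θ • (y - x) := by rw [hw]; module
    have e2 : ‖w - (x - (k * d) • e)‖ ≤ d := by
      rw [e1, norm_smul, Real.norm_of_nonneg hθ0, norm_sub_rev, ← hd]
      nlinarith
    have hwb : w ∈ Metric.ball p δ₀ := by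
      rw [Metric.mem_ball, dist_eq_norm]
      calc ‖w - p‖ = ‖(x - p) + (w - (x - (k * d) • e)) - (k * d) • e‖ := by congr 1; abel
        _ ≤ ‖x - p‖ + ‖w - (x - (k * d) • e)‖ + ‖(k * d) • e‖ :=
            (norm_sub_le _ _).trans (add_le_add_left (norm_add_le _ _) _)
        _ < δ + C * d := by
            rw [norm_smul, Real.norm_of_nonneg (by positivity : 0 ≤ k * d), hC]
            nlinarith [mul_nonneg (mul_nonneg hk0.le hd0) he0.le]
        _ ≤ δ₀ := by linarith
    refine hin _ hwb ?_
    have h1 := (abs_le.1 (happ' w hwb _ g1)).2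
    have h2 : D (w - (x - (k * d) • e)) ≤ ‖D‖ * ‖w - (x - (k * d) • e)‖ :=
      (le_abs_self _).trans (D.le_opNorm _)
    have h3 : ρ w ≤ ρ (x - (k * d) • e) + (‖D‖ + η) * ‖w - (x - (k * d) • e)‖ := by linarith
    have h4 : (‖D‖ + η) * ‖w - (x - (k * d) • e)‖ ≤ (‖D‖ + η) * d :=
      mul_le_mul_of_nonneg_left e2 (by positivity)
    have h5 : k * d / 2 = (‖D‖ + η) * d := by rw [hk]; ring
    linarith
  · rw [segment_symm]
    exact vert y hyp hyΩ
  · have e1 : x - (x - (k * d) • e) = (k * d) • e := by module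
    have e2 : x - (k * d) • e - (y - (k * d) • e) = x - y := by module
    have e3 : y - (k * d) • e - y = -((k * d) • e) := by module
    rw [e1, e2, e3, norm_neg, norm_smul, Real.norm_of_nonneg (by positivity : 0 ≤ k * d), hC, ← hd]
    linarith

/-- A real function which is bounded along short paths is Lipschitz on a smooth bounded domain. -/
lemma exists_lipschitz_of_path {Ω S : Set E3} (hΩ : IsSmoothBoundedDomain Ω) (hS : S ⊆ Ω)
    {u : E3 → ℝ} {B M : ℝ} (hB : ∀ x ∈ S, |u x| ≤ B) (hM : 0 ≤ M)
    (hpath : ∀ x ∈ S, ∀ y ∈ S, ∀ x' y', segment ℝ x x' ⊆ Ω → segment ℝ x' y' ⊆ Ω →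
      segment ℝ y' y ⊆ Ω → |u x - u y| ≤ M * (‖x - x'‖ + ‖x' - y'‖ + ‖y' - y‖)) :
    ∃ L : ℝ, 0 ≤ L ∧ ∀ x ∈ S, ∀ y ∈ S, |u x - u y| ≤ L * ‖x - y‖ := by
  -- Being Lipschitz on the pairs of a set is stable under finite unions, so by compactness it
  -- suffices to treat neighbourhoods of single pairs: diagonal pairs by short paths, other pairs by
  -- boundedness.
  have hcomp : IsCompact (closure Ω ×ˢ closure Ω) :=
    hΩ.isBounded.isCompact_closure.prod hΩ.isBounded.isCompact_closure
  have key := hcomp.induction_on (p := fun T : Set (E3 × E3) => ∃ L : ℝ, 0 ≤ L ∧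
    ∀ z ∈ T, z.1 ∈ S → z.2 ∈ S → |u z.1 - u z.2| ≤ L * ‖z.1 - z.2‖) ?_ ?_ ?_ ?_
  · obtain ⟨L, hL, h⟩ := key
    exact ⟨L, hL, fun x hx y hy =>
      h (x, y) ⟨subset_closure (hS hx), subset_closure (hS hy)⟩ hx hy⟩
  · exact ⟨0, le_rfl, fun z hz => absurd hz (notMem_empty z)⟩
  · rintro s t hst ⟨L, hL, h⟩
    exact ⟨L, hL, fun z hz => h z (hst hz)⟩
  · rintro s t ⟨L, hL, h⟩ ⟨L', hL', h'⟩
    refine ⟨max L L', hL.trans (le_max_left _ _), fun z hz h1 h2 => ?_⟩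
    rcases hz with hz | hz
    · exact (h z hz h1 h2).trans
        (mul_le_mul_of_nonneg_right (le_max_left _ _) (norm_nonneg _))
    · exact (h' z hz h1 h2).trans
        (mul_le_mul_of_nonneg_right (le_max_right _ _) (norm_nonneg _))
  · rintro ⟨p, p'⟩ ⟨hp, hp'⟩
    rcases eq_or_ne p p' with rfl | hne
    · have near : ∃ C δ : ℝ, 0 ≤ C ∧ 0 < δ ∧ ∀ x ∈ Metric.ball p δ, ∀ y ∈ Metric.ball p δ,
          x ∈ Ω → y ∈ Ω → ∃ x' y' : E3, segment ℝ x x' ⊆ Ω ∧ segment ℝ x' y' ⊆ Ω ∧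
          segment ℝ y' y ⊆ Ω ∧ ‖x - x'‖ + ‖x' - y'‖ + ‖y' - y‖ ≤ C * ‖x - y‖ := by
        by_cases hpΩ : p ∈ Ω
        · obtain ⟨δ, hδ, hball⟩ := Metric.isOpen_iff.1 hΩ.isOpen p hpΩ
          refine ⟨1, δ, zero_le_one, hδ, fun x hx y hy hxΩ hyΩ => ⟨x, y, ?_, ?_, ?_, ?_⟩⟩
          · rw [segment_same]; exact singleton_subset_iff.2 hxΩ
          · exact ((convex_ball p δ).segment_subset hx hy).trans hball
          · rw [segment_same]; exact singleton_subset_iff.2 hyΩ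
          · simp
        · refine exists_path_near_frontier hΩ ⟨hp, ?_⟩
          rwa [hΩ.isOpen.interior_eq]
      obtain ⟨C, δ, hC, hδ, h⟩ := near
      refine ⟨Metric.ball p δ ×ˢ Metric.ball p δ, mem_nhdsWithin_of_mem_nhds
        (prod_mem_nhds (Metric.ball_mem_nhds p hδ) (Metric.ball_mem_nhds p hδ)), M * C,
        by positivity, fun z hz h1 h2 => ?_⟩
      obtain ⟨x', y', s1, s2, s3, hlen⟩ := h z.1 hz.1 z.2 hz.2 (hS h1) (hS h2)
      refine (hpath _ h1 _ h2 x' y' s1 s2 s3).trans ?_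
      rw [mul_assoc]
      exact mul_le_mul_of_nonneg_left hlen hM
    · set d := ‖p - p'‖ with hd
      have hd0 : 0 < d := norm_pos_iff.2 (sub_ne_zero.2 hne)
      have hopen : IsOpen {z : E3 × E3 | d / 2 < ‖z.1 - z.2‖} :=
        isOpen_lt continuous_const (by fun_prop)
      refine ⟨{z | d / 2 < ‖z.1 - z.2‖}, mem_nhdsWithin_of_mem_nhds
        (hopen.mem_nhds (half_lt_self hd0 : d / 2 < d)), 4 * |B| / d, by positivity,
        fun z hz h1 h2 => ?_⟩
      have hz' : d / 2 < ‖z.1 - z.2‖ := hz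
      have h3 : |u z.1 - u z.2| ≤ |B| + |B| := (abs_sub _ _).trans
        (add_le_add ((hB _ h1).trans (le_abs_self B)) ((hB _ h2).trans (le_abs_self B)))
      refine h3.trans ?_
      have e : |B| + |B| = 4 * |B| / d * (d / 2) := by field_simp; ring
      rw [e]
      exact mul_le_mul_of_nonneg_left hz'.le (by positivity)

/-- Real functions in `W^{1,∞}` of a smooth bounded domain are Lipschitz off a null set. -/
lemma exists_lipschitz_off_null {Ω : Set E3} (hΩ : IsSmoothBoundedDomain Ω) {u : E3 → ℝ}
    {v : Fin 3 → E3 → ℝ} {B M : ℝ} (h : HasWeakGradient Ω u v)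
    (hum : AEStronglyMeasurable u (volume.restrict Ω))
    (huB : ∀ᵐ x ∂(volume.restrict Ω), |u x| ≤ B) (hM : 0 ≤ M)
    (hv : ∀ j, ∀ᵐ x ∂(volume.restrict Ω), |v j x| ≤ M) :
    ∃ (S : Set E3) (L : ℝ), S ⊆ Ω ∧ (∀ᵐ x ∂(volume.restrict Ω), x ∈ S) ∧ 0 ≤ L ∧
      (∀ x ∈ S, |u x| ≤ B) ∧ ∀ x ∈ S, ∀ y ∈ S, |u x - u y| ≤ L * ‖x - y‖ := by
  have hm := hΩ.isOpen.measurableSet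
  have : IsFiniteMeasure (volume.restrict Ω) :=
    ⟨by rw [Measure.restrict_apply_univ]; exact hΩ.isBounded.measure_lt_top⟩
  have hui : IntegrableOn u Ω := (MemLp.of_bound hum B huB).integrable le_top
  have hu : LocallyIntegrable (Ω.indicator u) := ((integrable_indicator_iff hm).2 hui).locallyIntegrable
  -- These are the points at which the mollifications recover the value of u. They have full measure
  -- in Ω, and the path estimate passes to the limit there.
  set S : Set E3 := {x | x ∈ Ω ∧ |u x| ≤ B ∧
    Tendsto (fun n => molli n (Ω.indicator u) x) atTop (𝓝 (u x))} with hS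
  have hSΩ : S ⊆ Ω := fun x hx => hx.1
  obtain ⟨L, hL, hLip⟩ := exists_lipschitz_of_path (B := B) (M := 3 * M) hΩ hSΩ
    (fun x hx => hx.2.1) (by positivity) fun x hx y hy x' y' h1 h2 h3 =>
      abs_sub_le_of_path hΩ.isOpen h hv hu hx.2.2 hy.2.2 h1 h2 h3
  refine ⟨S, L, hSΩ, ?_, hL, fun x hx => hx.2.1, hLip⟩
  filter_upwards [ae_restrict_mem hm, huB, ae_restrict_of_ae (ae_tendsto_molli hu)] with x h1 h2 h3
  rw [indicator_of_mem h1] at h3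
  exact ⟨h1, h2, h3⟩

lemma locallyIntegrableOn_coord {Ω : Set E3} {f : E3 → E3} (hf : LocallyIntegrableOn f Ω)
    (i : Fin 3) : LocallyIntegrableOn (fun x => f x i) Ω := fun x hx => by
  obtain ⟨s, hs, hi⟩ := hf x hx
  exact ⟨s, hs, (EuclideanSpace.proj (𝕜 := ℝ) i : E3 →L[ℝ] ℝ).integrable_comp hi⟩

lemma HasWeakPartial.coord {Ω : Set E3} {j : Fin 3} {f g : E3 → E3} (h : HasWeakPartial Ω j f g)
    (hf : MemLp f ∞ (volume.restrict Ω)) (hg : MemLp g ∞ (volume.restrict Ω)) (i : Fin 3) :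
    HasWeakPartial Ω j (fun x => f x i) (fun x => g x i) := by
  refine ⟨locallyIntegrableOn_coord h.1 i, locallyIntegrableOn_coord h.2.1 i, fun φ hφ => ?_⟩
  have int : ∀ {w : E3 → E3}, MemLp w ∞ (volume.restrict Ω) → ∀ {χ : E3 → ℝ}, IsTestFunction Ω χ →
      Integrable (fun x => χ x • w x) (volume.restrict Ω) := fun hw χ hχ =>
    memLp_one_iff_integrable.1 (hw.smul ((hχ.memLp 1).restrict Ω))
  have c1 := (EuclideanSpace.proj (𝕜 := ℝ) i : E3 →L[ℝ] ℝ).integral_comp_comm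
    (int hf (hφ.pderiv j))
  have c2 := (EuclideanSpace.proj (𝕜 := ℝ) i : E3 →L[ℝ] ℝ).integral_comp_comm (int hg hφ)
  rw [h.2.2 φ hφ] at c1
  simp only [PiLp.proj_apply, PiLp.smul_apply, PiLp.neg_apply] at c1 c2
  rw [c1, c2]

lemma norm_le_sum_abs_coord (v : E3) : ‖v‖ ≤ ∑ j, |v j| := by
  calc ‖v‖ = ‖∑ j, v j • basisVec j‖ := by rw [sum_smul_basisVec]
    _ ≤ ∑ j, ‖v j • basisVec j‖ := norm_sum_le _ _
    _ = ∑ j, |v j| := by simp [norm_smul, norm_basisVec]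

/-- Vector fields in `W^{1,∞}` of a smooth bounded domain extend to compactly supported Lipschitz
fields. -/
theorem exists_isLipschitzExtension {Ω Ω' : Set E3} (hΩ : IsSmoothBoundedDomain Ω)
    (hΩ' : IsOpen Ω') (hΩΩ' : closure Ω ⊆ Ω') {A : E3 → E3} (hA : MemW1 ∞ Ω A) :
    ∃ A' : E3 → E3, IsLipschitzExtension Ω Ω' A A' := by
  obtain ⟨hAm, G, hG, hGm⟩ := hA
  obtain ⟨B, hB⟩ := exists_ae_norm_le hAm
  choose M hM using fun j => exists_ae_norm_le (hGm j)
  have hM' : ∀ j, (M j : ℝ) ≤ ((∑ j, M j : NNReal) : ℝ) := fun j => by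
    exact_mod_cast Finset.single_le_sum (f := M) (fun _ _ => zero_le) (Finset.mem_univ j)
  have hcomp : ∀ i : Fin 3, ∃ (S : Set E3) (L : ℝ), S ⊆ Ω ∧ (∀ᵐ x ∂(volume.restrict Ω), x ∈ S) ∧
      0 ≤ L ∧ (∀ x ∈ S, |A x i| ≤ B) ∧ ∀ x ∈ S, ∀ y ∈ S, |A x i - A y i| ≤ L * ‖x - y‖ := by
    intro i
    refine exists_lipschitz_off_null hΩ (u := fun x => A x i) (v := fun j x => G j x i)
      (M := ((∑ j, M j : NNReal) : ℝ)) (fun j => (hG j).coord hAm (hGm j) i) ?_ ?_ (NNReal.coe_nonneg _)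
      fun j => ?_
    · exact (EuclideanSpace.proj (𝕜 := ℝ) i : E3 →L[ℝ] ℝ).continuous.comp_aestronglyMeasurable hAm.1
    · filter_upwards [hB] with x hx
      exact (abs_coord_le _ _).trans hx
    · filter_upwards [hM j] with x hx
      exact (abs_coord_le _ _).trans (hx.trans (hM' j))
  choose S L hSΩ hSae hL hSB hSL using hcomp
  set T : Set E3 := ⋂ i, S i with hT
  have hTS : ∀ {x}, x ∈ T → ∀ i, x ∈ S i := fun hx i => mem_iInter.1 hx i
  have hTΩ : T ⊆ Ω := fun x hx => hSΩ 0 (hTS hx 0)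
  have hTae : ∀ᵐ x ∂(volume.restrict Ω), x ∈ T := by
    filter_upwards [ae_all_iff.2 hSae] with x hx
    exact mem_iInter.2 hx
  have hTB : ∀ x ∈ T, ‖A x‖ ≤ 3 * B := fun x hx => by
    refine (norm_le_sum_abs_coord _).trans ((Finset.sum_le_card_nsmul _ _ (B : ℝ) fun i _ =>
      hSB i x (hTS hx i)).trans ?_)
    simp
  have hTL : ∀ x ∈ T, ∀ y ∈ T, ‖A x - A y‖ ≤ (∑ i, L i) * ‖x - y‖ := fun x hx y hy => by
    refine (norm_le_sum_abs_coord _).trans ?_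
    rw [Finset.sum_mul]
    exact Finset.sum_le_sum fun i _ => hSL i x (hTS hx i) y (hTS hy i)
  have hK : IsCompact (closure Ω) := hΩ.isBounded.isCompact_closure
  obtain ⟨δ, hδ, hδΩ⟩ := hK.exists_cthickening_subset_open hΩ' hΩΩ'
  set V := Metric.thickening δ (closure Ω) with hV
  have hΩV : Ω ⊆ V := subset_closure.trans (Metric.self_subset_thickening hδ _)
  set f : E3 → E3 := T.indicator A with hf
  have hfV : ∀ x ∉ V, f x = 0 := fun x hx => indicator_of_notMem (fun h => hx (hΩV (hTΩ h))) _
  have hL0 : 0 ≤ ∑ i, L i := Finset.sum_nonneg fun i _ => hL i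
  -- The first summand handles two points of T. The second handles a point of T and one outside V,
  -- which are at least δ apart while the values are at most 3B.
  set Λ : ℝ := (∑ i, L i) + 3 * B / δ with hΛ
  have hΛ0 : 0 ≤ Λ := by positivity
  have far : ∀ x ∈ T, ∀ y ∉ V, ‖f x‖ ≤ Λ * ‖x - y‖ := fun x hx y hy => by
    have h1 : δ ≤ ‖x - y‖ := by
      by_contra hlt
      refine hy (Metric.mem_thickening_iff.2 ⟨x, subset_closure (hTΩ hx), ?_⟩)
      rw [dist_comm, dist_eq_norm]
      exact not_le.1 hlt
    rw [hf, indicator_of_mem hx]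
    calc ‖A x‖ ≤ 3 * B := hTB x hx
      _ = 3 * B / δ * δ := by field_simp
      _ ≤ 3 * B / δ * ‖x - y‖ := by gcongr
      _ ≤ Λ * ‖x - y‖ := by
          refine mul_le_mul_of_nonneg_right ?_ (norm_nonneg _)
          exact le_add_of_nonneg_left hL0
  have hLip : LipschitzOnWith Λ.toNNReal f (T ∪ Vᶜ) := by
    refine LipschitzOnWith.of_dist_le_mul fun x hx y hy => ?_
    rw [Real.coe_toNNReal _ hΛ0, dist_eq_norm, dist_eq_norm]
    by_cases hxV : x ∈ V <;> by_cases hyV : y ∈ V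
    · have hxT : x ∈ T := hx.resolve_right fun h => h hxV
      have hyT : y ∈ T := hy.resolve_right fun h => h hyV
      rw [hf, indicator_of_mem hxT, indicator_of_mem hyT]
      refine (hTL x hxT y hyT).trans (mul_le_mul_of_nonneg_right ?_ (norm_nonneg _))
      exact le_add_of_nonneg_right (by positivity)
    · rw [hfV y hyV, sub_zero]
      exact far x (hx.resolve_right fun h => h hxV) y hyV
    · rw [hfV x hxV, zero_sub, norm_neg, norm_sub_rev]
      exact far y (hy.resolve_right fun h => h hyV) x hxV
    · rw [hfV x hxV, hfV y hyV, sub_zero, norm_zero]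
      positivity
  -- Including the complement of V in the domain, with value 0, forces every extension to have
  -- compact support near the closure of Ω.
  obtain ⟨g, hg, hfg⟩ := hLip.extend_finite_dimension
  have hg0 : ∀ x ∉ V, g x = 0 := fun x hx => by rw [← hfg (Or.inr hx), hfV x hx]
  have hts : tsupport g ⊆ Metric.cthickening δ (closure Ω) := by
    refine closure_minimal (fun x hx => ?_) Metric.isClosed_cthickening
    by_contra hx'
    exact hx (hg0 x fun h => hx' (Metric.thickening_subset_cthickening _ _ h))
  refine ⟨g, ⟨_, hg⟩, hK.cthickening.of_isClosed_subset (isClosed_tsupport _) hts,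
    hts.trans hδΩ, ?_⟩
  filter_upwards [hTae] with x hx
  rw [← hfg (Or.inl hx), hf, indicator_of_mem hx]

end MagneticCGO

end

theorem mainTheorem8
    (Ω Ω' : Set E3) (hΩ : IsSmoothBoundedDomain Ω)
    (hΩ'_open : IsOpen Ω') (hΩ'_bdd : Bornology.IsBounded Ω') (hΩΩ' : closure Ω ⊆ Ω')
    (A : E3 → E3) (hA : MemW1 ∞ Ω A)
    (q : E3 → ℂ) (hq : MemLp q ∞ (volume.restrict Ω)) :
    (∃ A' : E3 → E3, IsLipschitzExtension Ω Ω' A A') ∧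
    ∀ A' : E3 → E3, IsLipschitzExtension Ω Ω' A A' →
    ∀ ψ : E3 → ℝ, IsMollifier ψ →
    ∀ α β : E3, ‖α‖ = 1 → ‖β‖ = 1 → inner ℝ α β = 0 →
    ∀ ζ : ℝ → C3, (∀ᶠ h in 𝓝[>] (0 : ℝ), cdot (ζ h) (ζ h) = 0) →
      (fun h => ζ h - zetaZero α β) =O[𝓝[>] (0 : ℝ)] (fun h => h) →
    ∃ h₀ : ℝ, 0 < h₀ ∧ ∃ (C : ℝ) (Cα : (Fin 3 → ℕ) → ℝ), ∀ h : ℝ, 0 < h → h < h₀ →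
      ContDiff ℝ ∞ (amplitude α β ψ A' h) ∧
      (∀ x ∈ Ω, ∑ j, zetaZero α β j * pderiv j (amplitude α β ψ A' h) x =
        -Complex.I * cdot (zetaZero α β) (toC3 (mollify ψ (h ^ (1 / 3 : ℝ)) A' x)) *
          amplitude α β ψ A' h x) ∧
      (∀ κ : Fin 3 → ℕ,
        eLpNorm (multiDeriv κ (amplitude α β ψ A' h)) ∞ (volume.restrict Ω) ≤
          ENNReal.ofReal (Cα κ * h ^ (-((∑ j, κ j : ℕ) : ℝ) / 3))) ∧
      ∃ r : E3 → ℂ, MemH1 Ω r ∧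
        h1sclNorm Ω h r ≤ ENNReal.ofReal (C * h ^ (1 / 3 : ℝ)) ∧
        MemH1 Ω (fun x => Complex.exp (cdot (toC3 x) (ζ h) / (h : ℂ)) *
          (amplitude α β ψ A' h x + r x)) ∧
        IsWeakSolution Ω A q (fun x => Complex.exp (cdot (toC3 x) (ζ h) / (h : ℂ)) *
          (amplitude α β ψ A' h x + r x)) := by
  refine ⟨exists_isLipschitzExtension hΩ hΩ'_open hΩΩ' hA, ?_⟩
  intro A' hA' ψ hψ α β hα hβ hαβ ζ hζ hζO
  exact exists_cgo_solutions hΩ.isOpen hΩ.isBounded hq hA' hψ hα hβ hαβ hζ hζO
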